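/- Let $p,q\in(0,1)$, $\theta\in\mathbb{R}$ and $\beta\in\mathbb{N}_0$. All algebras are unital complex $*$-algebras; write $x^{-n}:=(x^*)^n$ for $n>0$, and $[n]_p=1+p+\dots+p^{n-1}$, $[n]_p!=[1]_p\cdots[n]_p$, $\binom{n}{m}_p=\frac{[n]_p!}{[m]_p!\,[n-m]_p!}$. **Algebras.** $\vartheta(D_p\times_\theta S^1)$ is the $*$-algebra generated by $x,h$ with relations $$hh^*=1=h^*h,\quad x^*x-pxx^*=1-p,\quad hx=e^{i\theta}xh,\quad hx^*=e^{-i\theta}x^*h;$$ the generators of $\vartheta(D_q\times_\theta S^1)$ (same relations with $p$ replaced by $q$) are denoted $y,g$. $\vartheta(T_\theta)$ is the $*$-algebra generated by unitaries $U,V$ with $UV=e^{i\theta}VU$ and $UV^*=e^{-i\theta}V^*U$. $\vartheta(D_p)$ is the $*$-algebra generated by $x$ with $x^*x-pxx^*=1-p$ (the generator of $\vartheta(D_q)$ is denoted $y$). $\vartheta(S^1)$ is the $*$-algebra generated by one unitary $V$, and $H=\vartheta(U(1))=\mathbb{C}[u,u^{-1}]$ is the Hopf $*$-algebra generated by one unitary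 group-like element $u$. $\vartheta(L^{p,q,\theta}_\beta)$ is the $*$-algebra generated by $\xi,z,a,b$ with the relations, where $\eta:=1-zz^*-\xi$, $$\xi^*=\xi,\quad \xi z=pz\xi,\quad z^*z-qzz^*=1-q-(p-q)\xi,\quad \eta\xi=0,$$ $$\xi a=p^\beta a\xi,\quad \xi b=b\xi,\quad za=e^{-i\theta}az,\quad zb=e^{i\theta}bz,$$ $$za^*-e^{i\theta}a^*z=(p^\beta-1)\xi z^{1-\beta}b,\qquad z^*b-e^{-i\theta}bz^*=(1-q^\beta)z^{\beta-1}\eta a^*,$$ $$ab=e^{i\beta\theta}ba,\quad ab^*=e^{-i\beta\theta}b^*a,\quad ba=z^\beta,$$ $$a^*a=\sum_{m=0}^\beta(-1)^mp^{\beta m-\frac{m(m-1)}2}\tbinom{\beta}{m}_{p^{-1}}\xi^m,\qquad aa^*=\sum_{m=0}^\beta(-1)^mp^{-\beta m+\frac{m(m+1)}2}\tbinom{\beta}{m}_{p}\xi^m,$$ $$b^*b=\sum_{m=0}^\beta(-1)^mq^{\beta m-\frac{m(m-1)}2}\tbinom{\beta}{m}_{q^{-1}}\eta^m,\qquad bb^*=\sum_{m=0}^\beta(-1)^mq^{-\beta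 m+\frac{m(m+1)}2}\tbinom{\beta}{m}_{q}\eta^m.$$ $\vartheta(S^2_{pq})$ is the $*$-algebra generated by $\xi,z$ with the four relations of the first line. **Gluing.** Let $\chi^1_2:\vartheta(D_p\times_\theta S^1)\to\vartheta(T_\theta)$ and $\chi^2_1:\vartheta(D_q\times_\theta S^1)\to\vartheta(T_\theta)$ be the $*$-homomorphisms with $\chi^1_2(x)=V$, $\chi^1_2(h)=U$ and $\chi^2_1(y)=V$, $\chi^2_1(g)=e^{i\beta\theta/2}V^\beta U$; thus, for $k\in\mathbb{N}_0$ and $m,n\in\mathbb{Z}$, $$\chi^1_2((1-xx^*)^kx^mh^n)=\delta_{k0}V^mU^n,\qquad \chi^2_1((1-yy^*)^ky^mg^n)=\delta_{k0}e^{i\beta\theta n^2/2}V^{m+\beta n}U^n.$$ Let $P=\{(s,t)\in\vartheta(D_p\times_\theta S^1)\oplus\vartheta(D_q\times_\theta S^1):\chi^1_2(s)=\chi^2_1(t)\}$. **Coactions.** Let $\rho_1$, $\rho_2$, $\rho$ be the $*$-homomorphisms from $\vartheta(D_p\times_\theta S^1)$, $\vartheta(D_q\times_\theta S^1)$, $\vartheta(L^{p,q,\theta}_\beta)$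 to their respective tensor products with $H$ given by $x\mapsto x\otimes1$, $h\mapsto h\otimes u$; $y\mapsto y\otimes1$, $g\mapsto g\otimes u$; $\xi\mapsto\xi\otimes1$, $z\mapsto z\otimes1$, $a\mapsto a\otimes u$, $b\mapsto b\otimes u^{-1}$. **Proposition.** 1. The vectors $\xi^kz^mb^n$ ($k>0$, $m,n\in\mathbb{Z}$) together with $(1-zz^*-\xi)^kz^ma^n$ ($k\ge0$, $m,n\in\mathbb{Z}$) form a linear basis of $\vartheta(L^{p,q,\theta}_\beta)$. 2. $\rho$ is a (coassociative and counital) right $H$-coaction, and there is a $*$-algebra isomorphism $\chi:\vartheta(L^{p,q,\theta}_\beta)\to P$ with $\chi(\xi)=(1-xx^*,0)$, $\chi(z)=(x,y)$, $\chi(a)=(e^{i\beta\theta/2}x^\beta h,\,g)$, $\chi(b)=(e^{i\beta\theta/2}h^{-1},\,y^\beta g^{-1})$, both of whose components are $H$-colinear (for $\rho$ and $\rho_1$, respectively $\rho$ and $\rho_2$). 3. The assignment $\xi\mapsto\xi$, $z\mapsto z$ defines a $*$-algebra isomorphism from $\vartheta(S^2_{pq})$ onto the algebra of coinvariants $\{w\in\vartheta(L^{p,q,\theta}_\beta):\rho(w)=w\otimes1\}$.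 Moreover, $\xi\mapsto(1-xx^*,0)$, $z\mapsto(x,y)$ defines a $*$-algebra isomorphism from $\vartheta(S^2_{pq})$ onto the gluing of the two quantum discs $\{(s,t)\in\vartheta(D_p)\oplus\vartheta(D_q):\pi^1_2(s)=\pi^2_1(t)\}$, where $\pi^1_2:\vartheta(D_p)\to\vartheta(S^1)$ and $\pi^2_1:\vartheta(D_q)\to\vartheta(S^1)$ are the $*$-homomorphisms with $x\mapsto V$ and $y\mapsto V$. -/

import Mathlib

open scoped TensorProduct LaurentPolynomial

noncomputable section

namespace QLens

/-! ## Complex `*`-algebras given by generators and relations -/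

/-- The opposite of a complex algebra, with scalars acting through complex conjugation; a
conjugate-linear anti-homomorphism out of an algebra is an algebra homomorphism into `ConjOp`. -/
def ConjOp (A : Type*) : Type _ := Aᵐᵒᵖ

namespace ConjOp

set_option linter.unusedSectionVars false

variable {A : Type*} [Ring A] [Algebra ℂ A]

instance : Ring (ConjOp A) := inferInstanceAs (Ring Aᵐᵒᵖ)

instance : Algebra ℂ (ConjOp A) :=
  RingHom.toAlgebra' (R := ℂ) (S := Aᵐᵒᵖ) ((algebraMap ℂ Aᵐᵒᵖ).comp (starRingEnd ℂ))
    (fun c x => Algebra.commutes (starRingEnd ℂ c) x)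

/-- The identity, as a map from `A` to its conjugate opposite. -/
def mk (a : A) : ConjOp A := MulOpposite.op a

/-- The identity, as a map from the conjugate opposite of `A` to `A`. -/
def out (a : ConjOp A) : A := MulOpposite.unop (show Aᵐᵒᵖ from a)

@[simp] theorem out_mk (a : A) : out (mk a) = a := rfl
@[simp] theorem out_mul (a b : ConjOp A) : out (a * b) = out b * out a := rfl
@[simp] theorem out_add (a b : ConjOp A) : out (a + b) = out a + out b := rfl
@[simp] theorem out_algebraMap (c : ℂ) :
    out (algebraMap ℂ (ConjOp A) c) = algebraMap ℂ A (starRingEnd ℂ c) := rfl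

theorem out_injective : Function.Injective (out (A := A)) := MulOpposite.unop_injective

end ConjOp

/-- The free complex `*`-algebra on a set `X`: the free algebra on the letters `x` (`Sum.inl x`)
and `x*` (`Sum.inr x`), `x ∈ X`. -/
def FreeStar (X : Type) : Type := FreeAlgebra ℂ (X ⊕ X)

namespace FreeStar

variable {X : Type}

instance : Ring (FreeStar X) := inferInstanceAs (Ring (FreeAlgebra ℂ (X ⊕ X)))
instance : Algebra ℂ (FreeStar X) := inferInstanceAs (Algebra ℂ (FreeAlgebra ℂ (X ⊕ X)))

/-- The letters of the free `*`-algebra. -/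
def letter (s : X ⊕ X) : FreeStar X := FreeAlgebra.ι ℂ s

/-- The generators of the free `*`-algebra. -/
def of (x : X) : FreeStar X := letter (Sum.inl x)

/-- The conjugate-linear anti-homomorphism exchanging `x` and `x*`. -/
def starHom (X : Type) : FreeStar X →ₐ[ℂ] ConjOp (FreeStar X) :=
  FreeAlgebra.lift ℂ (fun s => ConjOp.mk (letter s.swap))

instance : Star (FreeStar X) := ⟨fun a => ConjOp.out (starHom X a)⟩

theorem star_def (a : FreeStar X) : star a = ConjOp.out (starHom X a) := rfl

theorem star_mul' (a b : FreeStar X) : star (a * b) = star b * star a := by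
  simp [star_def]

theorem star_add' (a b : FreeStar X) : star (a + b) = star a + star b := by
  simp [star_def]

theorem star_algebraMap' (c : ℂ) :
    star (algebraMap ℂ (FreeStar X) c) = algebraMap ℂ (FreeStar X) (starRingEnd ℂ c) := by
  simp [star_def]

theorem star_letter (s : X ⊕ X) : star (letter s) = (letter s.swap : FreeStar X) := by
  have h : starHom X (letter s) = ConjOp.mk (letter s.swap) :=
    FreeAlgebra.lift_ι_apply _ _
  rw [star_def, h, ConjOp.out_mk]

theorem induction' {C : FreeStar X → Prop} (h0 : ∀ c, C (algebraMap ℂ _ c))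
    (h1 : ∀ s, C (letter s)) (hm : ∀ a b, C a → C b → C (a * b))
    (ha : ∀ a b, C a → C b → C (a + b)) (a : FreeStar X) : C a :=
  FreeAlgebra.induction ℂ (X ⊕ X) (motive := C) h0 h1 hm ha a

instance : StarRing (FreeStar X) where
  star_involutive a := by
    induction a using induction' with
    | h0 c => simp [star_algebraMap']
    | h1 s => simp [star_letter]
    | hm a b ha hb => rw [star_mul', star_mul', ha, hb]
    | ha a b ha hb => rw [star_add', star_add', ha, hb]
  star_mul := star_mul'
  star_add := star_add'

instance : StarModule ℂ (FreeStar X) where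
  star_smul c a := by
    rw [Algebra.smul_def, star_mul, star_algebraMap', Algebra.smul_def]
    exact (Algebra.commutes _ _).symm

/-- The algebra homomorphism from the free `*`-algebra with `x ↦ f x`, `x* ↦ (f x)*`. -/
def liftAlg {B : Type*} [Ring B] [Algebra ℂ B] [StarRing B] (f : X → B) :
    FreeStar X →ₐ[ℂ] B :=
  FreeAlgebra.lift ℂ (Sum.elim f (fun x => star (f x)))

theorem liftAlg_letter {B : Type*} [Ring B] [Algebra ℂ B] [StarRing B] (f : X → B)
    (s : X ⊕ X) : liftAlg f (letter s) = Sum.elim f (fun x => star (f x)) s :=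
  FreeAlgebra.lift_ι_apply _ _

/-- The `*`-homomorphism from the free `*`-algebra determined by the images of the generators. -/
def lift {B : Type*} [Ring B] [Algebra ℂ B] [StarRing B] [StarModule ℂ B] (f : X → B) :
    FreeStar X →⋆ₐ[ℂ] B where
  toAlgHom := liftAlg f
  map_star' := by
    intro a
    change liftAlg f (star a) = star (liftAlg f a)
    induction a using induction' with
    | h0 c =>
      rw [star_algebraMap', AlgHom.commutes, AlgHom.commutes, ← algebraMap_star_comm]; rfl
    | h1 s =>
      rw [star_letter, liftAlg_letter, liftAlg_letter]
      cases s <;> simp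
    | hm a b ha hb => rw [star_mul, map_mul, map_mul, star_mul, ha, hb]
    | ha a b ha hb => rw [star_add, map_add, map_add, star_add, ha, hb]

@[simp] theorem lift_of {B : Type*} [Ring B] [Algebra ℂ B] [StarRing B] [StarModule ℂ B]
    (f : X → B) (x : X) : lift f (of x) = f x :=
  FreeAlgebra.lift_ι_apply _ _

end FreeStar

/-- The closure of a set of relations under `*`. -/
inductive StarClosure {X : Type} (r : FreeStar X → FreeStar X → Prop) :
    FreeStar X → FreeStar X → Prop
  | of {u v : FreeStar X} : r u v → StarClosure r u v
  | star {u v : FreeStar X} : r u v → StarClosure r (star u) (star v)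

/-- The complex `*`-algebra generated by the elements of `X` modulo the relations `r`: the
quotient of the free `*`-algebra by the two-sided `*`-ideal generated by the `u - v`, `r u v`. -/
def Presented {X : Type} (r : FreeStar X → FreeStar X → Prop) : Type :=
  RingQuot (StarClosure r)

namespace Presented

variable {X : Type} {r : FreeStar X → FreeStar X → Prop}

instance : Ring (Presented r) := inferInstanceAs (Ring (RingQuot (StarClosure r)))
instance : Algebra ℂ (Presented r) := inferInstanceAs (Algebra ℂ (RingQuot (StarClosure r)))

/-- The quotient map. -/
def proj (r : FreeStar X → FreeStar X → Prop) : FreeStar X →ₐ[ℂ] Presented r :=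
  RingQuot.mkAlgHom ℂ (StarClosure r)

theorem proj_surjective : Function.Surjective (proj r) :=
  RingQuot.mkAlgHom_surjective ℂ _

theorem proj_eq {u v : FreeStar X} (h : r u v) : proj r u = proj r v :=
  RingQuot.mkAlgHom_rel ℂ (StarClosure.of h)

theorem proj_star_eq {u v : FreeStar X} (h : r u v) : proj r (star u) = proj r (star v) :=
  RingQuot.mkAlgHom_rel ℂ (StarClosure.star h)

/-- The involution of the free `*`-algebra, followed by the quotient map. -/
def preStar (r : FreeStar X → FreeStar X → Prop) : FreeStar X →ₐ[ℂ] ConjOp (Presented r) where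
  toFun a := ConjOp.mk (proj r (star a))
  map_one' := by simp; rfl
  map_mul' a b := ConjOp.out_injective (by simp)
  map_zero' := by simp; rfl
  map_add' a b := ConjOp.out_injective (by simp)
  commutes' c := ConjOp.out_injective (by simp [FreeStar.star_algebraMap'])

/-- The involution on the quotient. -/
def starHom (r : FreeStar X → FreeStar X → Prop) : Presented r →ₐ[ℂ] ConjOp (Presented r) :=
  RingQuot.liftAlgHom ℂ ⟨preStar r, by
    intro u v h
    cases h with
    | of h => exact congrArg ConjOp.mk (proj_star_eq h)
    | star h =>
      change ConjOp.mk _ = ConjOp.mk _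
      rw [star_star, star_star, proj_eq h]⟩

instance : Star (Presented r) := ⟨fun a => ConjOp.out (starHom r a)⟩

theorem star_proj (a : FreeStar X) : star (proj r a) = proj r (star a) := by
  have h : starHom r (proj r a) = ConjOp.mk (proj r (star a)) :=
    RingQuot.liftAlgHom_mkAlgHom_apply ℂ _ _ _
  change ConjOp.out (starHom r (proj r a)) = _
  rw [h, ConjOp.out_mk]

instance : StarRing (Presented r) where
  star_involutive a := by
    obtain ⟨a, rfl⟩ := proj_surjective a
    rw [star_proj, star_proj, star_star]
  star_mul a b := by
    obtain ⟨a, rfl⟩ := proj_surjective a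
    obtain ⟨b, rfl⟩ := proj_surjective b
    rw [← map_mul, star_proj, star_proj, star_proj, star_mul, map_mul]
  star_add a b := by
    obtain ⟨a, rfl⟩ := proj_surjective a
    obtain ⟨b, rfl⟩ := proj_surjective b
    rw [← map_add, star_proj, star_proj, star_proj, star_add, map_add]

instance : StarModule ℂ (Presented r) where
  star_smul c a := by
    obtain ⟨a, rfl⟩ := proj_surjective a
    rw [← map_smul, star_proj, star_proj, star_smul, map_smul]

/-- The quotient map, as a `*`-homomorphism. -/
def projStar (r : FreeStar X → FreeStar X → Prop) : FreeStar X →⋆ₐ[ℂ] Presented r :=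
  { proj r with map_star' := fun a => (star_proj a).symm }

/-- The generators. -/
def gen (r : FreeStar X → FreeStar X → Prop) (x : X) : Presented r := projStar r (FreeStar.of x)

theorem projStar_of (x : X) : projStar r (FreeStar.of x) = gen r x := rfl

theorem projStar_eq {u v : FreeStar X} (h : r u v) : projStar r u = projStar r v := proj_eq h

/-- The algebra homomorphism underlying `lift`. -/
def liftAlg {B : Type*} [Ring B] [Algebra ℂ B] [StarRing B] [StarModule ℂ B] (f : X → B)
    (hf : ∀ u v, r u v → FreeStar.lift f u = FreeStar.lift f v) : Presented r →ₐ[ℂ] B :=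
  have hf' : ∀ ⦃u v⦄, StarClosure r u v →
      (FreeStar.lift f).toAlgHom u = (FreeStar.lift f).toAlgHom v := by
    intro u v h
    cases h with
    | of h => exact hf _ _ h
    | star h =>
      change FreeStar.lift f (star _) = FreeStar.lift f (star _)
      rw [map_star, map_star, hf _ _ h]
  RingQuot.liftAlgHom ℂ ⟨(FreeStar.lift f).toAlgHom, hf'⟩

theorem liftAlg_proj {B : Type*} [Ring B] [Algebra ℂ B] [StarRing B] [StarModule ℂ B]
    (f : X → B) (hf : ∀ u v, r u v → FreeStar.lift f u = FreeStar.lift f v) (a : FreeStar X) :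
    liftAlg f hf (proj r a) = FreeStar.lift f a :=
  RingQuot.liftAlgHom_mkAlgHom_apply ℂ (FreeStar.lift f).toAlgHom _ _

/-- The universal property of the `*`-algebra given by generators and relations. -/
def lift {B : Type*} [Ring B] [Algebra ℂ B] [StarRing B] [StarModule ℂ B] (f : X → B)
    (hf : ∀ u v, r u v → FreeStar.lift f u = FreeStar.lift f v) : Presented r →⋆ₐ[ℂ] B where
  toAlgHom := liftAlg f hf
  map_star' := by
    intro a
    change liftAlg f hf (star a) = star (liftAlg f hf a)
    obtain ⟨a, rfl⟩ := proj_surjective a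
    rw [star_proj, liftAlg_proj, liftAlg_proj, map_star]

@[simp] theorem lift_gen {B : Type*} [Ring B] [Algebra ℂ B] [StarRing B] [StarModule ℂ B]
    (f : X → B) (hf : ∀ u v, r u v → FreeStar.lift f u = FreeStar.lift f v) (x : X) :
    lift f hf (gen r x) = f x :=
  (liftAlg_proj f hf _).trans (FreeStar.lift_of f x)

end Presented

/-! ## Integer powers, phases and deformed binomial coefficients -/

/-- Integer powers in a `*`-algebra, with the convention `x⁻ⁿ = (x*)ⁿ`. -/
def spow {A : Type*} [Monoid A] [Star A] (x : A) : ℤ → A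
  | Int.ofNat n => x ^ n
  | Int.negSucc n => star x ^ (n + 1)

theorem map_spow {A B : Type*} [Ring A] [Algebra ℂ A] [Star A] [Ring B] [Algebra ℂ B] [Star B]
    (f : A →⋆ₐ[ℂ] B) (x : A) (n : ℤ) : f (spow x n) = spow (f x) n := by
  cases n <;> simp [spow, map_star]

/-- The phase `e^{it}`. -/
def phase (t : ℝ) : ℂ := Complex.exp (t * Complex.I)

theorem phase_add (s t : ℝ) : phase (s + t) = phase s * phase t := by
  simp [phase, add_mul, Complex.exp_add]

@[simp] theorem phase_zero : phase 0 = 1 := by simp [phase]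

@[simp] theorem star_phase (t : ℝ) : star (phase t) = phase (-t) := by
  simp [phase, ← Complex.exp_conj]

/-- The deformed integer `[n]_p = 1 + p + ... + p^{n-1}`. -/
def qInt (p : ℝ) (n : ℕ) : ℝ := ∑ i ∈ Finset.range n, p ^ i

/-- The deformed factorial `[n]_p! = [1]_p [2]_p ⋯ [n]_p`. -/
def qFactorial (p : ℝ) (n : ℕ) : ℝ := ∏ i ∈ Finset.range n, qInt p (i + 1)

/-- The deformed binomial coefficient, for `m ≤ n`. -/
def qBinom (p : ℝ) (n m : ℕ) : ℝ := qFactorial p n / (qFactorial p m * qFactorial p (n - m))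

/-- `∑_{m=0}^n (-1)^m p^{nm - m(m-1)/2} [n choose m]_{1/p} t^m`. -/
def lowerPoly {A : Type*} [Ring A] [Algebra ℂ A] (p : ℝ) (n : ℕ) (t : A) : A :=
  ∑ m ∈ Finset.range (n + 1),
    (((-1) ^ m * p ^ ((n : ℤ) * m - m * (m - 1) / 2) * qBinom p⁻¹ n m : ℝ) : ℂ) • t ^ m

/-- `∑_{m=0}^n (-1)^m p^{-nm + m(m+1)/2} [n choose m]_p t^m`. -/
def raisePoly {A : Type*} [Ring A] [Algebra ℂ A] (p : ℝ) (n : ℕ) (t : A) : A :=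
  ∑ m ∈ Finset.range (n + 1),
    (((-1) ^ m * p ^ (-((n : ℤ) * m) + m * (m + 1) / 2) * qBinom p n m : ℝ) : ℂ) • t ^ m

theorem map_lowerPoly {A B : Type*} [Ring A] [Algebra ℂ A] [Star A] [Ring B] [Algebra ℂ B]
    [Star B] (f : A →⋆ₐ[ℂ] B) (p : ℝ) (n : ℕ) (t : A) :
    f (lowerPoly p n t) = lowerPoly p n (f t) := by
  simp only [lowerPoly, map_sum, map_smul, map_pow]

theorem map_raisePoly {A B : Type*} [Ring A] [Algebra ℂ A] [Star A] [Ring B] [Algebra ℂ B]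
    [Star B] (f : A →⋆ₐ[ℂ] B) (p : ℝ) (n : ℕ) (t : A) :
    f (raisePoly p n t) = raisePoly p n (f t) := by
  simp only [raisePoly, map_sum, map_smul, map_pow]

/-! ## The coordinate algebra of the unitary group `U(1)` -/

open LaurentPolynomial in
/-- The involution of `ℂ[T;T⁻¹]`, conjugate-linear with `T* = T⁻¹`. -/
instance : StarRing ℂ[T;T⁻¹] where
  star f := invert (AddMonoidAlgebra.mapRingHom ℤ (starRingEnd ℂ) f)
  star_involutive f := by
    ext n
    simp
  star_mul f g := by
    simp [mul_comm]
  star_add f g := by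
    simp

open LaurentPolynomial in
theorem laurent_star_def (f : ℂ[T;T⁻¹]) :
    star f = invert (AddMonoidAlgebra.mapRingHom ℤ (starRingEnd ℂ) f) := rfl

instance : StarModule ℂ ℂ[T;T⁻¹] where
  star_smul c f := by
    ext n
    simp [laurent_star_def]

open LaurentPolynomial in
@[simp] theorem star_T (n : ℤ) : star (T n : ℂ[T;T⁻¹]) = T (-n) := by
  ext m
  simp only [laurent_star_def, T_apply, invert_apply, AddMonoidAlgebra.coeff_mapRingHom]
  by_cases h : n = -m
  · simp [h]
  · have h' : -n ≠ m := fun h' => h (by omega)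
    simp [h, h']

/-- The Hopf `*`-algebra `O(U(1)) = O(S¹)`: its unitary group-like generator is `T 1`. -/
abbrev OU1 : Type := ℂ[T;T⁻¹]

/-- The unitary generator and its integer powers. -/
def u (n : ℤ) : OU1 := LaurentPolynomial.T n

@[simp] theorem star_u (n : ℤ) : star (u n) = u (-n) := star_T n
@[simp] theorem u_mul (m n : ℤ) : u m * u n = u (m + n) := (LaurentPolynomial.T_add m n).symm
@[simp] theorem u_zero : u 0 = 1 := LaurentPolynomial.T_zero

/-! ## The quantum disc, torus and solid torus -/

open FreeStar (of)

/-- The generator `x` of the quantum disc. -/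
inductive DiscGen
  | x

/-- The relation `x*x - p xx* = 1 - p`. -/
inductive DiscRel (p : ℝ) : FreeStar DiscGen → FreeStar DiscGen → Prop
  | disc : DiscRel p
      (star (of DiscGen.x) * of DiscGen.x - (p : ℂ) • (of DiscGen.x * star (of DiscGen.x)))
      ((1 - p : ℂ) • 1)

/-- The coordinate algebra `O(D_p)` of the quantum unit disc. -/
abbrev Disc (p : ℝ) : Type := Presented (DiscRel p)

/-- The generators `U`, `V` of the quantum torus. -/
inductive TorusGen
  | U
  | V

/-- `U`, `V` are unitary, `UV = e^{iφ} VU` and `UV* = e^{-iφ} V*U`. -/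
inductive TorusRel (φ : ℝ) : FreeStar TorusGen → FreeStar TorusGen → Prop
  | U_left : TorusRel φ (star (of TorusGen.U) * of TorusGen.U) 1
  | U_right : TorusRel φ (of TorusGen.U * star (of TorusGen.U)) 1
  | V_left : TorusRel φ (star (of TorusGen.V) * of TorusGen.V) 1
  | V_right : TorusRel φ (of TorusGen.V * star (of TorusGen.V)) 1
  | comm : TorusRel φ (of TorusGen.U * of TorusGen.V) (phase φ • (of TorusGen.V * of TorusGen.U))
  | comm_star : TorusRel φ (of TorusGen.U * star (of TorusGen.V)) (phase (-φ) • (star (of TorusGen.V) * of TorusGen.U))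

/-- The coordinate algebra `O(T_φ)` of the quantum torus. -/
abbrev Torus (φ : ℝ) : Type := Presented (TorusRel φ)

/-- The generators `x`, `h` of the quantum solid torus. -/
inductive SolidGen
  | x
  | h

/-- `h` is unitary, `x*x - p xx* = 1 - p`, `hx = e^{iθ} xh` and `hx* = e^{-iθ} x*h`. -/
inductive SolidRel (p θ : ℝ) : FreeStar SolidGen → FreeStar SolidGen → Prop
  | h_right : SolidRel p θ (of SolidGen.h * star (of SolidGen.h)) 1
  | h_left : SolidRel p θ (star (of SolidGen.h) * of SolidGen.h) 1
  | disc : SolidRel p θ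
      (star (of SolidGen.x) * of SolidGen.x - (p : ℂ) • (of SolidGen.x * star (of SolidGen.x)))
      ((1 - p : ℂ) • 1)
  | comm : SolidRel p θ (of SolidGen.h * of SolidGen.x) (phase θ • (of SolidGen.x * of SolidGen.h))
  | comm_star : SolidRel p θ (of SolidGen.h * star (of SolidGen.x)) (phase (-θ) • (star (of SolidGen.x) * of SolidGen.h))

/-- The coordinate algebra `O(D_p ×_θ S¹)` of the quantum solid torus. -/
abbrev Solid (p θ : ℝ) : Type := Presented (SolidRel p θ)

namespace Torus

variable {φ : ℝ}

/-- The generator `U`. -/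
def U (φ : ℝ) : Torus φ := Presented.gen (TorusRel φ) .U
/-- The generator `V`. -/
def V (φ : ℝ) : Torus φ := Presented.gen (TorusRel φ) .V

theorem star_U_mul : star (U φ) * U φ = 1 := by
  simpa only [U, V, map_mul, map_smul, map_star, map_one, Presented.projStar_of] using Presented.projStar_eq (TorusRel.U_left (φ := φ))
theorem U_mul_star : U φ * star (U φ) = 1 := by
  simpa only [U, V, map_mul, map_smul, map_star, map_one, Presented.projStar_of] using Presented.projStar_eq (TorusRel.U_right (φ := φ))
theorem star_V_mul : star (V φ) * V φ = 1 := by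
  simpa only [U, V, map_mul, map_smul, map_star, map_one, Presented.projStar_of] using Presented.projStar_eq (TorusRel.V_left (φ := φ))
theorem V_mul_star : V φ * star (V φ) = 1 := by
  simpa only [U, V, map_mul, map_smul, map_star, map_one, Presented.projStar_of] using Presented.projStar_eq (TorusRel.V_right (φ := φ))
theorem U_mul_V : U φ * V φ = phase φ • (V φ * U φ) := by
  simpa only [U, V, map_mul, map_smul, map_star, map_one, Presented.projStar_of] using Presented.projStar_eq (TorusRel.comm (φ := φ))
theorem U_mul_star_V : U φ * star (V φ) = phase (-φ) • (star (V φ) * U φ) := by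
  simpa only [U, V, map_mul, map_smul, map_star, map_one, Presented.projStar_of] using Presented.projStar_eq (TorusRel.comm_star (φ := φ))

end Torus

namespace Solid

/-- The generator `x`. -/
def x (p θ : ℝ) : Solid p θ := Presented.gen (SolidRel p θ) .x
/-- The generator `h`. -/
def h (p θ : ℝ) : Solid p θ := Presented.gen (SolidRel p θ) .h

end Solid

namespace Disc

/-- The generator `x`. -/
def x (p : ℝ) : Disc p := Presented.gen (DiscRel p) .x

/-- The restriction `O(D_p) → O(S¹)` to the boundary circle, `x ↦ V`, where `V` is the unitary
generator of `O(S¹)`. -/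
def boundary (p : ℝ) : Disc p →⋆ₐ[ℂ] OU1 :=
  Presented.lift (fun _ => u 1) (by
    rintro _ _ ⟨⟩
    simp only [map_sub, map_mul, map_smul, map_star, map_one, FreeStar.lift_of, star_u, u_mul,
      neg_add_cancel, add_neg_cancel, u_zero, sub_smul, one_smul])

end Disc

/-- `χ¹₂ : O(D_p ×_θ S¹) → O(T_θ)`, `x ↦ V`, `h ↦ U`. -/
def chi12 (p θ : ℝ) : Solid p θ →⋆ₐ[ℂ] Torus θ :=
  Presented.lift (fun | .x => Torus.V θ | .h => Torus.U θ) (by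
    rintro _ _ ⟨⟩ <;>
    simp only [map_sub, map_mul, map_smul, map_star, map_one, FreeStar.lift_of, Torus.star_U_mul,
      Torus.U_mul_star, Torus.star_V_mul, Torus.V_mul_star, Torus.U_mul_V, Torus.U_mul_star_V,
      sub_smul, one_smul])

theorem phase_mul_phase_neg (t : ℝ) : phase t * phase (-t) = 1 := by
  rw [← phase_add, add_neg_cancel, phase_zero]

theorem phase_neg_mul_phase (t : ℝ) : phase (-t) * phase t = 1 := by
  rw [← phase_add, neg_add_cancel, phase_zero]

/-- `χ²₁ : O(D_q ×_θ S¹) → O(T_θ)`, `y ↦ V`, `g ↦ e^{iβθ/2} V^β U`. -/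
def chi21 (q θ : ℝ) (β : ℕ) : Solid q θ →⋆ₐ[ℂ] Torus θ :=
  Presented.lift (fun | .x => Torus.V θ | .h => phase (β * θ / 2) • (Torus.V θ ^ β * Torus.U θ))
    (by
    have hVl : star (Torus.V θ) ^ β * Torus.V θ ^ β = 1 := by
      have hc : Commute (star (Torus.V θ)) (Torus.V θ) :=
        Torus.star_V_mul.trans Torus.V_mul_star.symm
      rw [← hc.mul_pow, Torus.star_V_mul, one_pow]
    have hVr : Torus.V θ ^ β * star (Torus.V θ) ^ β = 1 := by
      have hc : Commute (Torus.V θ) (star (Torus.V θ)) :=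
        Torus.V_mul_star.trans Torus.star_V_mul.symm
      rw [← hc.mul_pow, Torus.V_mul_star, one_pow]
    have hc : Torus.V θ ^ β * star (Torus.V θ) = star (Torus.V θ) * Torus.V θ ^ β :=
      Commute.pow_left (Torus.V_mul_star.trans Torus.star_V_mul.symm) β
    rintro _ _ ⟨⟩
    · simp only [map_mul, map_star, FreeStar.lift_of, map_one, star_smul, star_mul, star_pow,
        smul_mul_smul_comm, star_phase, phase_mul_phase_neg, one_smul]
      rw [mul_assoc, ← mul_assoc (Torus.U θ), Torus.U_mul_star, one_mul, hVr]
    · simp only [map_mul, map_star, FreeStar.lift_of, map_one, star_smul, star_mul, star_pow,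
        smul_mul_smul_comm, star_phase, phase_neg_mul_phase, one_smul]
      rw [mul_assoc, ← mul_assoc (_ ^ β) (_ ^ β), hVl, one_mul, Torus.star_U_mul]
    · simp only [map_sub, map_mul, map_smul, map_star, map_one, FreeStar.lift_of,
        Torus.star_V_mul, Torus.V_mul_star, sub_smul, one_smul]
    · simp only [map_mul, map_smul, FreeStar.lift_of, smul_mul_assoc, mul_smul_comm]
      rw [mul_assoc, Torus.U_mul_V, mul_smul_comm, ← mul_assoc, ← mul_assoc, ← pow_succ,
        ← pow_succ', smul_comm]
    · simp only [map_mul, map_smul, map_star, FreeStar.lift_of, smul_mul_assoc, mul_smul_comm]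
      rw [mul_assoc, Torus.U_mul_star_V, mul_smul_comm, ← mul_assoc, hc, mul_assoc, smul_comm])

/-- For a unitary element, `spow` is the integer power in the group of units. -/
theorem spow_eq_zpow {A : Type*} [Monoid A] [Star A] (w : A) (h1 : w * star w = 1)
    (h2 : star w * w = 1) (n : ℤ) : spow w n = ((⟨w, star w, h1, h2⟩ : Aˣ) ^ n : Aˣ) := by
  cases n with
  | ofNat n => simp [spow]
  | negSucc n => simp only [spow, zpow_negSucc, ← inv_pow]; rfl

theorem spow_zero {A : Type*} [Monoid A] [Star A] (w : A) : spow w 0 = 1 := pow_zero w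

theorem spow_add_unitary {A : Type*} [Monoid A] [Star A] (w : A) (h1 : w * star w = 1)
    (h2 : star w * w = 1) (m n : ℤ) : spow w (m + n) = spow w m * spow w n := by
  simp only [spow_eq_zpow w h1 h2, zpow_add, Units.val_mul]

theorem Torus.spow_V_add (φ : ℝ) (m n : ℤ) :
    spow (Torus.V φ) (m + n) = spow (Torus.V φ) m * spow (Torus.V φ) n :=
  spow_add_unitary _ Torus.V_mul_star Torus.star_V_mul m n

theorem Torus.spow_U_add (φ : ℝ) (m n : ℤ) :
    spow (Torus.U φ) (m + n) = spow (Torus.U φ) m * spow (Torus.U φ) n :=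
  spow_add_unitary _ Torus.U_mul_star Torus.star_U_mul m n

theorem Torus.U_mul_spow_V (φ : ℝ) (m : ℤ) :
    Torus.U φ * spow (Torus.V φ) m = phase (m * φ) • (spow (Torus.V φ) m * Torus.U φ) := by
  have hm1 : spow (Torus.V φ) (-1) = star (Torus.V φ) := pow_one _
  have h1 : spow (Torus.V φ) 1 = Torus.V φ := pow_one _
  induction m using Int.induction_on with
  | zero => simp [spow_zero]
  | succ m ih =>
    rw [Torus.spow_V_add, ← mul_assoc, ih, h1, smul_mul_assoc, mul_assoc, Torus.U_mul_V,
      mul_smul_comm, smul_smul, ← phase_add, mul_assoc]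
    push_cast
    rw [add_one_mul]
  | pred m ih =>
    rw [sub_eq_add_neg, Torus.spow_V_add, ← mul_assoc, ih, hm1, smul_mul_assoc, mul_assoc,
      Torus.U_mul_star_V, mul_smul_comm, smul_smul, ← phase_add, mul_assoc]
    push_cast
    rw [add_mul, neg_one_mul]

theorem chi12_x (p θ : ℝ) : chi12 p θ (Solid.x p θ) = Torus.V θ := Presented.lift_gen _ _ _
theorem chi12_h (p θ : ℝ) : chi12 p θ (Solid.h p θ) = Torus.U θ := Presented.lift_gen _ _ _
theorem chi21_x (q θ : ℝ) (β : ℕ) : chi21 q θ β (Solid.x q θ) = Torus.V θ :=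
  Presented.lift_gen _ _ _
theorem chi21_h (q θ : ℝ) (β : ℕ) : chi21 q θ β (Solid.h q θ) =
    phase (β * θ / 2) • (Torus.V θ ^ β * Torus.U θ) := Presented.lift_gen _ _ _

/-- The values of `χ¹₂` on the basis vectors `(1 - xx*)^k x^m h^n`. -/
theorem chi12_basis (p θ : ℝ) (k : ℕ) (m n : ℤ) :
    chi12 p θ ((1 - Solid.x p θ * star (Solid.x p θ)) ^ k * spow (Solid.x p θ) m *
      spow (Solid.h p θ) n) =
    if k = 0 then spow (Torus.V θ) m * spow (Torus.U θ) n else 0 := by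
  simp only [map_mul, map_pow, map_sub, map_one, map_star, map_spow, chi12_x, chi12_h,
    Torus.V_mul_star, sub_self]
  split_ifs with hk
  · rw [hk, pow_zero, one_mul]
  · rw [zero_pow hk, zero_mul, zero_mul]

theorem spow_chi21_h (q θ : ℝ) (β : ℕ) (n : ℤ) :
    spow (chi21 q θ β (Solid.h q θ)) n =
      phase (β * θ * n ^ 2 / 2) • (spow (Torus.V θ) (β * n) * spow (Torus.U θ) n) := by
  have hr : Solid.h q θ * star (Solid.h q θ) = 1 := by
    have e := Presented.projStar_eq (SolidRel.h_right (p := q) (θ := θ))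
    simp only [map_mul, map_star, map_one, Presented.projStar_of] at e
    exact e
  have hl : star (Solid.h q θ) * Solid.h q θ = 1 := by
    have e := Presented.projStar_eq (SolidRel.h_left (p := q) (θ := θ))
    simp only [map_mul, map_star, map_one, Presented.projStar_of] at e
    exact e
  have wr : chi21 q θ β (Solid.h q θ) * star (chi21 q θ β (Solid.h q θ)) = 1 := by
    rw [← map_star, ← map_mul, hr, map_one]
  have wl : star (chi21 q θ β (Solid.h q θ)) * chi21 q θ β (Solid.h q θ) = 1 := by
    rw [← map_star, ← map_mul, hl, map_one]
  have step : ∀ n : ℤ, chi21 q θ β (Solid.h q θ) *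
      (phase (β * θ * n ^ 2 / 2) • (spow (Torus.V θ) (β * n) * spow (Torus.U θ) n)) =
      phase (β * θ * (n + 1 : ℤ) ^ 2 / 2) •
        (spow (Torus.V θ) (β * (n + 1)) * spow (Torus.U θ) (n + 1)) := by
    intro n
    have hV : Torus.V θ ^ β = spow (Torus.V θ) β := rfl
    have hU : Torus.U θ = spow (Torus.U θ) 1 := (pow_one _).symm
    rw [chi21_h, smul_mul_smul_comm, ← mul_assoc, mul_assoc (_ ^ β), Torus.U_mul_spow_V,
      mul_smul_comm, smul_mul_assoc, smul_smul, ← phase_add, ← phase_add, hV, ← mul_assoc,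
      ← Torus.spow_V_add, mul_assoc, mul_add_one, add_comm (β : ℤ), add_comm n 1,
      Torus.spow_U_add, show spow (Torus.U θ) 1 = Torus.U θ from pow_one _]
    simp only [mul_assoc]
    congr 2
    push_cast
    ring
  have stepW : ∀ n : ℤ, spow (chi21 q θ β (Solid.h q θ)) (n + 1) =
      chi21 q θ β (Solid.h q θ) * spow (chi21 q θ β (Solid.h q θ)) n := by
    intro n
    rw [add_comm, spow_add_unitary _ wr wl]
    exact congrArg (· * _) (pow_one _)
  induction n using Int.induction_on with
  | zero => simp [spow_zero]
  | succ n ih => rw [stepW, ih, step]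
  | pred n ih =>
    have e := step (-n - 1)
    have e' := stepW (-n - 1)
    rw [sub_add_cancel] at e e'
    rw [← ih, e'] at e
    have c := congrArg (fun t => star (chi21 q θ β (Solid.h q θ)) * t) e
    simp only [← mul_assoc, wl, one_mul] at c
    rw [← c]

/-- The values of `χ²₁` on the basis vectors `(1 - yy*)^k y^m g^n`. -/
theorem chi21_basis (q θ : ℝ) (β k : ℕ) (m n : ℤ) :
    chi21 q θ β ((1 - Solid.x q θ * star (Solid.x q θ)) ^ k * spow (Solid.x q θ) m *
      spow (Solid.h q θ) n) =
    if k = 0 then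
      phase (β * θ * n ^ 2 / 2) • (spow (Torus.V θ) (m + β * n) * spow (Torus.U θ) n)
    else 0 := by
  simp only [map_mul, map_pow, map_sub, map_one, map_star, map_spow, chi21_x, spow_chi21_h,
    Torus.V_mul_star, sub_self]
  split_ifs with hk
  · rw [hk, pow_zero, one_mul, Torus.spow_V_add, mul_smul_comm, ← mul_assoc]
  · rw [zero_pow hk, zero_mul, zero_mul]

/-- The gluing of two `*`-algebras along `*`-homomorphisms to a third one. -/
def glue {A B C : Type} [Ring A] [Algebra ℂ A] [StarRing A] [StarModule ℂ A] [Ring B]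
    [Algebra ℂ B] [StarRing B] [StarModule ℂ B] [Ring C] [Algebra ℂ C] [StarRing C]
    (f : A →⋆ₐ[ℂ] C) (g : B →⋆ₐ[ℂ] C) : StarSubalgebra ℂ (A × B) :=
  StarAlgHom.equalizer (f.comp (StarAlgHom.fst ℂ A B)) (g.comp (StarAlgHom.snd ℂ A B))

theorem mem_glue {A B C : Type} [Ring A] [Algebra ℂ A] [StarRing A] [StarModule ℂ A] [Ring B]
    [Algebra ℂ B] [StarRing B] [StarModule ℂ B] [Ring C] [Algebra ℂ C] [StarRing C]
    (f : A →⋆ₐ[ℂ] C) (g : B →⋆ₐ[ℂ] C) (w : A × B) : w ∈ glue f g ↔ f w.1 = g w.2 := Iff.rfl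

/-! ## The quantum sphere and the quantum lens space -/

/-- The generators `ξ`, `z` of the quantum sphere. -/
inductive SphereGen
  | xi
  | z

/-- `ξ* = ξ`, `ξz = pzξ`, `z*z - qzz* = 1 - q - (p - q)ξ`, `(1 - zz* - ξ)ξ = 0`. -/
inductive SphereRel (p q : ℝ) : FreeStar SphereGen → FreeStar SphereGen → Prop
  | xi_star : SphereRel p q (star (of SphereGen.xi)) (of SphereGen.xi)
  | xi_z : SphereRel p q (of SphereGen.xi * of SphereGen.z) ((p : ℂ) • (of SphereGen.z * of SphereGen.xi))
  | z_star_z : SphereRel p q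
      (star (of SphereGen.z) * of SphereGen.z - (q : ℂ) • (of SphereGen.z * star (of SphereGen.z)))
      ((1 - q : ℂ) • 1 - (p - q : ℂ) • of SphereGen.xi)
  | ortho : SphereRel p q ((1 - of SphereGen.z * star (of SphereGen.z) - of SphereGen.xi) * of SphereGen.xi) 0

/-- The coordinate algebra `O(S²_{pq})` of the quantum sphere. -/
abbrev Sphere (p q : ℝ) : Type := Presented (SphereRel p q)

namespace Sphere

/-- The generator `ξ`. -/
def xi (p q : ℝ) : Sphere p q := Presented.gen (SphereRel p q) .xi
/-- The generator `z`. -/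
def z (p q : ℝ) : Sphere p q := Presented.gen (SphereRel p q) .z

end Sphere

/-- The generators `ξ`, `z`, `a`, `b` of the quantum lens space. -/
inductive LensGen
  | xi
  | z
  | a
  | b

/-- The defining relations of the quantum lens space of charge `β`. -/
inductive LensRel (p q θ : ℝ) (β : ℕ) : FreeStar LensGen → FreeStar LensGen → Prop
  | xi_star : LensRel p q θ β (star (of LensGen.xi)) (of LensGen.xi)
  | xi_z : LensRel p q θ β (of LensGen.xi * of LensGen.z) ((p : ℂ) • (of LensGen.z * of LensGen.xi))
  | z_star_z : LensRel p q θ β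
      (star (of LensGen.z) * of LensGen.z - (q : ℂ) • (of LensGen.z * star (of LensGen.z)))
      ((1 - q : ℂ) • 1 - (p - q : ℂ) • of LensGen.xi)
  | ortho : LensRel p q θ β ((1 - of LensGen.z * star (of LensGen.z) - of LensGen.xi) * of LensGen.xi) 0
  | xi_a : LensRel p q θ β (of LensGen.xi * of LensGen.a) ((p : ℂ) ^ β • (of LensGen.a * of LensGen.xi))
  | xi_b : LensRel p q θ β (of LensGen.xi * of LensGen.b) (of LensGen.b * of LensGen.xi)
  | z_a : LensRel p q θ β (of LensGen.z * of LensGen.a) (phase (-θ) • (of LensGen.a * of LensGen.z))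
  | z_b : LensRel p q θ β (of LensGen.z * of LensGen.b) (phase θ • (of LensGen.b * of LensGen.z))
  | z_a_star : LensRel p q θ β
      (of LensGen.z * star (of LensGen.a) - phase θ • (star (of LensGen.a) * of LensGen.z))
      (((p : ℂ) ^ β - 1) • (of LensGen.xi * spow (of LensGen.z) (1 - (β : ℤ)) * of LensGen.b))
  | z_star_b : LensRel p q θ β
      (star (of LensGen.z) * of LensGen.b - phase (-θ) • (of LensGen.b * star (of LensGen.z)))
      ((1 - (q : ℂ) ^ β) •
        (spow (of LensGen.z) ((β : ℤ) - 1) * (1 - of LensGen.z * star (of LensGen.z) - of LensGen.xi) * star (of LensGen.a)))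
  | a_b : LensRel p q θ β (of LensGen.a * of LensGen.b) (phase (β * θ) • (of LensGen.b * of LensGen.a))
  | a_b_star : LensRel p q θ β
      (of LensGen.a * star (of LensGen.b)) (phase (-(β * θ)) • (star (of LensGen.b) * of LensGen.a))
  | b_a : LensRel p q θ β (of LensGen.b * of LensGen.a) (of LensGen.z ^ β)
  | a_star_a : LensRel p q θ β (star (of LensGen.a) * of LensGen.a) (lowerPoly p β (of LensGen.xi))
  | a_a_star : LensRel p q θ β (of LensGen.a * star (of LensGen.a)) (raisePoly p β (of LensGen.xi))
  | b_star_b : LensRel p q θ β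
      (star (of LensGen.b) * of LensGen.b) (lowerPoly q β (1 - of LensGen.z * star (of LensGen.z) - of LensGen.xi))
  | b_b_star : LensRel p q θ β
      (of LensGen.b * star (of LensGen.b)) (raisePoly q β (1 - of LensGen.z * star (of LensGen.z) - of LensGen.xi))

/-- The coordinate algebra `O(L^{p,q,θ}_β)` of the quantum lens space of charge `β`. -/
abbrev Lens (p q θ : ℝ) (β : ℕ) : Type := Presented (LensRel p q θ β)

namespace Lens

variable (p q θ : ℝ) (β : ℕ)

/-- The generator `ξ`. -/
def xi : Lens p q θ β := Presented.gen (LensRel p q θ β) .xi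
/-- The generator `z`. -/
def z : Lens p q θ β := Presented.gen (LensRel p q θ β) .z
/-- The generator `a`. -/
def a : Lens p q θ β := Presented.gen (LensRel p q θ β) .a
/-- The generator `b`. -/
def b : Lens p q θ β := Presented.gen (LensRel p q θ β) .b

/-- The element `1 - zz* - ξ`. -/
def eta : Lens p q θ β := 1 - z p q θ β * star (z p q θ β) - xi p q θ β

/-- The vectors `ξ^k z^m b^n`, `k > 0`, `m, n ∈ ℤ`, together with the vectors
`(1 - zz* - ξ)^k z^m a^n`, `k ≥ 0`, `m, n ∈ ℤ`. -/
def family : (ℕ+ × ℤ × ℤ) ⊕ (ℕ × ℤ × ℤ) → Lens p q θ β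
  | .inl (k, m, n) => xi p q θ β ^ (k : ℕ) * spow (z p q θ β) m * spow (b p q θ β) n
  | .inr (k, m, n) => eta p q θ β ^ k * spow (z p q θ β) m * spow (a p q θ β) n

end Lens

/-! ## Coactions of `O(U(1))` -/

section Coaction

open Coalgebra Algebra.TensorProduct

variable {A : Type} [Ring A] [Algebra ℂ A] [StarRing A] [StarModule ℂ A]

/-- A `*`-homomorphism `A → A ⊗ O(U(1))` is a right coaction if it is coassociative and
counital. -/
def IsCoaction (ρ : A →⋆ₐ[ℂ] A ⊗[ℂ] OU1) : Prop :=
  (∀ w, TensorProduct.assoc ℂ A OU1 OU1 (LinearMap.rTensor OU1 ρ.toAlgHom.toLinearMap (ρ w)) =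
      LinearMap.lTensor A (comul (R := ℂ) (A := OU1)) (ρ w)) ∧
    ∀ w, TensorProduct.rid ℂ A (LinearMap.lTensor A (counit (R := ℂ) (A := OU1)) (ρ w)) = w

/-- The `*`-algebra of coinvariants `{w | ρ(w) = w ⊗ 1}`. -/
def coinvariants (ρ : A →⋆ₐ[ℂ] A ⊗[ℂ] OU1) : StarSubalgebra ℂ A where
  carrier := {w | ρ w = w ⊗ₜ[ℂ] 1}
  mul_mem' := by
    intro v w hv hw
    simp only [Set.mem_ofPred_eq] at hv hw ⊢
    rw [map_mul, hv, hw, tmul_mul_tmul, one_mul]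
  add_mem' := by
    intro v w hv hw
    simp only [Set.mem_ofPred_eq] at hv hw ⊢
    rw [map_add, hv, hw, TensorProduct.add_tmul]
  algebraMap_mem' := by
    intro c
    simp only [Set.mem_ofPred_eq]
    rw [show ρ (algebraMap ℂ A c) = algebraMap ℂ (A ⊗[ℂ] OU1) c from ρ.toAlgHom.commutes c]
    rfl
  star_mem' := by
    intro w hw
    simp only [Set.mem_ofPred_eq] at hw ⊢
    rw [map_star, hw, TensorProduct.star_tmul, star_one]

/-- A `*`-homomorphism `F : A → B` is colinear for `ρ` and `σ` if `σ ∘ F = (F ⊗ id) ∘ ρ`. -/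
def IsColinear {B : Type} [Ring B] [Algebra ℂ B] [StarRing B] [StarModule ℂ B]
    (ρ : A →⋆ₐ[ℂ] A ⊗[ℂ] OU1) (σ : B →⋆ₐ[ℂ] B ⊗[ℂ] OU1) (F : A →⋆ₐ[ℂ] B) : Prop :=
  ∀ w, σ (F w) = LinearMap.rTensor OU1 F.toAlgHom.toLinearMap (ρ w)

theorem spow_tmul_one (x : A) (n : ℤ) :
    spow (x ⊗ₜ[ℂ] (1 : OU1)) n = spow x n ⊗ₜ[ℂ] (1 : OU1) := by
  cases n <;> simp only [spow, tmul_pow, TensorProduct.star_tmul, star_one, one_pow]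

set_option linter.unusedSectionVars false in
theorem lowerPoly_tmul_one (p : ℝ) (n : ℕ) (x : A) :
    lowerPoly p n (x ⊗ₜ[ℂ] (1 : OU1)) = lowerPoly p n x ⊗ₜ[ℂ] (1 : OU1) := by
  simp only [lowerPoly, tmul_pow, one_pow, TensorProduct.smul_tmul', TensorProduct.sum_tmul]

set_option linter.unusedSectionVars false in
theorem raisePoly_tmul_one (p : ℝ) (n : ℕ) (x : A) :
    raisePoly p n (x ⊗ₜ[ℂ] (1 : OU1)) = raisePoly p n x ⊗ₜ[ℂ] (1 : OU1) := by
  simp only [raisePoly, tmul_pow, one_pow, TensorProduct.smul_tmul', TensorProduct.sum_tmul]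

theorem solid_coaction_aux {p θ : ℝ} (F : FreeStar SolidGen →⋆ₐ[ℂ] A)
    {v w : FreeStar SolidGen} (hr : SolidRel p θ v w) (e : F v = F w)
    (f : SolidGen → A ⊗[ℂ] OU1) (fx : f .x = F (of .x) ⊗ₜ 1) (fh : f .h = F (of .h) ⊗ₜ u 1) :
    FreeStar.lift f v = FreeStar.lift f w := by
  cases hr <;>
  simp only [fx, fh, map_mul, map_sub, map_smul, map_star, map_one, FreeStar.lift_of,
    TensorProduct.star_tmul, tmul_mul_tmul, star_u, u_mul, star_one,
    mul_one, one_mul, neg_add_cancel, add_neg_cancel, u_zero, TensorProduct.smul_tmul', one_def,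
    ← TensorProduct.sub_tmul] at e ⊢ <;>
  rw [e]

theorem lens_coaction_aux {p q θ : ℝ} {β : ℕ} (F : FreeStar LensGen →⋆ₐ[ℂ] A)
    {v w : FreeStar LensGen} (hr : LensRel p q θ β v w) (e : F v = F w)
    (f : LensGen → A ⊗[ℂ] OU1) (fxi : f .xi = F (of .xi) ⊗ₜ 1) (fz : f .z = F (of .z) ⊗ₜ 1)
    (fa : f .a = F (of .a) ⊗ₜ u 1) (fb : f .b = F (of .b) ⊗ₜ u (-1)) :
    FreeStar.lift f v = FreeStar.lift f w := by
  cases hr <;>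
  simp only [fxi, fz, fa, fb, map_mul, map_sub, map_smul, map_star, map_one, map_zero, map_pow, map_spow,
    map_lowerPoly, map_raisePoly, FreeStar.lift_of, TensorProduct.star_tmul, tmul_mul_tmul,
    tmul_pow, star_u, u_mul, star_one, one_pow, neg_neg, mul_one, one_mul, neg_add_cancel,
    add_neg_cancel, u_zero, TensorProduct.smul_tmul', one_def, ← TensorProduct.sub_tmul,
    spow_tmul_one, lowerPoly_tmul_one, raisePoly_tmul_one,
    ← TensorProduct.zero_tmul A (1 : OU1)] at e ⊢ <;>
  rw [e]

end Coaction

/-- The coaction `x ↦ x ⊗ 1`, `h ↦ h ⊗ u` on the quantum solid torus. -/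
def Solid.coaction (p θ : ℝ) : Solid p θ →⋆ₐ[ℂ] Solid p θ ⊗[ℂ] OU1 :=
  Presented.lift (fun
    | .x => Solid.x p θ ⊗ₜ 1
    | .h => Solid.h p θ ⊗ₜ u 1)
    (fun _ _ hr => solid_coaction_aux (Presented.projStar _) hr (Presented.projStar_eq hr) _
      rfl rfl)

/-- The coaction `ξ ↦ ξ ⊗ 1`, `z ↦ z ⊗ 1`, `a ↦ a ⊗ u`, `b ↦ b ⊗ u⁻¹` on the quantum lens
space. -/
def Lens.coaction (p q θ : ℝ) (β : ℕ) : Lens p q θ β →⋆ₐ[ℂ] Lens p q θ β ⊗[ℂ] OU1 :=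
  Presented.lift (fun
    | .xi => Lens.xi p q θ β ⊗ₜ 1
    | .z => Lens.z p q θ β ⊗ₜ 1
    | .a => Lens.a p q θ β ⊗ₜ u 1
    | .b => Lens.b p q θ β ⊗ₜ u (-1))
    (fun _ _ hr => lens_coaction_aux (Presented.projStar _) hr (Presented.projStar_eq hr) _
      rfl rfl rfl rfl)

/-- The first component of an element of a gluing. -/
def glueFst {A B C : Type} [Ring A] [Algebra ℂ A] [StarRing A] [StarModule ℂ A] [Ring B]
    [Algebra ℂ B] [StarRing B] [StarModule ℂ B] [Ring C] [Algebra ℂ C] [StarRing C]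
    (f : A →⋆ₐ[ℂ] C) (g : B →⋆ₐ[ℂ] C) : glue f g →⋆ₐ[ℂ] A :=
  (StarAlgHom.fst ℂ A B).comp (glue f g).subtype

/-- The second component of an element of a gluing. -/
def glueSnd {A B C : Type} [Ring A] [Algebra ℂ A] [StarRing A] [StarModule ℂ A] [Ring B]
    [Algebra ℂ B] [StarRing B] [StarModule ℂ B] [Ring C] [Algebra ℂ C] [StarRing C]
    (f : A →⋆ₐ[ℂ] C) (g : B →⋆ₐ[ℂ] C) : glue f g →⋆ₐ[ℂ] B :=
  (StarAlgHom.snd ℂ A B).comp (glue f g).subtype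

end QLens

end

noncomputable section

namespace QLens

/-! ## Homomorphisms out of presented algebras -/

namespace Presented

variable {X : Type} {r : FreeStar X → FreeStar X → Prop}

theorem adjoin_gen : Algebra.adjoin ℂ
    (Set.range (gen r) ∪ Set.range (fun x => star (gen r x))) = ⊤ := by
  rw [eq_top_iff]
  rintro w -
  obtain ⟨w, rfl⟩ := proj_surjective w
  induction w using FreeStar.induction' with
  | h0 c => rw [AlgHom.commutes]; exact Subalgebra.algebraMap_mem _ c
  | h1 s =>
    apply Algebra.subset_adjoin
    rcases s with x | x
    · exact Or.inl ⟨x, rfl⟩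
    · refine Or.inr ⟨x, ?_⟩
      change star (proj r (FreeStar.of x)) = _
      rw [star_proj, FreeStar.of, FreeStar.star_letter, Sum.swap_inl]
  | hm a b ha hb => rw [map_mul]; exact mul_mem ha hb
  | ha a b ha hb => rw [map_add]; exact add_mem ha hb

theorem mem_of_gen_mem (S : Subalgebra ℂ (Presented r)) (h : ∀ x, gen r x ∈ S)
    (h' : ∀ x, star (gen r x) ∈ S) (w : Presented r) : w ∈ S := by
  have : w ∈ Algebra.adjoin ℂ (Set.range (gen r) ∪ Set.range (fun x => star (gen r x))) := by
    rw [adjoin_gen]; trivial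
  refine Algebra.adjoin_le ?_ this
  rintro _ (⟨x, rfl⟩ | ⟨x, rfl⟩)
  exacts [h x, h' x]

theorem algHom_ext {B : Type*} [Ring B] [Algebra ℂ B] {f g : Presented r →ₐ[ℂ] B}
    (h : ∀ x, f (gen r x) = g (gen r x)) (h' : ∀ x, f (star (gen r x)) = g (star (gen r x))) :
    f = g :=
  AlgHom.ext fun w => mem_of_gen_mem (AlgHom.equalizer f g) h h' w

theorem hom_ext {B : Type*} [Ring B] [Algebra ℂ B] [StarRing B] {f g : Presented r →⋆ₐ[ℂ] B}
    (h : ∀ x, f (gen r x) = g (gen r x)) (w : Presented r) : f w = g w :=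
  DFunLike.congr_fun (algHom_ext (f := f.toAlgHom) (g := g.toAlgHom) h fun x => by
    change f (star _) = g (star _)
    rw [map_star, map_star, h]) w

theorem hom_surjective {B : Type*} [Ring B] [Algebra ℂ B] [StarRing B]
    (f : B →⋆ₐ[ℂ] Presented r) (h : ∀ x, ∃ b, f b = gen r x) : Function.Surjective f := by
  intro w
  refine mem_of_gen_mem f.toAlgHom.range h (fun x => ?_) w
  obtain ⟨b, hb⟩ := h x
  exact ⟨star b, by rw [← hb]; exact map_star f b⟩

end Presented

/-- The algebra homomorphism out of the free `*`-algebra with prescribed values on the letters. -/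
def FreeStar.letterLift {X : Type} {B : Type*} [Ring B] [Algebra ℂ B] (f : X ⊕ X → B) :
    FreeStar X →ₐ[ℂ] B :=
  FreeAlgebra.lift ℂ f

theorem FreeStar.letterLift_of {X : Type} {B : Type*} [Ring B] [Algebra ℂ B] (f : X ⊕ X → B)
    (x : X) : letterLift f (of x) = f (Sum.inl x) :=
  FreeAlgebra.lift_ι_apply _ _

theorem FreeStar.letterLift_star_of {X : Type} {B : Type*} [Ring B] [Algebra ℂ B]
    (f : X ⊕ X → B) (x : X) : letterLift f (star (of x)) = f (Sum.inr x) := by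
  rw [of, star_letter]
  exact FreeAlgebra.lift_ι_apply _ _

namespace Presented

variable {X : Type} {r : FreeStar X → FreeStar X → Prop} {B : Type*} [Ring B] [Algebra ℂ B]

/-- The algebra homomorphism out of a presented `*`-algebra with prescribed values on the
generators and on their adjoints. -/
def algLift (f : X ⊕ X → B)
    (hf : ∀ u v, StarClosure r u v → FreeStar.letterLift f u = FreeStar.letterLift f v) :
    Presented r →ₐ[ℂ] B :=
  RingQuot.liftAlgHom ℂ ⟨FreeStar.letterLift f, fun {u v} h => hf u v h⟩

theorem algLift_proj (f : X ⊕ X → B)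
    (hf : ∀ u v, StarClosure r u v → FreeStar.letterLift f u = FreeStar.letterLift f v)
    (w : FreeStar X) : algLift f hf (proj r w) = FreeStar.letterLift f w :=
  RingQuot.liftAlgHom_mkAlgHom_apply ℂ _ _ _

theorem algLift_gen (f : X ⊕ X → B)
    (hf : ∀ u v, StarClosure r u v → FreeStar.letterLift f u = FreeStar.letterLift f v)
    (x : X) : algLift f hf (gen r x) = f (Sum.inl x) :=
  (algLift_proj f hf _).trans (FreeStar.letterLift_of f x)

theorem algLift_star_gen (f : X ⊕ X → B)
    (hf : ∀ u v, StarClosure r u v → FreeStar.letterLift f u = FreeStar.letterLift f v)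
    (x : X) : algLift f hf (star (gen r x)) = f (Sum.inr x) := by
  have e : star (gen r x) = proj r (star (FreeStar.of x)) := star_proj _
  rw [e, algLift_proj, FreeStar.letterLift_star_of]

end Presented

/-! ## Spanning sets of algebras of solid torus type -/

/-- Integer powers of `x`, where negative powers are powers of `y`. -/
def ipow {A : Type*} [Monoid A] (x y : A) : ℤ → A
  | Int.ofNat n => x ^ n
  | Int.negSucc n => y ^ (n + 1)

theorem spow_eq_ipow {A : Type*} [Monoid A] [Star A] (x : A) (n : ℤ) :
    spow x n = ipow x (star x) n := by
  cases n <;> rfl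

theorem map_ipow {A B F : Type*} [Monoid A] [Monoid B] [FunLike F A B] [MonoidHomClass F A B]
    (f : F) (x y : A) (n : ℤ) : f (ipow x y n) = ipow (f x) (f y) n := by
  cases n <;> simp [ipow]

theorem ipow_units {A : Type*} [Monoid A] (w : Aˣ) (n : ℤ) :
    ipow (w : A) ((w⁻¹ : Aˣ) : A) n = ((w ^ n : Aˣ) : A) := by
  cases n with
  | ofNat n => simp [ipow]
  | negSucc n => simp only [ipow, zpow_negSucc, ← inv_pow, Units.val_pow_eq_pow_val]

section Span

variable {A : Type*} [Ring A] [Algebra ℂ A]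

/-- The vectors `e^k x^m h^n`, where `x⁻¹` stands for `y` and `h⁻¹` for `k`. -/
def monomials (e x y h k : A) (i : ℕ × ℤ × ℤ) : A := e ^ i.1 * ipow x y i.2.1 * ipow h k i.2.2

theorem units_zpow_mul_of_commute {w : Aˣ} {x : A} {φ : ℂ} (hφ : φ ≠ 0)
    (hx : (w : A) * x = φ • (x * w)) (n : ℤ) :
    ((w ^ n : Aˣ) : A) * x = φ ^ n • (x * ((w ^ n : Aˣ) : A)) := by
  have hx' : ((w⁻¹ : Aˣ) : A) * x = φ⁻¹ • (x * ((w⁻¹ : Aˣ) : A)) := by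
    rw [Units.inv_mul_eq_iff_eq_mul, mul_smul_comm, ← mul_assoc, hx, smul_mul_assoc, smul_smul,
      inv_mul_cancel₀ hφ, one_smul, mul_assoc, Units.mul_inv, mul_one]
  induction n using Int.induction_on with
  | zero => simp
  | succ n ih =>
    rw [zpow_add_one, Units.val_mul, mul_assoc, hx, mul_smul_comm, ← mul_assoc, ih,
      smul_mul_assoc, smul_smul, zpow_add_one₀ hφ, mul_comm φ, mul_assoc]
  | pred n ih =>
    rw [zpow_sub_one, Units.val_mul, mul_assoc, hx', mul_smul_comm, ← mul_assoc, ih,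
      smul_mul_assoc, smul_smul, zpow_sub_one₀ hφ, mul_comm φ⁻¹, mul_assoc]

theorem pow_mul_of_twist {c : ℂ} {e y : A} (h : y * e = c • (e * y)) (j : ℕ) :
    y ^ j * e = c ^ j • (e * y ^ j) := by
  induction j with
  | zero => simp
  | succ j ih =>
    rw [pow_succ, mul_assoc, h, mul_smul_comm, ← mul_assoc, ih, smul_mul_assoc, smul_smul,
      mul_assoc, pow_succ, mul_comm c]

theorem mul_pow_of_twist {c : ℂ} {e y : A} (h : e * y = c • (y * e)) (j : ℕ) :
    e * y ^ j = c ^ j • (y ^ j * e) := by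
  induction j with
  | zero => simp
  | succ j ih =>
    rw [pow_succ, ← mul_assoc, ih, smul_mul_assoc, mul_assoc, h, mul_smul_comm, smul_smul,
      ← mul_assoc, pow_succ]

theorem ipow_mul_left {p : ℂ} {e x y : A} (hyx : y * x = 1 - p • e)
    (hye : y * e = p • (e * y)) (m : ℤ) :
    ∃ c : ℂ, ipow x y m * x = ipow x y (m + 1) + c • (e * ipow x y (m + 1)) := by
  cases m with
  | ofNat n => exact ⟨0, by rw [zero_smul, add_zero]; exact (pow_succ x n).symm⟩
  | negSucc n =>
    refine ⟨-(p * p ^ n), ?_⟩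
    have e1 : ipow x y (Int.negSucc n + 1) = y ^ n := by
      cases n with
      | zero => exact (pow_zero x).trans (pow_zero y).symm
      | succ n => rfl
    rw [e1]
    change y ^ (n + 1) * x = _
    rw [pow_succ, mul_assoc, hyx, mul_sub, mul_one, mul_smul_comm, pow_mul_of_twist hye, smul_smul, neg_smul,
      sub_eq_add_neg]

theorem ipow_mul_right {p : ℂ} (hp : p ≠ 0) {e x y : A} (hxy : x * y = 1 - e)
    (hex : e * x = p • (x * e)) (m : ℤ) :
    ∃ c : ℂ, ipow x y m * y = ipow x y (m - 1) + c • (e * ipow x y (m - 1)) := by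
  have hex' : x * e = p⁻¹ • (e * x) := by rw [hex, smul_smul, inv_mul_cancel₀ hp, one_smul]
  cases m with
  | ofNat n =>
    cases n with
    | zero => exact ⟨0, by rw [zero_smul, add_zero]; change x ^ 0 * y = y ^ 1; simp⟩
    | succ n =>
      refine ⟨-p⁻¹ ^ n, ?_⟩
      have e1 : ipow x y (Int.ofNat (n + 1) - 1) = x ^ n := by
        have : Int.ofNat (n + 1) - 1 = Int.ofNat n := by simp
        rw [this]; rfl
      rw [e1]
      change x ^ (n + 1) * y = _
      rw [pow_succ, mul_assoc, hxy, mul_sub, mul_one, pow_mul_of_twist hex', neg_smul,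
        sub_eq_add_neg]
  | negSucc n => exact ⟨0, by rw [zero_smul, add_zero]; exact (pow_succ y (n + 1)).symm⟩

theorem span_monomials {p φ : ℂ} (hp : p ≠ 0) (hφ : φ ≠ 0) {e x y h k : A}
    (hxy : x * y = 1 - e) (hyx : y * x = 1 - p • e) (hhk : h * k = 1) (hkh : k * h = 1)
    (hhx : h * x = φ • (x * h)) (hhy : h * y = φ⁻¹ • (y * h))
    (hgen : Algebra.adjoin ℂ {x, y, h, k} = ⊤) :
    Submodule.span ℂ (Set.range (monomials e x y h k)) = ⊤ := by
  have hex : e * x = p • (x * e) := by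
    rw [← sub_sub_cancel 1 e, ← hxy, sub_mul, mul_assoc, hyx, one_mul, mul_sub, mul_one,
      sub_sub_cancel, mul_smul_comm]
    congr 2
    rw [hxy, sub_sub_cancel]
  have hye : y * e = p • (e * y) := by
    have : e = 1 - x * y := by rw [hxy, sub_sub_cancel]
    rw [show y * e = y - y * x * y by rw [this]; noncomm_ring, hyx, sub_mul, one_mul,
      sub_sub_cancel, smul_mul_assoc]
  set w : Aˣ := ⟨h, k, hhk, hkh⟩ with hw
  have hwn : ∀ n, ipow h k n = ((w ^ n : Aˣ) : A) := fun n => ipow_units w n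
  set W := Submodule.span ℂ (Set.range (monomials e x y h k)) with hW
  have hmem : ∀ (i : ℕ) (m n : ℤ), e ^ i * ipow x y m * ((w ^ n : Aˣ) : A) ∈ W :=
    fun i m n => Submodule.subset_span ⟨(i, m, n), by rw [← hwn]; rfl⟩
  have hmem' : ∀ (c : ℂ) (i : ℕ) (m n : ℤ),
      e ^ i * (ipow x y m + c • (e * ipow x y m)) * ((w ^ n : Aˣ) : A) ∈ W := by
    intro c i m n
    rw [mul_add, add_mul, mul_smul_comm, ← mul_assoc, ← pow_succ, smul_mul_assoc]
    exact W.add_mem (hmem _ _ _) (W.smul_mem _ (hmem _ _ _))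
  have key : ∀ g ∈ ({x, y, h, k} : Set A), ∀ v ∈ W, v * g ∈ W := by
    intro g hg v hv
    induction hv using Submodule.span_induction with
    | zero => rw [zero_mul]; exact W.zero_mem
    | add _ _ _ _ h1 h2 => rw [add_mul]; exact W.add_mem h1 h2
    | smul c _ _ h1 => rw [smul_mul_assoc]; exact W.smul_mem c h1
    | mem v hv =>
      obtain ⟨⟨i, m, n⟩, rfl⟩ := hv
      simp only [monomials, hwn]
      rcases hg with rfl | rfl | rfl | rfl
      · rw [mul_assoc, units_zpow_mul_of_commute hφ hhx, mul_smul_comm, ← mul_assoc,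
          mul_assoc (e ^ i)]
        obtain ⟨c, hc⟩ := ipow_mul_left hyx hye m
        rw [hc]
        exact W.smul_mem _ (hmem' _ _ _ _)
      · rw [mul_assoc, units_zpow_mul_of_commute (inv_ne_zero hφ) hhy, mul_smul_comm, ← mul_assoc,
          mul_assoc (e ^ i)]
        obtain ⟨c, hc⟩ := ipow_mul_right hp hxy hex m
        rw [hc]
        exact W.smul_mem _ (hmem' _ _ _ _)
      · rw [mul_assoc, show ((w ^ n : Aˣ) : A) * g = ((w ^ (n + 1) : Aˣ) : A) by
          rw [zpow_add_one, Units.val_mul]]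
        exact hmem _ _ _
      · rw [mul_assoc, show ((w ^ n : Aˣ) : A) * g = ((w ^ (n - 1) : Aˣ) : A) by
          rw [zpow_sub_one, Units.val_mul]; rfl]
        exact hmem _ _ _
  have all : ∀ g : A, ∀ v ∈ W, v * g ∈ W := by
    intro g
    have hg : g ∈ Algebra.adjoin ℂ {x, y, h, k} := by rw [hgen]; trivial
    induction hg using Algebra.adjoin_induction with
    | mem g hg => exact key g hg
    | algebraMap c =>
      intro v hv
      rw [← Algebra.commutes, ← Algebra.smul_def]
      exact W.smul_mem c hv
    | add a b _ _ ha hb => intro v hv; rw [mul_add]; exact W.add_mem (ha v hv) (hb v hv)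
    | mul a b _ _ ha hb => intro v hv; rw [← mul_assoc]; exact hb _ (ha v hv)
  rw [eq_top_iff]
  rintro g -
  have h1 : (1 : A) ∈ W := by simpa [ipow] using hmem 0 0 0
  simpa using all g 1 h1

theorem span_monomials_mod (I : Ideal A) [I.IsTwoSided] {p φ : ℂ} (hp : p ≠ 0) (hφ : φ ≠ 0)
    {e x y h k : A}
    (hxy : x * y - (1 - e) ∈ I) (hyx : y * x - (1 - p • e) ∈ I) (hhk : h * k - 1 ∈ I)
    (hkh : k * h - 1 ∈ I)
    (hhx : h * x - φ • (x * h) ∈ I) (hhy : h * y - φ⁻¹ • (y * h) ∈ I)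
    (hgen : ∀ S : Subalgebra ℂ A, (∀ a ∈ I, a ∈ S) → x ∈ S → y ∈ S → h ∈ S → k ∈ S → S = ⊤)
    (w : A) :
    ∃ v ∈ Submodule.span ℂ (Set.range (monomials e x y h k)), w - v ∈ I := by
  let π : A →ₐ[ℂ] A ⧸ I := Ideal.Quotient.mkₐ ℂ I
  have hπ : ∀ a b : A, a - b ∈ I → π a = π b := fun a b hab => Ideal.Quotient.eq.2 hab
  have hsurj : Function.Surjective π := Ideal.Quotient.mkₐ_surjective ℂ I
  have htop := span_monomials (e := π e) (x := π x) (y := π y) (h := π h) (k := π k) hp hφ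
    (by rw [← map_mul, hπ _ _ hxy, map_sub, map_one])
    (by rw [← map_mul, hπ _ _ hyx, map_sub, map_one, map_smul])
    (by rw [← map_mul, hπ _ _ hhk, map_one]) (by rw [← map_mul, hπ _ _ hkh, map_one])
    (by rw [← map_mul, hπ _ _ hhx, map_smul, map_mul])
    (by rw [← map_mul, hπ _ _ hhy, map_smul, map_mul])
    (by
      set T := Algebra.adjoin ℂ {π x, π y, π h, π k} with hT
      have hc : T.comap π = ⊤ := by
        refine hgen _ (fun a ha => ?_) ?_ ?_ ?_ ?_
        · have : π a = 0 := Ideal.Quotient.eq_zero_iff_mem.2 ha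
          rw [Subalgebra.mem_comap, this]
          exact T.zero_mem
        all_goals exact Algebra.subset_adjoin (by simp)
      rw [eq_top_iff]
      rintro b -
      obtain ⟨a, rfl⟩ := hsurj b
      have : a ∈ T.comap π := by rw [hc]; trivial
      exact this)
  have hfam : monomials (π e) (π x) (π y) (π h) (π k) = π.toLinearMap ∘ monomials e x y h k := by
    funext i
    simp [monomials, map_ipow]
  rw [hfam, Set.range_comp, ← Submodule.map_span] at htop
  have hw : π w ∈ Submodule.map π.toLinearMap
      (Submodule.span ℂ (Set.range (monomials e x y h k))) := by rw [htop]; trivial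
  obtain ⟨v, hv, e1⟩ := hw
  exact ⟨v, hv, Ideal.Quotient.eq.1 e1.symm⟩

end Span

/-! ## Weighted shift operators -/

section Shift

variable {R : Type*} [CommRing R] [Algebra ℂ R]

/-- The shift in the first variable. -/
def shiftX (R : Type*) [CommRing R] [Algebra ℂ R] : Module.End ℂ (ℤ → ℤ → R) where
  toFun f := fun j l => f (j - 1) l
  map_add' _ _ := rfl
  map_smul' _ _ := rfl

/-- The weighted backward shift in the first variable, with weights `1 - p^{j+1} t`. -/
def shiftY (p : ℂ) (t : R) : Module.End ℂ (ℤ → ℤ → R) where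
  toFun f := fun j l => (1 - p ^ (j + 1) • t) * f (j + 1) l
  map_add' f g := by ext j l; simp [mul_add]
  map_smul' c f := by ext j l; simp

/-- The shift in the second variable, twisted by `φ^j`. -/
def shiftH (R : Type*) [CommRing R] [Algebra ℂ R] (φ : ℂ) : Module.End ℂ (ℤ → ℤ → R) where
  toFun f := fun j l => φ ^ j • f j (l - 1)
  map_add' f g := by ext j l; simp [smul_add]
  map_smul' c f := by ext j l; simp [smul_comm c]

/-- The inverse of `shiftH`. -/
def shiftK (R : Type*) [CommRing R] [Algebra ℂ R] (φ : ℂ) : Module.End ℂ (ℤ → ℤ → R) where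
  toFun f := fun j l => φ ^ (-j) • f j (l + 1)
  map_add' f g := by ext j l; simp [smul_add]
  map_smul' c f := by ext j l; simp [smul_comm c]

theorem shiftX_apply (f : ℤ → ℤ → R) (j l : ℤ) : shiftX R f j l = f (j - 1) l := rfl
theorem shiftY_apply (p : ℂ) (t : R) (f : ℤ → ℤ → R) (j l : ℤ) :
    shiftY p t f j l = (1 - p ^ (j + 1) • t) * f (j + 1) l := rfl
theorem shiftH_apply (φ : ℂ) (f : ℤ → ℤ → R) (j l : ℤ) :
    shiftH R φ f j l = φ ^ j • f j (l - 1) := rfl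
theorem shiftK_apply (φ : ℂ) (f : ℤ → ℤ → R) (j l : ℤ) :
    shiftK R φ f j l = φ ^ (-j) • f j (l + 1) := rfl

theorem shiftX_mul_shiftY_apply (p : ℂ) (t : R) (f : ℤ → ℤ → R) (j l : ℤ) :
    (shiftX R * shiftY p t) f j l = (1 - p ^ j • t) * f j l := by
  simp [shiftX_apply, shiftY_apply]

theorem shiftY_mul_shiftX {p : ℂ} (hp : p ≠ 0) (t : R) :
    shiftY p t * shiftX R - p • (shiftX R * shiftY p t) = (1 - p) • 1 := by
  ext f j l
  simp only [LinearMap.sub_apply, LinearMap.smul_apply, Pi.sub_apply, Pi.smul_apply,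
    shiftX_mul_shiftY_apply, Module.End.one_apply]
  simp only [Module.End.mul_apply, shiftX_apply, shiftY_apply, add_sub_cancel_right,
    zpow_add_one₀ hp, Algebra.smul_def, map_mul, map_sub, map_one]
  ring

theorem shiftH_mul_shiftK {φ : ℂ} (hφ : φ ≠ 0) : shiftH R φ * shiftK R φ = 1 := by
  ext f j l
  simp [shiftH_apply, shiftK_apply, smul_smul, zpow_ne_zero j hφ]

theorem shiftK_mul_shiftH {φ : ℂ} (hφ : φ ≠ 0) : shiftK R φ * shiftH R φ = 1 := by
  ext f j l
  simp [shiftH_apply, shiftK_apply, smul_smul, zpow_ne_zero j hφ]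

theorem shiftH_mul_shiftX {φ : ℂ} (hφ : φ ≠ 0) :
    shiftH R φ * shiftX R = φ • (shiftX R * shiftH R φ) := by
  ext f j l
  have h : φ ^ j = φ * φ ^ (j - 1) := by rw [← zpow_one_add₀ hφ, add_sub_cancel]
  simp [shiftH_apply, shiftX_apply, smul_smul, h]

theorem shiftH_mul_shiftY {φ : ℂ} (hφ : φ ≠ 0) (p : ℂ) (t : R) :
    shiftH R φ * shiftY p t = φ⁻¹ • (shiftY p t * shiftH R φ) := by
  ext f j l
  simp [shiftH_apply, shiftY_apply, smul_smul, zpow_add_one₀ hφ, mul_left_comm, hφ]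

theorem shiftX_mul_shiftK {φ : ℂ} (hφ : φ ≠ 0) :
    shiftX R * shiftK R φ = φ • (shiftK R φ * shiftX R) := by
  ext f j l
  simp [shiftK_apply, shiftX_apply, smul_smul, zpow_sub₀ hφ, div_eq_mul_inv]

theorem shiftY_mul_shiftK {φ : ℂ} (hφ : φ ≠ 0) (p : ℂ) (t : R) :
    shiftY p t * shiftK R φ = φ⁻¹ • (shiftK R φ * shiftY p t) := by
  ext f j l
  simp [shiftK_apply, shiftY_apply, smul_smul, zpow_add₀ hφ]

theorem ipow_shiftH_apply {φ : ℂ} (hφ : φ ≠ 0) (n : ℤ) (f : ℤ → ℤ → R) (j l : ℤ) :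
    ipow (shiftH R φ) (shiftK R φ) n f j l = φ ^ (j * n) • f j (l - n) := by
  have hH : ∀ (n : ℕ) (l : ℤ), (shiftH R φ ^ n) f j l = φ ^ (j * n) • f j (l - n) := by
    intro n
    induction n with
    | zero => simp
    | succ n ih =>
      intro l
      rw [pow_succ', Module.End.mul_apply, shiftH_apply, ih, smul_smul, ← zpow_add₀ hφ]
      push_cast
      rw [mul_add_one, add_comm j, sub_sub, add_comm (1 : ℤ)]
  have hK : ∀ (n : ℕ) (l : ℤ), (shiftK R φ ^ n) f j l = φ ^ (-(j * n)) • f j (l + n) := by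
    intro n
    induction n with
    | zero => simp
    | succ n ih =>
      intro l
      rw [pow_succ', Module.End.mul_apply, shiftK_apply, ih, smul_smul, ← zpow_add₀ hφ]
      push_cast
      rw [mul_add_one, neg_add, add_comm (-j), add_assoc, add_comm (1 : ℤ)]
  cases n with
  | ofNat n => exact hH n l
  | negSucc n =>
    refine (hK (n + 1) l).trans ?_
    rw [Int.negSucc_eq]
    push_cast
    rw [mul_neg, sub_neg_eq_add]

theorem exists_ipow_shiftX_apply [IsDomain R] {p : ℂ} {t : R} (ht : ∀ j : ℤ, 1 - p ^ j • t ≠ 0)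
    (m j : ℤ) : ∃ D : R, D ≠ 0 ∧ ∀ (f : ℤ → ℤ → R) (l : ℤ),
      ipow (shiftX R) (shiftY p t) m f j l = D * f (j - m) l := by
  have hX : ∀ (n : ℕ) (f : ℤ → ℤ → R) (j l : ℤ), (shiftX R ^ n) f j l = f (j - n) l := by
    intro n f
    induction n with
    | zero => simp
    | succ n ih =>
      intro j l
      rw [pow_succ', Module.End.mul_apply, shiftX_apply, ih]
      push_cast
      rw [sub_sub, add_comm (1 : ℤ)]
  have hY : ∀ (n : ℕ) (j : ℤ), ∃ D : R, D ≠ 0 ∧ ∀ (f : ℤ → ℤ → R) (l : ℤ),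
      (shiftY p t ^ n) f j l = D * f (j + n) l := by
    intro n
    induction n with
    | zero => exact fun j => ⟨1, one_ne_zero, by simp⟩
    | succ n ih =>
      intro j
      obtain ⟨D, hD, h⟩ := ih (j + 1)
      refine ⟨(1 - p ^ (j + 1) • t) * D, mul_ne_zero (ht _) hD, fun f l => ?_⟩
      rw [pow_succ', Module.End.mul_apply, shiftY_apply, h, mul_assoc]
      push_cast
      rw [add_assoc, add_comm (1 : ℤ)]
  cases m with
  | ofNat n => exact ⟨1, one_ne_zero, fun f l => (hX n f j l).trans (one_mul _).symm⟩
  | negSucc n =>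
    obtain ⟨D, hD, h⟩ := hY (n + 1) j
    refine ⟨D, hD, fun f l => (h f l).trans ?_⟩
    rw [Int.negSucc_eq]
    push_cast
    rw [sub_neg_eq_add]

theorem sum_coeff_eq_zero_of_shift [IsDomain R] {p φ : ℂ} (hφ : φ ≠ 0) {t : R}
    (ht : ∀ j : ℤ, 1 - p ^ j • t ≠ 0) (s : Finset (ℕ × ℤ × ℤ)) (g : ℕ × ℤ × ℤ → ℂ)
    (hs : ∑ i ∈ s, g i • monomials (1 - shiftX R * shiftY p t) (shiftX R) (shiftY p t)
      (shiftH R φ) (shiftK R φ) i = 0) (m n : ℤ) :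
    ∑ i ∈ s, (if i.2 = (m, n) then g i • t ^ i.1 else 0) = 0 := by
  choose D hD hDf using fun m => exists_ipow_shiftX_apply ht m 0
  have hE : ∀ (k : ℕ) (f : ℤ → ℤ → R), ((1 - shiftX R * shiftY p t) ^ k) f 0 0 = t ^ k * f 0 0 := by
    intro k
    induction k with
    | zero => simp
    | succ k ih =>
      intro f
      rw [pow_succ, Module.End.mul_apply, ih, LinearMap.sub_apply, Pi.sub_apply, Pi.sub_apply,
        shiftX_mul_shiftY_apply, Module.End.one_apply, zpow_zero, one_smul]
      ring
  have key := congrFun (congrFun (LinearMap.congr_fun hs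
    (fun a b => if a = -m ∧ b = -n then (1 : R) else 0)) 0) 0
  have hφ' : algebraMap ℂ R (φ ^ (-m * n)) ≠ 0 := by
    rw [Ne, FaithfulSMul.algebraMap_eq_zero_iff ℂ R]
    exact zpow_ne_zero _ hφ
  have e : (D m * algebraMap ℂ R (φ ^ (-m * n))) *
      ∑ i ∈ s, (if i.2 = (m, n) then g i • t ^ i.1 else 0) = 0 := by
    simp only [LinearMap.sum_apply, Finset.sum_apply, LinearMap.smul_apply, Pi.smul_apply,
      monomials, Module.End.mul_apply, hE, hDf, ipow_shiftH_apply hφ, LinearMap.zero_apply,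
      Pi.zero_apply, zero_sub, neg_inj] at key
    rw [Finset.mul_sum]
    refine (Finset.sum_congr rfl fun i _ => ?_).trans key
    obtain ⟨k, m', n'⟩ := i
    by_cases h : m' = m ∧ n' = n
    · obtain ⟨rfl, rfl⟩ := h
      simp only [and_self, if_true, Algebra.smul_def]
      ring
    · simp [h]
  exact (mul_eq_zero.1 e).resolve_left (mul_ne_zero (hD m) hφ')

end Shift

/-! ## The monomial basis of the quantum solid torus -/

theorem phase_ne_zero (t : ℝ) : phase t ≠ 0 := Complex.exp_ne_zero _

theorem phase_neg (t : ℝ) : phase (-t) = (phase t)⁻¹ :=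
  eq_inv_of_mul_eq_one_left (phase_neg_mul_phase t)

namespace Solid

theorem h_mul_star (p θ : ℝ) : h p θ * star (h p θ) = 1 := by
  simpa only [x, h, map_mul, map_star, map_one, Presented.projStar_of] using
    Presented.projStar_eq (SolidRel.h_right (p := p) (θ := θ))

theorem star_h_mul (p θ : ℝ) : star (h p θ) * h p θ = 1 := by
  simpa only [x, h, map_mul, map_star, map_one, Presented.projStar_of] using
    Presented.projStar_eq (SolidRel.h_left (p := p) (θ := θ))

theorem star_x_mul (p θ : ℝ) : star (x p θ) * x p θ - (p : ℂ) • (x p θ * star (x p θ)) =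
    (1 - p : ℂ) • 1 := by
  simpa only [x, h, map_sub, map_smul, map_mul, map_star, map_one, Presented.projStar_of] using
    Presented.projStar_eq (SolidRel.disc (p := p) (θ := θ))

theorem h_mul_x (p θ : ℝ) : h p θ * x p θ = phase θ • (x p θ * h p θ) := by
  simpa only [x, h, map_sub, map_smul, map_mul, map_star, map_one, Presented.projStar_of] using
    Presented.projStar_eq (SolidRel.comm (p := p) (θ := θ))

theorem h_mul_star_x (p θ : ℝ) :
    h p θ * star (x p θ) = phase (-θ) • (star (x p θ) * h p θ) := by
  simpa only [x, h, map_sub, map_smul, map_mul, map_star, map_one, Presented.projStar_of] using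
    Presented.projStar_eq (SolidRel.comm_star (p := p) (θ := θ))

/-- The element `1 - xx*`. -/
def s (p θ : ℝ) : Solid p θ := 1 - x p θ * star (x p θ)

theorem x_mul_star (p θ : ℝ) : x p θ * star (x p θ) = 1 - s p θ := by
  rw [s, sub_sub_cancel]

theorem star_x_mul_x (p θ : ℝ) : star (x p θ) * x p θ = 1 - (p : ℂ) • s p θ := by
  rw [sub_eq_iff_eq_add.1 (star_x_mul p θ), x_mul_star, smul_sub, sub_smul, one_smul]
  abel

/-- The vectors `(1 - xx*)^k x^m h^n`. -/
def mono (p θ : ℝ) : ℕ × ℤ × ℤ → Solid p θ :=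
  monomials (s p θ) (x p θ) (star (x p θ)) (h p θ) (star (h p θ))

theorem span_mono {p : ℝ} (hp : p ≠ 0) (θ : ℝ) :
    Submodule.span ℂ (Set.range (mono p θ)) = ⊤ := by
  refine span_monomials (p := p) (φ := phase θ) (by exact_mod_cast hp) (phase_ne_zero θ)
    (x_mul_star p θ) (star_x_mul_x p θ) (h_mul_star p θ) (star_h_mul p θ) (h_mul_x p θ)
    (by rw [h_mul_star_x, phase_neg]) ?_
  rw [eq_top_iff]
  rintro w -
  refine Presented.mem_of_gen_mem _ ?_ ?_ w <;> rintro ⟨⟩ <;> apply Algebra.subset_adjoin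
  · exact Or.inl rfl
  · exact Or.inr (Or.inr (Or.inl rfl))
  · exact Or.inr (Or.inl rfl)
  · exact Or.inr (Or.inr (Or.inr rfl))

/-- The representation of the quantum solid torus by weighted shifts. -/
def shiftRep {p : ℝ} (hp : p ≠ 0) (θ : ℝ) {R : Type} [CommRing R] [Algebra ℂ R] (t : R) :
    Solid p θ →ₐ[ℂ] Module.End ℂ (ℤ → ℤ → R) :=
  have hp' : (p : ℂ) ≠ 0 := by exact_mod_cast hp
  Presented.algLift
    (Sum.elim (fun | .x => shiftX R | .h => shiftH R (phase θ))
      (fun | .x => shiftY p t | .h => shiftK R (phase θ))) (by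
    have hφ := phase_ne_zero θ
    have hy := shiftH_mul_shiftY hφ (p : ℂ) t
    have hk := shiftY_mul_shiftK hφ (p : ℂ) t
    have hxy := shiftY_mul_shiftX hp' t
    rw [← phase_neg] at hy hk
    rintro _ _ (⟨⟨⟩⟩ | ⟨⟨⟩⟩) <;>
    simp only [star_mul, star_sub, star_smul, star_star, star_one, map_mul, map_sub, map_smul,
      map_one, FreeStar.letterLift_of, FreeStar.letterLift_star_of, Sum.elim_inl, Sum.elim_inr,
      shiftH_mul_shiftK hφ, shiftK_mul_shiftH hφ, shiftH_mul_shiftX hφ, hy,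
      shiftX_mul_shiftK hφ, hk, star_phase, neg_neg, hxy,
      show star (p : ℂ) = p from Complex.conj_ofReal p])

theorem shiftRep_mono {p : ℝ} (hp : p ≠ 0) (θ : ℝ) {R : Type} [CommRing R] [Algebra ℂ R] (t : R)
    (i : ℕ × ℤ × ℤ) : shiftRep hp θ t (mono p θ i) =
      monomials (1 - shiftX R * shiftY (p : ℂ) t) (shiftX R) (shiftY (p : ℂ) t)
        (shiftH R (phase θ)) (shiftK R (phase θ)) i := by
  have h1 : shiftRep hp θ t (x p θ) = shiftX R := Presented.algLift_gen _ _ _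
  have h2 : shiftRep hp θ t (star (x p θ)) = shiftY (p : ℂ) t := Presented.algLift_star_gen _ _ _
  have h3 : shiftRep hp θ t (h p θ) = shiftH R (phase θ) := Presented.algLift_gen _ _ _
  have h4 : shiftRep hp θ t (star (h p θ)) = shiftK R (phase θ) :=
    Presented.algLift_star_gen _ _ _
  simp only [mono, monomials, map_mul, map_pow, map_ipow, s, map_sub, map_one, h1, h2, h3, h4]

open Polynomial in
theorem linearIndependent_mono {p : ℝ} (hp : p ≠ 0) (θ : ℝ) :
    LinearIndependent ℂ (mono p θ) := by
  rw [linearIndependent_iff']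
  rintro F g hF ⟨k, m, n⟩ hi
  have ht : ∀ j : ℤ, (1 : ℂ[X]) - (p : ℂ) ^ j • (X : ℂ[X]) ≠ 0 := by
    intro j hj
    have := congrArg (Polynomial.eval 0) hj
    simp at this
  have h1 := congrArg (shiftRep hp θ (X : ℂ[X])) hF
  simp only [map_sum, map_smul, shiftRep_mono, map_zero] at h1
  have h2 := congrArg (fun P => Polynomial.coeff P k)
    (sum_coeff_eq_zero_of_shift (phase_ne_zero θ) ht F g h1 m n)
  simp only [Polynomial.finsetSum_coeff, Polynomial.coeff_zero] at h2
  rw [Finset.sum_eq_single_of_mem (k, m, n) hi] at h2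
  · simpa using h2
  · rintro ⟨k', m', n'⟩ - hne
    split_ifs with h
    · have : k ≠ k' := by
        rintro rfl
        exact hne (by rw [Prod.mk.injEq]; exact ⟨rfl, h⟩)
      simp [Polynomial.coeff_X_pow, this]
    · simp

end Solid

namespace Torus

/-- The vectors `V^m U^n`. -/
def mono (φ : ℝ) (i : ℤ × ℤ) : Torus φ := spow (V φ) i.1 * spow (U φ) i.2

/-- The representation of the quantum torus by shifts. -/
def shiftRep (φ : ℝ) : Torus φ →ₐ[ℂ] Module.End ℂ (ℤ → ℤ → ℂ) :=
  Presented.algLift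
    (Sum.elim (fun | .V => shiftX ℂ | .U => shiftH ℂ (phase φ))
      (fun | .V => shiftY 1 0 | .U => shiftK ℂ (phase φ))) (by
    have hφ := phase_ne_zero φ
    have hy := shiftH_mul_shiftY hφ (1 : ℂ) (0 : ℂ)
    have hk := shiftY_mul_shiftK hφ (1 : ℂ) (0 : ℂ)
    rw [← phase_neg] at hy hk
    have h1 : shiftX ℂ * shiftY 1 0 = 1 := by
      ext f j l
      simp [shiftX_mul_shiftY_apply]
    have h2 : shiftY 1 0 * shiftX ℂ = 1 := by
      ext f j l
      simp [shiftX_apply, shiftY_apply]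
    rintro _ _ (⟨⟨⟩⟩ | ⟨⟨⟩⟩) <;>
    simp only [star_mul, star_smul, star_star, star_one, map_mul, map_smul,
      map_one, FreeStar.letterLift_of, FreeStar.letterLift_star_of, Sum.elim_inl, Sum.elim_inr,
      shiftH_mul_shiftK hφ, shiftK_mul_shiftH hφ, shiftH_mul_shiftX hφ, hy,
      shiftX_mul_shiftK hφ, hk, star_phase, neg_neg, h1, h2])

theorem linearIndependent_mono (φ : ℝ) : LinearIndependent ℂ (mono φ) := by
  rw [linearIndependent_iff']
  rintro F g hF ⟨m, n⟩ hi
  have h1 : shiftRep φ (V φ) = shiftX ℂ := Presented.algLift_gen _ _ _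
  have h2 : shiftRep φ (star (V φ)) = shiftY 1 0 := Presented.algLift_star_gen _ _ _
  have h3 : shiftRep φ (U φ) = shiftH ℂ (phase φ) := Presented.algLift_gen _ _ _
  have h4 : shiftRep φ (star (U φ)) = shiftK ℂ (phase φ) := Presented.algLift_star_gen _ _ _
  have h5 := congrArg (shiftRep φ) hF
  simp only [map_sum, map_smul, mono, map_mul, spow_eq_ipow, map_ipow, h1, h2, h3, h4,
    map_zero] at h5
  have h6 := sum_coeff_eq_zero_of_shift (R := ℂ) (p := 1) (phase_ne_zero φ) (t := 0) (by simp)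
    (F.image (Prod.mk 0)) (fun i => g i.2)
    (by rw [Finset.sum_image (by simp)]; simpa [monomials] using h5) m n
  rw [Finset.sum_image (by simp)] at h6
  simpa [hi] using h6

end Torus

/-! ## The deformed binomial theorem -/

section Binomial

theorem qInt_pos {p : ℝ} (hp : 0 < p) (n : ℕ) : 0 < qInt p (n + 1) :=
  Finset.sum_pos (fun i _ => pow_pos hp i) ⟨0, by simp⟩

theorem qFactorial_pos {p : ℝ} (hp : 0 < p) (n : ℕ) : 0 < qFactorial p n :=
  Finset.prod_pos fun i _ => qInt_pos hp i

theorem qFactorial_succ (p : ℝ) (n : ℕ) :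
    qFactorial p (n + 1) = qFactorial p n * qInt p (n + 1) :=
  Finset.prod_range_succ _ n

theorem qInt_add (p : ℝ) (m n : ℕ) : qInt p (m + n) = qInt p m + p ^ m * qInt p n := by
  simp only [qInt, Finset.sum_range_add, Finset.mul_sum, pow_add]

theorem qBinom_zero_right {p : ℝ} (hp : 0 < p) (n : ℕ) : qBinom p n 0 = 1 := by
  have h0 : qFactorial p 0 = 1 := Finset.prod_range_zero _
  rw [qBinom, h0, one_mul, Nat.sub_zero, div_self (qFactorial_pos hp n).ne']

theorem qBinom_self {p : ℝ} (hp : 0 < p) (n : ℕ) : qBinom p n n = 1 := by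
  have h0 : qFactorial p 0 = 1 := Finset.prod_range_zero _
  rw [qBinom, Nat.sub_self, h0, mul_one, div_self (qFactorial_pos hp n).ne']

theorem qBinom_succ_succ {p : ℝ} (hp : 0 < p) {n m : ℕ} (h : m < n) :
    qBinom p (n + 1) (m + 1) = qBinom p n m + p ^ (m + 1) * qBinom p n (m + 1) := by
  obtain ⟨d, rfl⟩ := Nat.exists_eq_add_of_lt h
  have e1 : m + d + 1 + 1 - (m + 1) = d + 1 := by omega
  have e2 : m + d + 1 - m = d + 1 := by omega
  have e3 : m + d + 1 - (m + 1) = d := by omega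
  have e4 : qInt p (m + d + 1 + 1) = qInt p (m + 1) + p ^ (m + 1) * qInt p (d + 1) := by
    rw [← qInt_add]
    congr 1
    omega
  simp only [qBinom, e1, e2, e3]
  rw [qFactorial_succ p (m + d + 1), e4, qFactorial_succ p m, qFactorial_succ p d]
  have h1 := (qInt_pos hp m).ne'
  have h2 := (qInt_pos hp d).ne'
  have h3 := (qFactorial_pos hp m).ne'
  have h4 := (qFactorial_pos hp d).ne'
  field_simp

/-- The coefficients of `raisePoly`. -/
def raiseCoeff (p : ℝ) (n m : ℕ) : ℝ :=
  (-1) ^ m * p ^ (-((n : ℤ) * m) + m * (m + 1) / 2) * qBinom p n m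

theorem raiseCoeff_zero {p : ℝ} (hp : 0 < p) (n : ℕ) : raiseCoeff p n 0 = 1 := by
  simp [raiseCoeff, qBinom_zero_right hp]

theorem triangle_succ (m : ℕ) :
    ((m + 1 : ℕ) : ℤ) * ((m + 1 : ℕ) + 1) / 2 = (m : ℤ) * (m + 1) / 2 + (m + 1) := by
  rw [← Int.add_mul_ediv_right _ _ two_ne_zero]
  congr 1
  push_cast
  ring

theorem raiseCoeff_succ_succ {p : ℝ} (hp : 0 < p) {n m : ℕ} (h : m < n) :
    raiseCoeff p (n + 1) (m + 1) = raiseCoeff p n (m + 1) - p ^ (-(n : ℤ)) * raiseCoeff p n m := by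
  simp only [raiseCoeff, qBinom_succ_succ hp h, triangle_succ]
  set N : ℤ := (m : ℤ) * (m + 1) / 2
  have e1 : -(((n + 1 : ℕ) : ℤ) * (m + 1 : ℕ)) + (N + (m + 1)) = -(n : ℤ) + (-(n * m) + N) := by
    push_cast
    ring
  have e2 : -((n : ℤ) * (m + 1 : ℕ)) + (N + (m + 1)) = -(n : ℤ) + (-(n * m) + N) + (m + 1 : ℕ) := by
    push_cast
    ring
  rw [e1, e2, zpow_add₀ hp.ne' _ ((m + 1 : ℕ) : ℤ), zpow_natCast, zpow_add₀ hp.ne' (-(n : ℤ)),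
    pow_succ (-1 : ℝ)]
  ring

theorem raiseCoeff_succ_self {p : ℝ} (hp : 0 < p) (n : ℕ) :
    raiseCoeff p (n + 1) (n + 1) = -(p ^ (-(n : ℤ)) * raiseCoeff p n n) := by
  simp only [raiseCoeff, qBinom_self hp, triangle_succ]
  set N : ℤ := (n : ℤ) * (n + 1) / 2
  have e1 : -(((n + 1 : ℕ) : ℤ) * (n + 1 : ℕ)) + (N + (n + 1)) = -(n : ℤ) + (-(n * n) + N) := by
    push_cast
    ring
  rw [e1, zpow_add₀ hp.ne' (-(n : ℤ)), pow_succ (-1 : ℝ)]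
  ring

variable {A : Type*} [Ring A] [Algebra ℂ A]

theorem raisePoly_eq (p : ℝ) (n : ℕ) (t : A) :
    raisePoly p n t = ∑ m ∈ Finset.range (n + 1), (raiseCoeff p n m : ℂ) • t ^ m := rfl

theorem raisePoly_zero_left {p : ℝ} (hp : 0 < p) (t : A) : raisePoly p 0 t = 1 := by
  simp [raisePoly_eq, raiseCoeff_zero hp]

theorem raisePoly_succ {p : ℝ} (hp : 0 < p) (n : ℕ) (t : A) :
    raisePoly p (n + 1) t = (1 - (p⁻¹ : ℂ) ^ n • t) * raisePoly p n t := by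
  have e1 : ∑ m ∈ Finset.range (n + 1), (raiseCoeff p n m : ℂ) • t ^ m =
      ∑ m ∈ Finset.range n, (raiseCoeff p n (m + 1) : ℂ) • t ^ (m + 1) + 1 := by
    rw [Finset.sum_range_succ', raiseCoeff_zero hp, pow_zero, Complex.ofReal_one, one_smul]
  have e2 : (p⁻¹ : ℂ) ^ n = ((p ^ (-(n : ℤ)) : ℝ) : ℂ) := by simp
  rw [raisePoly_eq, raisePoly_eq, sub_mul, one_mul, smul_mul_assoc, Finset.mul_sum,
    Finset.smul_sum, e1, Finset.sum_range_succ', raiseCoeff_zero hp, pow_zero,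
    Complex.ofReal_one, one_smul, e2, Finset.sum_range_succ _ n, Finset.sum_range_succ _ n,
    raiseCoeff_succ_self hp, Finset.sum_congr rfl fun m hm => by
      rw [raiseCoeff_succ_succ hp (Finset.mem_range.1 hm)]]
  simp only [mul_smul_comm, ← pow_succ', smul_smul, Complex.ofReal_sub, Complex.ofReal_mul,
    Complex.ofReal_neg, sub_smul, neg_smul, Finset.sum_sub_distrib]
  abel

theorem lowerPoly_eq_raisePoly {p : ℝ} (hp : 0 < p) (n : ℕ) (t : A) :
    lowerPoly p n t = raisePoly p⁻¹ n ((p : ℂ) • t) := by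
  rw [lowerPoly, raisePoly_eq]
  refine Finset.sum_congr rfl fun m _ => ?_
  rw [smul_pow, smul_smul, raiseCoeff]
  congr 1
  rw [← Complex.ofReal_pow, ← Complex.ofReal_mul]
  congr 1
  have e : (m : ℤ) * (m + 1) / 2 = m * (m - 1) / 2 + m := by
    rw [← Int.add_mul_ediv_right _ _ two_ne_zero]
    congr 1
    ring
  rw [inv_zpow', e, show -(-((n : ℤ) * m) + (m * (m - 1) / 2 + m)) =
    (n : ℤ) * m - m * (m - 1) / 2 - m by ring, zpow_sub₀ hp.ne' _ (m : ℤ), zpow_natCast]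
  have := (pow_pos hp m).ne'
  field_simp

theorem lowerPoly_zero_left {p : ℝ} (hp : 0 < p) (t : A) : lowerPoly p 0 t = 1 := by
  rw [lowerPoly_eq_raisePoly hp, raisePoly_zero_left (inv_pos.2 hp)]

theorem lowerPoly_succ {p : ℝ} (hp : 0 < p) (n : ℕ) (t : A) :
    lowerPoly p (n + 1) t = (1 - (p : ℂ) ^ (n + 1) • t) * lowerPoly p n t := by
  rw [lowerPoly_eq_raisePoly hp, lowerPoly_eq_raisePoly hp, raisePoly_succ (inv_pos.2 hp),
    smul_smul, Complex.ofReal_inv, inv_inv, pow_succ]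

theorem raisePoly_zero_right {p : ℝ} (hp : 0 < p) (n : ℕ) : raisePoly p n (0 : A) = 1 := by
  induction n with
  | zero => exact raisePoly_zero_left hp _
  | succ n ih => rw [raisePoly_succ hp, ih, smul_zero, sub_zero, one_mul]

theorem lowerPoly_zero_right {p : ℝ} (hp : 0 < p) (n : ℕ) : lowerPoly p n (0 : A) = 1 := by
  rw [lowerPoly_eq_raisePoly hp, smul_zero, raisePoly_zero_right (inv_pos.2 hp)]

end Binomial

/-! ## Computations in the quantum solid torus -/

theorem phase_nat_mul (n : ℕ) (t : ℝ) : phase (n * t) = phase t ^ n := by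
  simp only [phase, ← Complex.exp_nat_mul]
  congr 1
  push_cast
  ring

theorem phase_half_mul_phase_half (n : ℕ) (t : ℝ) :
    phase (n * t / 2) * phase (n * t / 2) = phase t ^ n := by
  rw [← phase_add, add_halves, phase_nat_mul]

namespace Solid

theorem star_s (p θ : ℝ) : star (s p θ) = s p θ := by
  rw [s, star_sub, star_mul, star_star, star_one]

theorem s_mul_x (p θ : ℝ) : s p θ * x p θ = (p : ℂ) • (x p θ * s p θ) := by
  have e : s p θ * x p θ = x p θ * (1 - star (x p θ) * x p θ) := by rw [s]; noncomm_ring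
  rw [e, star_x_mul_x, sub_sub_cancel, mul_smul_comm]

theorem star_x_mul_s (p θ : ℝ) : star (x p θ) * s p θ = (p : ℂ) • (s p θ * star (x p θ)) := by
  have e : star (x p θ) * s p θ = (1 - star (x p θ) * x p θ) * star (x p θ) := by
    rw [s]; noncomm_ring
  rw [e, star_x_mul_x, sub_sub_cancel, smul_mul_assoc]

theorem star_h_mul_x (p θ : ℝ) :
    star (h p θ) * x p θ = (phase θ)⁻¹ • (x p θ * star (h p θ)) := by
  have e := congrArg star (h_mul_star_x p θ)
  rw [star_mul, star_smul, star_mul, star_star, star_phase, neg_neg] at e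
  rw [e, smul_smul, inv_mul_cancel₀ (phase_ne_zero θ), one_smul]

theorem star_h_mul_star_x (p θ : ℝ) :
    star (h p θ) * star (x p θ) = phase θ • (star (x p θ) * star (h p θ)) := by
  have e := congrArg star (h_mul_x p θ)
  rw [star_mul, star_smul, star_mul, star_phase, phase_neg] at e
  rw [e, smul_smul, mul_inv_cancel₀ (phase_ne_zero θ), one_smul]

theorem h_mul_star_x' (p θ : ℝ) :
    h p θ * star (x p θ) = (phase θ)⁻¹ • (star (x p θ) * h p θ) := by
  rw [h_mul_star_x, phase_neg]

theorem h_mul_s (p θ : ℝ) : h p θ * s p θ = s p θ * h p θ := by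
  rw [s, mul_sub, sub_mul, ← mul_assoc, h_mul_x, smul_mul_assoc, mul_assoc, h_mul_star_x',
    mul_smul_comm, smul_smul, mul_inv_cancel₀ (phase_ne_zero θ), one_smul, mul_assoc, mul_one,
    one_mul]

theorem star_h_mul_s (p θ : ℝ) : star (h p θ) * s p θ = s p θ * star (h p θ) := by
  have e := congrArg star (h_mul_s p θ)
  rw [star_mul, star_mul, star_s] at e
  exact e.symm

theorem x_pow_mul_star_x_pow {p : ℝ} (hp : 0 < p) (θ : ℝ) (n : ℕ) :
    x p θ ^ n * star (x p θ) ^ n = raisePoly p n (s p θ) := by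
  have hp' : (p : ℂ) ≠ 0 := by exact_mod_cast hp.ne'
  have e : x p θ * s p θ = (p : ℂ)⁻¹ • (s p θ * x p θ) := by
    rw [s_mul_x, smul_smul, inv_mul_cancel₀ hp', one_smul]
  induction n with
  | zero => rw [pow_zero, pow_zero, mul_one, raisePoly_zero_left hp]
  | succ n ih =>
    rw [pow_succ, pow_succ', mul_assoc, ← mul_assoc (x p θ), x_mul_star, ← mul_assoc, mul_sub,
      mul_one, pow_mul_of_twist e, raisePoly_succ hp, ← ih, ← smul_mul_assoc, ← one_sub_mul,
      mul_assoc]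

theorem star_x_pow_mul_x_pow {p : ℝ} (hp : 0 < p) (θ : ℝ) (n : ℕ) :
    star (x p θ) ^ n * x p θ ^ n = lowerPoly p n (s p θ) := by
  induction n with
  | zero => rw [pow_zero, pow_zero, mul_one, lowerPoly_zero_left hp]
  | succ n ih =>
    rw [pow_succ, pow_succ', mul_assoc, ← mul_assoc (star (x p θ)), star_x_mul_x, ← mul_assoc,
      mul_sub, mul_one, mul_smul_comm, pow_mul_of_twist (star_x_mul_s p θ), lowerPoly_succ hp,
      ← ih, smul_smul, ← pow_succ', ← smul_mul_assoc, ← one_sub_mul, mul_assoc]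

theorem x_mul_star_pow_sub (p θ : ℝ) (n : ℕ) :
    x p θ * star (x p θ) ^ n - star (x p θ) ^ n * x p θ =
      ((p : ℂ) ^ n - 1) • (s p θ * spow (x p θ) (1 - (n : ℤ))) := by
  cases n with
  | zero => simp
  | succ n =>
    have e : spow (x p θ) (1 - ((n + 1 : ℕ) : ℤ)) = star (x p θ) ^ n := by
      cases n with
      | zero => simp [spow_zero]
      | succ n =>
        have : 1 - ((n + 1 + 1 : ℕ) : ℤ) = Int.negSucc n := by rw [Int.negSucc_eq]; push_cast; ring
        rw [this]; rfl
    rw [e, pow_succ', ← mul_assoc, x_mul_star, ← pow_succ', pow_succ, mul_assoc, star_x_mul_x,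
      sub_mul, one_mul, mul_sub, mul_one, mul_smul_comm, pow_mul_of_twist (star_x_mul_s p θ),
      smul_smul, ← pow_succ', sub_smul, one_smul]
    abel

theorem star_x_mul_pow_sub (p θ : ℝ) (n : ℕ) :
    star (x p θ) * x p θ ^ n - x p θ ^ n * star (x p θ) =
      (1 - (p : ℂ) ^ n) • (spow (x p θ) ((n : ℤ) - 1) * s p θ) := by
  cases n with
  | zero => simp
  | succ n =>
    have e : spow (x p θ) (((n + 1 : ℕ) : ℤ) - 1) = x p θ ^ n := by
      have : ((n + 1 : ℕ) : ℤ) - 1 = Int.ofNat n := by simp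
      rw [this]; rfl
    rw [e, pow_succ', ← mul_assoc, star_x_mul_x, ← pow_succ', pow_succ, mul_assoc, x_mul_star,
      sub_mul, one_mul, mul_sub, mul_one, smul_mul_assoc, mul_pow_of_twist (s_mul_x p θ),
      smul_smul, ← pow_succ', sub_smul, one_smul]
    abel

end Solid

/-! ## The two components of the lens space -/

open FreeStar (of)

theorem lens_fst_rel {p : ℝ} (hp : 0 < p) {q : ℝ} (hq : 0 < q) (θ : ℝ) (β : ℕ)
    (f : LensGen → Solid p θ) (fxi : f .xi = Solid.s p θ) (fz : f .z = Solid.x p θ)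
    (fa : f .a = phase (β * θ / 2) • (Solid.x p θ ^ β * Solid.h p θ))
    (fb : f .b = phase (β * θ / 2) • star (Solid.h p θ))
    (v w : FreeStar LensGen) (hr : LensRel p q θ β v w) :
    FreeStar.lift f v = FreeStar.lift f w := by
  have hω2 := phase_half_mul_phase_half β θ
  have hφ := phase_ne_zero θ
  have hω0 := phase_ne_zero (β * θ / 2)
  have hη : 1 - Solid.x p θ * star (Solid.x p θ) - Solid.s p θ = 0 := sub_self _
  have hhK := Solid.h_mul_star p θ
  have hKh := Solid.star_h_mul p θ
  have hsa : star (f .a) = phase (β * θ / 2) • (star (Solid.x p θ) ^ β * star (Solid.h p θ)) := by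
    rw [fa, star_smul, star_phase, phase_neg, star_mul, star_pow,
      mul_pow_of_twist (Solid.star_h_mul_star_x p θ), smul_smul, ← hω2, ← mul_assoc,
      inv_mul_cancel₀ hω0, one_mul]
  have hsb : star (f .b) = (phase (β * θ / 2))⁻¹ • Solid.h p θ := by
    rw [fb, star_smul, star_phase, phase_neg, star_star]
  have hba : f .b * f .a = f .z ^ β := by
    rw [fa, fb, fz, smul_mul_smul_comm, ← mul_assoc, mul_pow_of_twist (Solid.star_h_mul_x p θ),
      smul_mul_assoc, mul_assoc, hKh, mul_one, smul_smul, hω2, inv_pow,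
      mul_inv_cancel₀ (pow_ne_zero _ hφ), one_smul]
  cases hr <;>
  simp only [map_sub, map_mul, map_smul, map_star, map_one, map_zero, map_pow, map_spow,
    map_lowerPoly, map_raisePoly, FreeStar.lift_of]
  case xi_star => rw [fxi, Solid.star_s]
  case xi_z => rw [fxi, fz, Solid.s_mul_x]
  case z_star_z =>
    rw [fxi, fz, Solid.star_x_mul_x, Solid.x_mul_star]
    simp only [sub_smul, smul_sub, one_smul]
    abel
  case ortho => rw [fxi, fz, hη, zero_mul]
  case xi_a =>
    rw [fxi, fa, mul_smul_comm, ← mul_assoc, mul_pow_of_twist (Solid.s_mul_x p θ), smul_mul_assoc,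
      smul_mul_assoc, mul_assoc, mul_assoc, Solid.h_mul_s, smul_comm]
  case xi_b => rw [fxi, fb, mul_smul_comm, smul_mul_assoc, Solid.star_h_mul_s]
  case z_a =>
    rw [fz, fa, mul_smul_comm, smul_mul_assoc, mul_assoc (_ ^ β), Solid.h_mul_x, mul_smul_comm,
      smul_comm (phase (-θ)), smul_smul (phase (-θ)), phase_neg_mul_phase, one_smul, ← mul_assoc,
      ← mul_assoc, ← pow_succ, ← pow_succ']
  case z_b =>
    rw [fz, fb, mul_smul_comm, smul_mul_assoc, Solid.star_h_mul_x, smul_comm (phase θ),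
      smul_smul (phase θ), mul_inv_cancel₀ hφ, one_smul]
  case z_a_star =>
    rw [hsa, fxi, fz, fb, mul_smul_comm, smul_mul_assoc, mul_assoc (_ ^ β), Solid.star_h_mul_x,
      mul_smul_comm, smul_comm (phase θ), smul_smul (phase θ), mul_inv_cancel₀ hφ, one_smul,
      ← mul_assoc, ← mul_assoc, ← smul_sub, ← sub_mul, Solid.x_mul_star_pow_sub, smul_mul_assoc,
      mul_smul_comm, smul_comm]
  case z_star_b =>
    rw [fxi, fz, fb, hη, mul_zero, zero_mul, smul_zero, mul_smul_comm, smul_mul_assoc,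
      Solid.star_h_mul_star_x, smul_comm (phase (-θ)), smul_smul (phase (-θ)), phase_neg_mul_phase,
      one_smul, sub_self]
  case a_b =>
    rw [hba, phase_nat_mul, fa, fb, fz, smul_mul_smul_comm, mul_assoc, hhK, mul_one, hω2]
  case a_b_star =>
    rw [hsb, fa, smul_mul_smul_comm, smul_mul_smul_comm, mul_inv_cancel₀ hω0, inv_mul_cancel₀ hω0,
      one_smul, one_smul, ← mul_assoc (Solid.h p θ), mul_pow_of_twist (Solid.h_mul_x p θ),
      smul_mul_assoc, smul_smul, phase_neg, phase_nat_mul,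
      inv_mul_cancel₀ (pow_ne_zero _ hφ), one_smul]
  case b_a => exact hba
  case a_star_a =>
    rw [hsa, fa, fxi, smul_mul_smul_comm, hω2, mul_assoc, ← mul_assoc (star (Solid.h p θ)),
      mul_pow_of_twist (Solid.star_h_mul_x p θ), smul_mul_assoc, mul_assoc, hKh, mul_one,
      mul_smul_comm, smul_smul, inv_pow, mul_inv_cancel₀ (pow_ne_zero _ hφ), one_smul,
      Solid.star_x_pow_mul_x_pow hp]
  case a_a_star =>
    rw [fa, fxi, star_smul, star_mul, star_pow, smul_mul_smul_comm, star_phase,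
      phase_mul_phase_neg, one_smul, mul_assoc, ← mul_assoc (Solid.h p θ), hhK, one_mul,
      Solid.x_pow_mul_star_x_pow hp]
  case b_star_b =>
    rw [hsb, fb, fz, fxi, hη, lowerPoly_zero_right hq, smul_mul_smul_comm, inv_mul_cancel₀ hω0,
      hhK, one_smul]
  case b_b_star =>
    rw [hsb, fb, fz, fxi, hη, raisePoly_zero_right hq, smul_mul_smul_comm, mul_inv_cancel₀ hω0,
      hKh, one_smul]

theorem lens_snd_rel {p : ℝ} (hp : 0 < p) {q : ℝ} (hq : 0 < q) (θ : ℝ) (β : ℕ)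
    (f : LensGen → Solid q θ) (fxi : f .xi = 0) (fz : f .z = Solid.x q θ)
    (fa : f .a = Solid.h q θ)
    (fb : f .b = Solid.x q θ ^ β * star (Solid.h q θ))
    (v w : FreeStar LensGen) (hr : LensRel p q θ β v w) :
    FreeStar.lift f v = FreeStar.lift f w := by
  have hφ := phase_ne_zero θ
  have hη : 1 - Solid.x q θ * star (Solid.x q θ) - 0 = Solid.s q θ := sub_zero _
  have hhK := Solid.h_mul_star q θ
  have hKh := Solid.star_h_mul q θ
  have hsb : star (f .b) = Solid.h q θ * star (Solid.x q θ) ^ β := by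
    rw [fb, star_mul, star_pow, star_star]
  have hba : f .b * f .a = f .z ^ β := by
    rw [fa, fb, fz, mul_assoc, hKh, mul_one]
  cases hr <;>
  simp only [map_sub, map_mul, map_smul, map_star, map_one, map_zero, map_pow, map_spow,
    map_lowerPoly, map_raisePoly, FreeStar.lift_of]
  case xi_star => rw [fxi, star_zero]
  case xi_z => rw [fxi, zero_mul, mul_zero, smul_zero]
  case z_star_z => rw [fxi, fz, smul_zero, sub_zero, Solid.star_x_mul]
  case ortho => rw [fxi, mul_zero]
  case xi_a => rw [fxi, zero_mul, mul_zero, smul_zero]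
  case xi_b => rw [fxi, zero_mul, mul_zero]
  case z_a => rw [fz, fa, Solid.h_mul_x, smul_smul, phase_neg_mul_phase, one_smul]
  case z_b =>
    rw [fz, fb, mul_assoc, Solid.star_h_mul_x, mul_smul_comm, smul_smul, mul_inv_cancel₀ hφ,
      one_smul, ← mul_assoc, ← mul_assoc, ← pow_succ, ← pow_succ']
  case z_a_star =>
    rw [fz, fa, fxi, Solid.star_h_mul_x, smul_smul, mul_inv_cancel₀ hφ, one_smul, sub_self,
      zero_mul, zero_mul, smul_zero]
  case z_star_b =>
    rw [fz, fb, fa, fxi, hη, mul_assoc (_ ^ β), Solid.star_h_mul_star_x, mul_smul_comm, smul_smul,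
      phase_neg_mul_phase, one_smul, ← mul_assoc, ← mul_assoc, ← sub_mul,
      Solid.star_x_mul_pow_sub, smul_mul_assoc]
  case a_b =>
    rw [hba, phase_nat_mul, fa, fb, fz, ← mul_assoc, mul_pow_of_twist (Solid.h_mul_x q θ),
      smul_mul_assoc, mul_assoc, hhK, mul_one]
  case a_b_star =>
    rw [hsb, fa, mul_assoc _ _ (Solid.h q θ), mul_pow_of_twist (Solid.h_mul_star_x' q θ),
      mul_smul_comm, phase_neg, phase_nat_mul, inv_pow]
  case b_a => exact hba
  case a_star_a => rw [fa, fxi, hKh, lowerPoly_zero_right hp]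
  case a_a_star => rw [fa, fxi, hhK, raisePoly_zero_right hp]
  case b_star_b =>
    rw [hsb, fb, fz, fxi, hη, mul_pow_of_twist (Solid.h_mul_star_x' q θ), smul_mul_assoc,
      mul_assoc, ← mul_assoc (Solid.h q θ), mul_pow_of_twist (Solid.h_mul_x q θ), smul_mul_assoc,
      mul_assoc, hhK, mul_one, mul_smul_comm, smul_smul, inv_pow,
      inv_mul_cancel₀ (pow_ne_zero _ hφ), one_smul, Solid.star_x_pow_mul_x_pow hq]
  case b_b_star =>
    rw [hsb, fb, fz, fxi, hη, mul_assoc, ← mul_assoc (star (Solid.h q θ)), hKh, one_mul,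
      Solid.x_pow_mul_star_x_pow hq]

namespace Lens

variable {p q : ℝ} (hp : 0 < p) (hq : 0 < q) (θ : ℝ) (β : ℕ)

/-- The projection of the quantum lens space to the first quantum solid torus. -/
def fst : Lens p q θ β →⋆ₐ[ℂ] Solid p θ :=
  Presented.lift (fun
    | .xi => Solid.s p θ
    | .z => Solid.x p θ
    | .a => phase (β * θ / 2) • (Solid.x p θ ^ β * Solid.h p θ)
    | .b => phase (β * θ / 2) • star (Solid.h p θ))
    (lens_fst_rel hp hq θ β _ rfl rfl rfl rfl)

/-- The projection of the quantum lens space to the second quantum solid torus. -/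
def snd : Lens p q θ β →⋆ₐ[ℂ] Solid q θ :=
  Presented.lift (fun
    | .xi => 0
    | .z => Solid.x q θ
    | .a => Solid.h q θ
    | .b => Solid.x q θ ^ β * star (Solid.h q θ))
    (lens_snd_rel hp hq θ β _ rfl rfl rfl rfl)

theorem fst_xi : fst hp hq θ β (xi p q θ β) = Solid.s p θ := Presented.lift_gen _ _ _
theorem fst_z : fst hp hq θ β (z p q θ β) = Solid.x p θ := Presented.lift_gen _ _ _
theorem fst_a : fst hp hq θ β (a p q θ β) = phase (β * θ / 2) • (Solid.x p θ ^ β * Solid.h p θ) :=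
  Presented.lift_gen _ _ _
theorem fst_b : fst hp hq θ β (b p q θ β) = phase (β * θ / 2) • star (Solid.h p θ) :=
  Presented.lift_gen _ _ _
theorem snd_xi : snd hp hq θ β (xi p q θ β) = 0 := Presented.lift_gen _ _ _
theorem snd_z : snd hp hq θ β (z p q θ β) = Solid.x q θ := Presented.lift_gen _ _ _
theorem snd_a : snd hp hq θ β (a p q θ β) = Solid.h q θ := Presented.lift_gen _ _ _
theorem snd_b : snd hp hq θ β (b p q θ β) = Solid.x q θ ^ β * star (Solid.h q θ) :=
  Presented.lift_gen _ _ _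

theorem fst_eta : fst hp hq θ β (eta p q θ β) = 0 := by
  rw [eta, map_sub, map_sub, map_mul, map_star, map_one, fst_z, fst_xi, Solid.s, sub_self]

theorem snd_eta : snd hp hq θ β (eta p q θ β) = Solid.s q θ := by
  rw [eta, map_sub, map_sub, map_mul, map_star, map_one, snd_z, snd_xi, Solid.s, sub_zero]

theorem fst_surjective : Function.Surjective (fst hp hq θ β) := by
  refine Presented.hom_surjective _ ?_
  rintro ⟨⟩
  · exact ⟨_, fst_z hp hq θ β⟩
  · refine ⟨phase (β * θ / 2) • star (b p q θ β), ?_⟩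
    rw [map_smul, map_star, fst_b, star_smul, star_star, star_phase, smul_smul,
      phase_mul_phase_neg, one_smul]
    rfl

theorem snd_surjective : Function.Surjective (snd hp hq θ β) := by
  refine Presented.hom_surjective _ ?_
  rintro ⟨⟩
  · exact ⟨_, snd_z hp hq θ β⟩
  · exact ⟨_, snd_a hp hq θ β⟩

theorem chi12_fst_eq_chi21_snd (w : Lens p q θ β) :
    chi12 p θ (fst hp hq θ β w) = chi21 q θ β (snd hp hq θ β w) := by
  refine Presented.hom_ext (f := (chi12 p θ).comp (fst hp hq θ β))
    (g := (chi21 q θ β).comp (snd hp hq θ β)) ?_ w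
  rintro ⟨⟩
  · change chi12 p θ (fst hp hq θ β (xi p q θ β)) = chi21 q θ β (snd hp hq θ β (xi p q θ β))
    rw [fst_xi, snd_xi, Solid.s, map_sub, map_mul, map_star, map_one, chi12_x, Torus.V_mul_star,
      sub_self, map_zero]
  · change chi12 p θ (fst hp hq θ β (z p q θ β)) = chi21 q θ β (snd hp hq θ β (z p q θ β))
    rw [fst_z, snd_z, chi12_x, chi21_x]
  · change chi12 p θ (fst hp hq θ β (a p q θ β)) = chi21 q θ β (snd hp hq θ β (a p q θ β))
    rw [fst_a, snd_a, map_smul, map_mul, map_pow, chi12_x, chi12_h, chi21_h]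
  · change chi12 p θ (fst hp hq θ β (b p q θ β)) = chi21 q θ β (snd hp hq θ β (b p q θ β))
    have e : Torus.V θ * star (Torus.U θ) = phase θ • (star (Torus.U θ) * Torus.V θ) := by
      have := congrArg star (Torus.U_mul_star_V (φ := θ))
      rwa [star_smul, star_mul, star_mul, star_star, star_phase, neg_neg] at this
    have hc : Torus.V θ ^ β * star (Torus.V θ) ^ β = 1 := by
      have hc : Commute (Torus.V θ) (star (Torus.V θ)) :=
        Torus.V_mul_star.trans Torus.star_V_mul.symm
      rw [← hc.mul_pow, Torus.V_mul_star, one_pow]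
    rw [fst_b, snd_b, map_smul, map_mul, map_star, map_star, map_pow, chi12_h, chi21_h, chi21_x,
      star_smul, star_mul, star_pow, mul_smul_comm, ← mul_assoc, pow_mul_of_twist e,
      smul_mul_assoc, mul_assoc, hc, mul_one, smul_smul, star_phase, phase_neg,
      ← phase_half_mul_phase_half, inv_mul_cancel_left₀ (phase_ne_zero _)]

end Lens

theorem eq_zero_of_mem_span_of_map_eq_zero {ι M N : Type*} [AddCommGroup M] [Module ℂ M]
    [AddCommGroup N] [Module ℂ N] {v : ι → M} (f : M →ₗ[ℂ] N) (h : LinearIndependent ℂ (f ∘ v))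
    {w : M} (hw : w ∈ Submodule.span ℂ (Set.range v)) (hf : f w = 0) : w = 0 :=
  Submodule.disjoint_def.1 (Submodule.range_ker_disjoint h) w hw hf

/-! ## Ideals attached to normal elements -/

section Ideals

variable {A : Type*} [Ring A] [Algebra ℂ A]

/-- The two-sided ideal annihilating the right ideal generated by `e`. -/
def annIdeal (e : A) : Ideal A where
  carrier := {r | ∀ w, e * w * r = 0}
  add_mem' := fun {a b} ha hb w => by rw [mul_add, ha, hb, add_zero]
  zero_mem' := fun w => mul_zero _
  smul_mem' := fun c r hr w => by rw [smul_eq_mul, ← mul_assoc, mul_assoc e, hr]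

instance (e : A) : (annIdeal e).IsTwoSided :=
  ⟨fun {a} b ha w => by rw [← mul_assoc, ha w, zero_mul]⟩

/-- The right ideal generated by `e`, for `e` such that it is two-sided. -/
def normalIdeal (e : A) (he : ∀ w, ∃ w', w * e = e * w') : Ideal A where
  carrier := {r | ∃ w, r = e * w}
  add_mem' := by
    rintro _ _ ⟨v, rfl⟩ ⟨w, rfl⟩
    exact ⟨v + w, (mul_add _ _ _).symm⟩
  zero_mem' := ⟨0, (mul_zero _).symm⟩
  smul_mem' := by
    rintro c _ ⟨w, rfl⟩
    obtain ⟨c', hc⟩ := he c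
    exact ⟨c' * w, by rw [smul_eq_mul, ← mul_assoc, hc, mul_assoc]⟩

instance (e : A) (he : ∀ w, ∃ w', w * e = e * w') : (normalIdeal e he).IsTwoSided :=
  ⟨fun {a} b ha => by
    obtain ⟨w, rfl⟩ := ha
    exact ⟨w * b, mul_assoc _ _ _⟩⟩

/-- The elements `w` with `ew ∈ Ae`. -/
def twistSubalgebra (e : A) : Subalgebra ℂ A where
  carrier := {w | ∃ w', e * w = w' * e}
  mul_mem' := by
    rintro v w ⟨v', hv⟩ ⟨w', hw⟩
    exact ⟨v' * w', by rw [← mul_assoc, hv, mul_assoc, hw, mul_assoc]⟩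
  add_mem' := by
    rintro v w ⟨v', hv⟩ ⟨w', hw⟩
    exact ⟨v' + w', by rw [mul_add, add_mul, hv, hw]⟩
  algebraMap_mem' c := ⟨algebraMap ℂ A c, (Algebra.commutes c e).symm⟩

theorem mem_twistSubalgebra_of_smul {e w : A} {c : ℂ} (h : e * w = c • (w * e)) :
    w ∈ twistSubalgebra e :=
  ⟨c • w, by rw [h, smul_mul_assoc]⟩

theorem smul_mem_ideal (I : Ideal A) (c : ℂ) {r : A} (hr : r ∈ I) : c • r ∈ I := by
  rw [Algebra.smul_def]
  exact I.mul_mem_left _ hr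

theorem raisePoly_sub_one_mem (I : Ideal A) [I.IsTwoSided] {p : ℝ} (hp : 0 < p) (n : ℕ) {t : A}
    (ht : t ∈ I) : raisePoly p n t - 1 ∈ I := by
  induction n with
  | zero => rw [raisePoly_zero_left hp, sub_self]; exact I.zero_mem
  | succ n ih =>
    rw [raisePoly_succ hp, sub_mul, one_mul, sub_right_comm]
    exact I.sub_mem ih (I.mul_mem_right _ (smul_mem_ideal I _ ht))

theorem lowerPoly_sub_one_mem (I : Ideal A) [I.IsTwoSided] {p : ℝ} (hp : 0 < p) (n : ℕ) {t : A}
    (ht : t ∈ I) : lowerPoly p n t - 1 ∈ I := by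
  rw [lowerPoly_eq_raisePoly hp]
  exact raisePoly_sub_one_mem I (inv_pos.2 hp) n (smul_mem_ideal I _ ht)

end Ideals

/-! ## The basis of the lens space -/

namespace Lens

section Relations

variable (p q θ : ℝ) (β : ℕ)

theorem star_xi : star (xi p q θ β) = xi p q θ β := by
  simpa only [map_star, Presented.projStar_of, xi, z, a, b, eta] using
    Presented.projStar_eq (LensRel.xi_star (p := p) (q := q) (θ := θ) (β := β))

theorem xi_mul_z : xi p q θ β * z p q θ β = (p : ℂ) • (z p q θ β * xi p q θ β) := by
  simpa only [map_smul, map_mul, Presented.projStar_of, xi, z, a, b, eta] using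
    Presented.projStar_eq (LensRel.xi_z (p := p) (q := q) (θ := θ) (β := β))

theorem star_z_mul_z : star (z p q θ β) * z p q θ β - (q : ℂ) • (z p q θ β * star (z p q θ β)) =
    (1 - q : ℂ) • 1 - (p - q : ℂ) • xi p q θ β := by
  simpa only [map_sub, map_star, map_one, map_smul, map_mul, Presented.projStar_of, xi, z, a, b, eta] using
    Presented.projStar_eq (LensRel.z_star_z (p := p) (q := q) (θ := θ) (β := β))

theorem eta_mul_xi : eta p q θ β * xi p q θ β = 0 := by
  simpa only [map_sub, map_star, map_one, map_zero, map_mul, Presented.projStar_of, xi, z, a, b, eta] using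
    Presented.projStar_eq (LensRel.ortho (p := p) (q := q) (θ := θ) (β := β))

theorem xi_mul_a : xi p q θ β * a p q θ β = (p : ℂ) ^ β • (a p q θ β * xi p q θ β) := by
  simpa only [map_smul, map_mul, Presented.projStar_of, xi, z, a, b, eta] using
    Presented.projStar_eq (LensRel.xi_a (p := p) (q := q) (θ := θ) (β := β))

theorem xi_mul_b : xi p q θ β * b p q θ β = b p q θ β * xi p q θ β := by
  simpa only [map_mul, Presented.projStar_of, xi, z, a, b, eta] using
    Presented.projStar_eq (LensRel.xi_b (p := p) (q := q) (θ := θ) (β := β))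

theorem z_mul_a : z p q θ β * a p q θ β = phase (-θ) • (a p q θ β * z p q θ β) := by
  simpa only [map_smul, map_mul, Presented.projStar_of, xi, z, a, b, eta] using
    Presented.projStar_eq (LensRel.z_a (p := p) (q := q) (θ := θ) (β := β))

theorem z_mul_b : z p q θ β * b p q θ β = phase θ • (b p q θ β * z p q θ β) := by
  simpa only [map_smul, map_mul, Presented.projStar_of, xi, z, a, b, eta] using
    Presented.projStar_eq (LensRel.z_b (p := p) (q := q) (θ := θ) (β := β))

theorem z_mul_star_a : z p q θ β * star (a p q θ β) - phase θ • (star (a p q θ β) * z p q θ β) =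
    ((p : ℂ) ^ β - 1) • (xi p q θ β * spow (z p q θ β) (1 - (β : ℤ)) * b p q θ β) := by
  simpa only [map_sub, map_star, map_spow, map_smul, map_mul, Presented.projStar_of, xi, z, a, b, eta] using
    Presented.projStar_eq (LensRel.z_a_star (p := p) (q := q) (θ := θ) (β := β))

theorem star_z_mul_b :
    star (z p q θ β) * b p q θ β - phase (-θ) • (b p q θ β * star (z p q θ β)) =
      (1 - (q : ℂ) ^ β) •
        (spow (z p q θ β) ((β : ℤ) - 1) * eta p q θ β * star (a p q θ β)) := by
  simpa only [map_sub, map_star, map_spow, map_one, map_smul, map_mul, Presented.projStar_of, xi, z, a, b, eta] using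
    Presented.projStar_eq (LensRel.z_star_b (p := p) (q := q) (θ := θ) (β := β))

theorem b_mul_a : b p q θ β * a p q θ β = z p q θ β ^ β := by
  simpa only [map_mul, map_pow, Presented.projStar_of, xi, z, a, b, eta] using
    Presented.projStar_eq (LensRel.b_a (p := p) (q := q) (θ := θ) (β := β))

theorem star_a_mul_a : star (a p q θ β) * a p q θ β = lowerPoly p β (xi p q θ β) := by
  simpa only [map_mul, map_star, map_lowerPoly, Presented.projStar_of, xi, z, a, b, eta] using
    Presented.projStar_eq (LensRel.a_star_a (p := p) (q := q) (θ := θ) (β := β))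

theorem a_mul_star_a : a p q θ β * star (a p q θ β) = raisePoly p β (xi p q θ β) := by
  simpa only [map_mul, map_star, map_raisePoly, Presented.projStar_of, xi, z, a, b, eta] using
    Presented.projStar_eq (LensRel.a_a_star (p := p) (q := q) (θ := θ) (β := β))

theorem star_b_mul_b : star (b p q θ β) * b p q θ β = lowerPoly q β (eta p q θ β) := by
  simpa only [map_sub, map_one, map_mul, map_star, map_lowerPoly, Presented.projStar_of, xi, z, a, b, eta] using
    Presented.projStar_eq (LensRel.b_star_b (p := p) (q := q) (θ := θ) (β := β))

theorem b_mul_star_b : b p q θ β * star (b p q θ β) = raisePoly q β (eta p q θ β) := by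
  simpa only [map_sub, map_one, map_mul, map_star, map_raisePoly, Presented.projStar_of, xi, z, a, b, eta] using
    Presented.projStar_eq (LensRel.b_b_star (p := p) (q := q) (θ := θ) (β := β))

theorem star_eta : star (eta p q θ β) = eta p q θ β := by
  rw [eta, star_sub, star_sub, star_mul, star_star, star_one, star_xi]

theorem xi_mul_eta : xi p q θ β * eta p q θ β = 0 := by
  have e := congrArg star (eta_mul_xi p q θ β)
  rwa [star_mul, star_xi, star_eta, star_zero] at e

theorem z_mul_star_z : z p q θ β * star (z p q θ β) = 1 - xi p q θ β - eta p q θ β := by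
  rw [eta]
  abel

theorem star_z_mul_z' : star (z p q θ β) * z p q θ β =
    1 - (p : ℂ) • xi p q θ β - (q : ℂ) • eta p q θ β := by
  rw [sub_eq_iff_eq_add.1 (star_z_mul_z p q θ β), z_mul_star_z]
  simp only [smul_sub, sub_smul, one_smul]
  abel

end Relations

variable {p q : ℝ} (hp : 0 < p) (hq : 0 < q) (θ : ℝ) (β : ℕ)

include hp in
theorem xi_mul_eq (w : Lens p q θ β) : ∃ w', xi p q θ β * w = w' * xi p q θ β := by
  have hp' : (p : ℂ) ≠ 0 := by exact_mod_cast hp.ne'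
  have hz := congrArg star (xi_mul_z p q θ β)
  have ha := congrArg star (xi_mul_a p q θ β)
  have hb := congrArg star (xi_mul_b p q θ β)
  have hs : star (p : ℂ) = p := Complex.conj_ofReal p
  rw [star_smul, star_mul, star_mul, star_xi, hs] at hz
  rw [star_smul, star_mul, star_mul, star_xi, star_pow, hs] at ha
  rw [star_mul, star_mul, star_xi] at hb
  refine Presented.mem_of_gen_mem (twistSubalgebra (xi p q θ β)) ?_ ?_ w
  · rintro ⟨⟩
    · exact ⟨_, rfl⟩
    · exact mem_twistSubalgebra_of_smul (xi_mul_z p q θ β)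
    · exact mem_twistSubalgebra_of_smul (xi_mul_a p q θ β)
    · exact ⟨_, xi_mul_b p q θ β⟩
  · rintro ⟨⟩
    · exact ⟨xi p q θ β, congrArg (xi p q θ β * ·) (star_xi p q θ β)⟩
    · refine mem_twistSubalgebra_of_smul (c := (p : ℂ)⁻¹) ?_
      exact (eq_inv_smul_iff₀ hp').2 hz.symm
    · refine mem_twistSubalgebra_of_smul (c := ((p : ℂ) ^ β)⁻¹) ?_
      exact (eq_inv_smul_iff₀ (pow_ne_zero _ hp')).2 ha.symm
    · exact ⟨_, hb.symm⟩

include hp in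
theorem mul_xi_eq (w : Lens p q θ β) : ∃ w', w * xi p q θ β = xi p q θ β * w' := by
  obtain ⟨w', hw⟩ := xi_mul_eq hp θ β (star w)
  have e := congrArg star hw
  rw [star_mul, star_mul, star_star, star_xi] at e
  exact ⟨_, e⟩

include hp in
theorem eta_mem_annIdeal : eta p q θ β ∈ annIdeal (xi p q θ β) := by
  intro w
  obtain ⟨w', hw⟩ := xi_mul_eq hp θ β w
  rw [hw, mul_assoc, xi_mul_eta, mul_zero]

theorem family_inl (k : ℕ+) (m n : ℤ) : family p q θ β (.inl (k, m, n)) =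
    monomials (xi p q θ β) (z p q θ β) (star (z p q θ β)) (b p q θ β) (star (b p q θ β))
      (k, m, n) := by
  simp only [family, monomials, spow_eq_ipow]

theorem family_inr (i : ℕ × ℤ × ℤ) : family p q θ β (.inr i) =
    monomials (eta p q θ β) (z p q θ β) (star (z p q θ β)) (a p q θ β) (star (a p q θ β)) i := by
  simp only [family, monomials, spow_eq_ipow]

include hp hq in
theorem exists_sub_mem_annIdeal (w : Lens p q θ β) :
    ∃ v ∈ Submodule.span ℂ (Set.range (monomials (xi p q θ β) (z p q θ β) (star (z p q θ β))
      (b p q θ β) (star (b p q θ β)))), w - v ∈ annIdeal (xi p q θ β) := by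
  set I := annIdeal (xi p q θ β)
  have hη : eta p q θ β ∈ I := eta_mem_annIdeal hp θ β
  have hbb : b p q θ β * star (b p q θ β) - 1 ∈ I := by
    rw [b_mul_star_b]
    exact raisePoly_sub_one_mem I hq β hη
  have hbb' : star (b p q θ β) * b p q θ β - 1 ∈ I := by
    rw [star_b_mul_b]
    exact lowerPoly_sub_one_mem I hq β hη
  refine span_monomials_mod I (p := p) (φ := (phase θ)⁻¹) (by exact_mod_cast hp.ne')
    (inv_ne_zero (phase_ne_zero θ)) ?_ ?_ hbb hbb' ?_ ?_ ?_ w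
  · rw [z_mul_star_z, sub_sub_cancel_left]
    exact I.neg_mem hη
  · rw [star_z_mul_z', sub_sub_cancel_left]
    exact I.neg_mem (smul_mem_ideal I _ hη)
  · rw [z_mul_b, smul_smul, inv_mul_cancel₀ (phase_ne_zero θ), one_smul, sub_self]
    exact I.zero_mem
  · have e : b p q θ β * star (z p q θ β) - (phase θ)⁻¹⁻¹ • (star (z p q θ β) * b p q θ β) =
        -phase θ • (star (z p q θ β) * b p q θ β -
          phase (-θ) • (b p q θ β * star (z p q θ β))) := by
      rw [smul_sub, smul_smul, neg_mul, phase_mul_phase_neg, inv_inv, neg_smul, neg_smul, one_smul]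
      abel
    rw [e, star_z_mul_b]
    exact smul_mem_ideal I _ (smul_mem_ideal I _ (I.mul_mem_right _ (I.mul_mem_left _ hη)))
  · intro S hI hz hz' hb hb'
    have hxi : xi p q θ β ∈ S := by
      rw [show xi p q θ β = 1 - z p q θ β * star (z p q θ β) - eta p q θ β by rw [eta]; abel]
      exact S.sub_mem (S.sub_mem S.one_mem (S.mul_mem hz hz')) (hI _ hη)
    have ha : a p q θ β ∈ S := by
      have e : a p q θ β = star (b p q θ β) * z p q θ β ^ β -
          (star (b p q θ β) * b p q θ β - 1) * a p q θ β := by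
        rw [← b_mul_a]; noncomm_ring
      rw [e]
      exact S.sub_mem (S.mul_mem hb' (S.pow_mem hz _)) (hI _ (I.mul_mem_right _ hbb'))
    have ha' : star (a p q θ β) ∈ S := by
      have e : star (a p q θ β) = star (z p q θ β) ^ β * b p q θ β -
          star (a p q θ β) * (star (b p q θ β) * b p q θ β - 1) := by
        rw [← star_pow, ← b_mul_a, star_mul]; noncomm_ring
      rw [e]
      exact S.sub_mem (S.mul_mem (S.pow_mem hz' _) hb) (hI _ (I.mul_mem_left _ hbb'))
    rw [eq_top_iff]
    rintro v -
    refine Presented.mem_of_gen_mem S ?_ ?_ v <;> rintro ⟨⟩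
    exacts [hxi, hz, ha, hb, by rwa [← star_xi] at hxi, hz', ha', hb']

include hp hq in
theorem exists_eq_add_xi_mul (w : Lens p q θ β) :
    ∃ v ∈ Submodule.span ℂ (Set.range (monomials (eta p q θ β) (z p q θ β) (star (z p q θ β))
      (a p q θ β) (star (a p q θ β)))), ∃ w', w = v + xi p q θ β * w' := by
  set I := normalIdeal (xi p q θ β) (mul_xi_eq hp θ β)
  have hξ : xi p q θ β ∈ I := ⟨1, (mul_one _).symm⟩
  have haa : a p q θ β * star (a p q θ β) - 1 ∈ I := by
    rw [a_mul_star_a]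
    exact raisePoly_sub_one_mem I hp β hξ
  have haa' : star (a p q θ β) * a p q θ β - 1 ∈ I := by
    rw [star_a_mul_a]
    exact lowerPoly_sub_one_mem I hp β hξ
  have hstar : ∀ r ∈ I, star r ∈ I := by
    rintro _ ⟨r, rfl⟩
    rw [star_mul, star_xi]
    exact I.mul_mem_left _ hξ
  suffices ∃ v ∈ Submodule.span ℂ (Set.range (monomials (eta p q θ β) (z p q θ β)
      (star (z p q θ β)) (a p q θ β) (star (a p q θ β)))), w - v ∈ I by
    obtain ⟨v, hv, w', e⟩ := this
    exact ⟨v, hv, w', by rw [← e, add_sub_cancel]⟩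
  refine span_monomials_mod I (p := q) (φ := phase θ) (by exact_mod_cast hq.ne')
    (phase_ne_zero θ) ?_ ?_ haa haa' ?_ ?_ ?_ w
  · rw [z_mul_star_z, sub_right_comm 1, sub_sub_cancel_left]
    exact I.neg_mem hξ
  · rw [star_z_mul_z', sub_right_comm 1, sub_sub_cancel_left]
    exact I.neg_mem (smul_mem_ideal I _ hξ)
  · rw [z_mul_a, smul_smul, phase_mul_phase_neg, one_smul, sub_self]
    exact I.zero_mem
  · have e := congrArg star (z_mul_star_a p q θ β)
    rw [star_sub, star_smul, star_mul, star_mul, star_star, star_phase, phase_neg] at e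
    rw [e]
    exact hstar _ (smul_mem_ideal I _ (I.mul_mem_right _ (I.mul_mem_right _ hξ)))
  · intro S hI hz hz' ha ha'
    have hb : b p q θ β ∈ S := by
      have e : b p q θ β = z p q θ β ^ β * star (a p q θ β) -
          b p q θ β * (a p q θ β * star (a p q θ β) - 1) := by
        rw [← b_mul_a]; noncomm_ring
      rw [e]
      exact S.sub_mem (S.mul_mem (S.pow_mem hz _) ha') (hI _ (I.mul_mem_left _ haa))
    have hb' : star (b p q θ β) ∈ S := by
      have e : star (b p q θ β) = a p q θ β * star (z p q θ β) ^ β -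
          (a p q θ β * star (a p q θ β) - 1) * star (b p q θ β) := by
        rw [← star_pow, ← b_mul_a, star_mul]; noncomm_ring
      rw [e]
      exact S.sub_mem (S.mul_mem ha (S.pow_mem hz' _)) (hI _ (I.mul_mem_right _ haa))
    rw [eq_top_iff]
    rintro v -
    refine Presented.mem_of_gen_mem S ?_ ?_ v <;> rintro ⟨⟩
    exacts [hI _ hξ, hz, ha, hb, hI _ (hstar _ hξ), hz', ha', hb']

include hp hq in
theorem span_family : Submodule.span ℂ (Set.range (family p q θ β)) = ⊤ := by
  rw [eq_top_iff]
  rintro w -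
  set W := Submodule.span ℂ (Set.range (family p q θ β))
  obtain ⟨v, hv, w', rfl⟩ := exists_eq_add_xi_mul hp hq θ β w
  obtain ⟨v', hv', hr⟩ := exists_sub_mem_annIdeal hp hq θ β w'
  have e : xi p q θ β * w' = xi p q θ β * v' := by
    have := hr 1
    rwa [mul_one, mul_sub, sub_eq_zero] at this
  rw [e]
  refine W.add_mem ?_ ?_
  · refine Submodule.span_le.2 ?_ hv
    rintro _ ⟨i, rfl⟩
    exact Submodule.subset_span ⟨.inr i, family_inr θ β i⟩
  · have h : Submodule.span ℂ (Set.range (monomials (xi p q θ β) (z p q θ β) (star (z p q θ β))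
      (b p q θ β) (star (b p q θ β)))) ≤ W.comap (LinearMap.mulLeft ℂ (xi p q θ β)) := by
      refine Submodule.span_le.2 ?_
      rintro _ ⟨⟨k, m, n⟩, rfl⟩
      refine Submodule.subset_span ⟨.inl (k.succPNat, m, n), ?_⟩
      rw [family_inl, LinearMap.mulLeft_apply, monomials, monomials, ← mul_assoc, ← mul_assoc]
      exact congrArg (· * _ * _) (pow_succ' _ _)
    exact h hv'

end Lens

theorem ipow_smul {A : Type*} [Ring A] [Algebra ℂ A] {c : ℂ} (x y : A) (n : ℤ) :
    ipow (c • x) (c⁻¹ • y) n = c ^ n • ipow x y n := by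
  cases n with
  | ofNat n => simp [ipow, smul_pow]
  | negSucc n => simp [ipow, smul_pow]

theorem ipow_swap {A : Type*} [Monoid A] (x y : A) (n : ℤ) : ipow y x n = ipow x y (-n) := by
  rcases n with (_ | n) | n
  · exact (pow_zero y).trans (pow_zero x).symm
  · rfl
  · rfl

theorem Solid.mono_eq (p θ : ℝ) (k : ℕ) (m n : ℤ) : Solid.mono p θ (k, m, n) =
    (1 - Solid.x p θ * star (Solid.x p θ)) ^ k * spow (Solid.x p θ) m * spow (Solid.h p θ) n := by
  simp only [mono, monomials, spow_eq_ipow, s]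

namespace Lens

variable {p q : ℝ} (hp : 0 < p) (hq : 0 < q) (θ : ℝ) (β : ℕ)

theorem snd_family_inl (i : ℕ+ × ℤ × ℤ) : snd hp hq θ β (family p q θ β (.inl i)) = 0 := by
  obtain ⟨k, m, n⟩ := i
  rw [family, map_mul, map_mul, map_pow, snd_xi, zero_pow k.ne_zero, zero_mul, zero_mul]

theorem snd_family_inr (i : ℕ × ℤ × ℤ) :
    snd hp hq θ β (family p q θ β (.inr i)) = Solid.mono q θ i := by
  rw [family_inr, monomials, map_mul, map_mul, map_pow, snd_eta, map_ipow, map_ipow, map_star,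
    map_star, snd_z, snd_a]
  rfl

theorem fst_family_inl (k : ℕ+) (m n : ℤ) : fst hp hq θ β (family p q θ β (.inl (k, m, n))) =
    phase (β * θ / 2) ^ n • Solid.mono p θ (k, m, -n) := by
  rw [family_inl, monomials, map_mul, map_mul, map_pow, fst_xi, map_ipow, map_ipow, map_star,
    map_star, fst_z, fst_b, star_smul, star_star, star_phase, phase_neg, ipow_smul, ipow_swap (Solid.h p θ),
    mul_smul_comm]
  rfl

theorem linearIndependent_snd_family_inr :
    LinearIndependent ℂ (snd hp hq θ β ∘ family p q θ β ∘ Sum.inr) := by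
  have e : snd hp hq θ β ∘ family p q θ β ∘ Sum.inr = Solid.mono q θ :=
    funext (snd_family_inr hp hq θ β)
  rw [e]
  exact Solid.linearIndependent_mono hq.ne' θ

theorem linearIndependent_fst_family_inl :
    LinearIndependent ℂ (fst hp hq θ β ∘ family p q θ β ∘ Sum.inl) := by
  have h := (Solid.linearIndependent_mono hp.ne' θ).comp
    (fun i : ℕ+ × ℤ × ℤ => ((i.1 : ℕ), i.2.1, -i.2.2)) (by
      rintro ⟨k, m, n⟩ ⟨k', m', n'⟩ h
      simp only [Prod.mk.injEq, neg_inj, PNat.coe_inj] at h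
      obtain ⟨rfl, rfl, rfl⟩ := h
      rfl)
  convert! h.units_smul
    (fun i => Units.mk0 (phase (β * θ / 2) ^ i.2.2) (zpow_ne_zero _ (phase_ne_zero _))) using 1
  funext ⟨k, m, n⟩
  exact fst_family_inl hp hq θ β k m n

include hp hq in
theorem linearIndependent_family : LinearIndependent ℂ (family p q θ β) := by
  rw [← Sum.elim_comp_inl_inr (family p q θ β)]
  refine (LinearIndependent.of_comp (fst hp hq θ β).toAlgHom.toLinearMap
    (linearIndependent_fst_family_inl hp hq θ β)).sum_type
    (LinearIndependent.of_comp (snd hp hq θ β).toAlgHom.toLinearMap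
    (linearIndependent_snd_family_inr hp hq θ β)) ?_
  have hd := Submodule.range_ker_disjoint (f := (snd hp hq θ β).toAlgHom.toLinearMap)
    (linearIndependent_snd_family_inr hp hq θ β)
  refine hd.symm.mono_left (Submodule.span_le.2 ?_)
  rintro _ ⟨i, rfl⟩
  exact snd_family_inl hp hq θ β i

theorem eq_zero_of_fst_of_snd {w : Lens p q θ β} (h1 : fst hp hq θ β w = 0)
    (h2 : snd hp hq θ β w = 0) : w = 0 := by
  have hw : w ∈ Submodule.span ℂ (Set.range (family p q θ β)) := by
    rw [span_family hp hq]; trivial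
  rw [← Sum.elim_comp_inl_inr (family p q θ β), Set.Sum.elim_range, Submodule.span_union] at hw
  obtain ⟨v1, hv1, v2, hv2, rfl⟩ := Submodule.mem_sup.1 hw
  have hz : snd hp hq θ β v1 = 0 := by
    have : Submodule.span ℂ (Set.range (family p q θ β ∘ Sum.inl)) ≤
        LinearMap.ker (snd hp hq θ β).toAlgHom.toLinearMap := by
      refine Submodule.span_le.2 ?_
      rintro _ ⟨i, rfl⟩
      exact snd_family_inl hp hq θ β i
    exact this hv1
  rw [map_add, hz, zero_add] at h2
  obtain rfl : v2 = 0 := eq_zero_of_mem_span_of_map_eq_zero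
    (snd hp hq θ β).toAlgHom.toLinearMap (linearIndependent_snd_family_inr hp hq θ β) hv2 h2
  rw [add_zero] at h1 ⊢
  exact eq_zero_of_mem_span_of_map_eq_zero
    (fst hp hq θ β).toAlgHom.toLinearMap (linearIndependent_fst_family_inl hp hq θ β) hv1 h1

end Lens

/-! ## Kernels of the boundary maps -/

theorem Solid.exists_add_s_mul {p : ℝ} (hp : p ≠ 0) (θ : ℝ) (w : Solid p θ) :
    ∃ v ∈ Submodule.span ℂ (Set.range fun i : ℤ × ℤ => Solid.mono p θ (0, i)),
      ∃ w', w = v + Solid.s p θ * w' := by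
  have hw : w ∈ Submodule.span ℂ (Set.range (Solid.mono p θ)) := by
    rw [span_mono hp]; trivial
  have hle : Submodule.span ℂ (Set.range (Solid.mono p θ)) ≤
      Submodule.span ℂ (Set.range fun i : ℤ × ℤ => Solid.mono p θ (0, i)) ⊔
        LinearMap.range (LinearMap.mulLeft ℂ (Solid.s p θ)) := by
    refine Submodule.span_le.2 ?_
    rintro _ ⟨⟨_ | k, i⟩, rfl⟩
    · exact Submodule.mem_sup_left (Submodule.subset_span ⟨i, rfl⟩)
    · refine Submodule.mem_sup_right ⟨Solid.mono p θ (k, i), ?_⟩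
      rw [LinearMap.mulLeft_apply, mono, monomials, monomials, pow_succ']
      simp only [mul_assoc]
  obtain ⟨v, hv, _, ⟨w', rfl⟩, rfl⟩ := Submodule.mem_sup.1 (hle hw)
  exact ⟨v, hv, w', rfl⟩

theorem exists_eq_s_mul_of_chi21_eq_zero {q : ℝ} (hq : q ≠ 0) (θ : ℝ) (β : ℕ) {w : Solid q θ}
    (hw : chi21 q θ β w = 0) : ∃ w', w = Solid.s q θ * w' := by
  obtain ⟨v, hv, w', rfl⟩ := Solid.exists_add_s_mul hq θ w
  have hs : chi21 q θ β (Solid.s q θ) = 0 := by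
    rw [Solid.s, map_sub, map_mul, map_star, map_one, chi21_x, Torus.V_mul_star, sub_self]
  rw [map_add, map_mul, hs, zero_mul, add_zero] at hw
  refine ⟨w', ?_⟩
  rw [eq_zero_of_mem_span_of_map_eq_zero (chi21 q θ β).toAlgHom.toLinearMap ?_ hv hw, zero_add]
  have h := (Torus.linearIndependent_mono θ).comp
    (fun i : ℤ × ℤ => (i.1 + β * i.2, i.2)) (by
      rintro ⟨m, n⟩ ⟨m', n'⟩ h
      simp only [Prod.mk.injEq] at h
      obtain ⟨h, rfl⟩ := h
      rw [add_left_inj] at h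
      rw [h])
  convert! h.units_smul
    (fun i => Units.mk0 (phase (β * θ * i.2 ^ 2 / 2)) (phase_ne_zero _)) using 1
  funext ⟨m, n⟩
  change chi21 q θ β (Solid.mono q θ (0, m, n)) = _
  rw [Solid.mono_eq, chi21_basis, if_pos rfl]
  rfl

/-! ## The lens space as a gluing -/

namespace Lens

variable {p q : ℝ} (hp : 0 < p) (hq : 0 < q) (θ : ℝ) (β : ℕ)

/-- The `*`-homomorphism from the lens space to the gluing of two solid tori. -/
def toGlue : Lens p q θ β →⋆ₐ[ℂ] glue (chi12 p θ) (chi21 q θ β) :=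
  ((fst hp hq θ β).prod (snd hp hq θ β)).codRestrict _
    (chi12_fst_eq_chi21_snd hp hq θ β)

theorem coe_toGlue (w : Lens p q θ β) : (toGlue hp hq θ β w : Solid p θ × Solid q θ) =
    (fst hp hq θ β w, snd hp hq θ β w) := rfl

theorem toGlue_bijective : Function.Bijective (toGlue hp hq θ β) := by
  refine ⟨(injective_iff_map_eq_zero _).2 fun w hw => ?_, ?_⟩
  · have e := congrArg Subtype.val hw
    rw [coe_toGlue] at e
    exact eq_zero_of_fst_of_snd hp hq θ β (congrArg Prod.fst e) (congrArg Prod.snd e)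
  · rintro ⟨⟨v, w⟩, h⟩
    rw [mem_glue] at h
    obtain ⟨l, rfl⟩ := fst_surjective hp hq θ β v
    have hk : chi21 q θ β (w - snd hp hq θ β l) = 0 := by
      rw [map_sub, ← h, chi12_fst_eq_chi21_snd, sub_self]
    obtain ⟨w', hw'⟩ := exists_eq_s_mul_of_chi21_eq_zero hq.ne' θ β hk
    obtain ⟨l', rfl⟩ := snd_surjective hp hq θ β w'
    refine ⟨l + eta p q θ β * l', Subtype.ext ?_⟩
    rw [coe_toGlue, map_add, map_add, map_mul, map_mul, fst_eta, snd_eta, zero_mul, add_zero,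
      ← hw', add_sub_cancel]

/-! ## The coaction on the basis -/

theorem coaction_xi : coaction p q θ β (xi p q θ β) = xi p q θ β ⊗ₜ 1 := Presented.lift_gen _ _ _
theorem coaction_z : coaction p q θ β (z p q θ β) = z p q θ β ⊗ₜ 1 := Presented.lift_gen _ _ _
theorem coaction_a : coaction p q θ β (a p q θ β) = a p q θ β ⊗ₜ u 1 := Presented.lift_gen _ _ _
theorem coaction_b : coaction p q θ β (b p q θ β) = b p q θ β ⊗ₜ u (-1) := Presented.lift_gen _ _ _

end Lens

theorem u_pow (m : ℤ) (n : ℕ) : u m ^ n = u (n * m) := LaurentPolynomial.T_pow m n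

theorem spow_tmul_u {A : Type} [Ring A] [Algebra ℂ A] [StarRing A] [StarModule ℂ A] (x : A)
    (m n : ℤ) : spow (x ⊗ₜ[ℂ] u m) n = spow x n ⊗ₜ[ℂ] u (n * m) := by
  cases n with
  | ofNat n => simp only [spow, Algebra.TensorProduct.tmul_pow, u_pow, Int.ofNat_eq_natCast]
  | negSucc n =>
    simp only [spow, Algebra.TensorProduct.tmul_pow, TensorProduct.star_tmul, star_u, u_pow]
    congr 2
    rw [Int.negSucc_eq]
    push_cast
    ring

namespace Lens

variable {p q : ℝ} (hp : 0 < p) (hq : 0 < q) (θ : ℝ) (β : ℕ)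

/-- The degrees of the basis vectors. -/
def degree : (ℕ+ × ℤ × ℤ) ⊕ (ℕ × ℤ × ℤ) → ℤ
  | .inl i => -i.2.2
  | .inr i => i.2.2

theorem coaction_family (i : (ℕ+ × ℤ × ℤ) ⊕ (ℕ × ℤ × ℤ)) :
    coaction p q θ β (family p q θ β i) = family p q θ β i ⊗ₜ u (degree i) := by
  have heta : coaction p q θ β (eta p q θ β) = eta p q θ β ⊗ₜ 1 := by
    rw [eta, map_sub, map_sub, map_mul, map_star, map_one, coaction_z, coaction_xi,
      TensorProduct.star_tmul, star_one, Algebra.TensorProduct.tmul_mul_tmul, mul_one,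
      Algebra.TensorProduct.one_def, TensorProduct.sub_tmul, TensorProduct.sub_tmul]
  rcases i with ⟨k, m, n⟩ | ⟨k, m, n⟩
  · simp only [family, map_mul, map_pow, map_spow, coaction_xi, coaction_z, coaction_b,
      spow_tmul_u, spow_tmul_one, Algebra.TensorProduct.tmul_pow, one_pow,
      Algebra.TensorProduct.tmul_mul_tmul, one_mul, degree, mul_neg_one]
  · simp only [family, map_mul, map_pow, map_spow, heta, coaction_z, coaction_a,
      spow_tmul_u, spow_tmul_one, Algebra.TensorProduct.tmul_pow, one_pow,
      Algebra.TensorProduct.tmul_mul_tmul, one_mul, degree, mul_one]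

include hp hq in
theorem linearMap_ext {M : Type*} [AddCommGroup M] [Module ℂ M] {f g : Lens p q θ β →ₗ[ℂ] M}
    (h : ∀ i, f (family p q θ β i) = g (family p q θ β i)) : f = g :=
  LinearMap.ext_on (span_family hp hq θ β) (by rintro _ ⟨i, rfl⟩; exact h i)

include hp hq in
theorem isCoaction : IsCoaction (coaction p q θ β) := by
  have comul_u : ∀ n, Coalgebra.comul (R := ℂ) (u n) = u n ⊗ₜ[ℂ] u n :=
    LaurentPolynomial.comul_T
  have counit_u : ∀ n, Coalgebra.counit (R := ℂ) (u n) = 1 :=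
    LaurentPolynomial.counit_T
  have e : ∀ i, (coaction p q θ β).toAlgHom.toLinearMap (family p q θ β i) =
    family p q θ β i ⊗ₜ u (degree i) := coaction_family θ β
  constructor
  · refine LinearMap.congr_fun (linearMap_ext hp hq θ β
      (f := (TensorProduct.assoc ℂ _ OU1 OU1).toLinearMap ∘ₗ
        LinearMap.rTensor OU1 (coaction p q θ β).toAlgHom.toLinearMap ∘ₗ
        (coaction p q θ β).toAlgHom.toLinearMap)
      (g := LinearMap.lTensor _ (Coalgebra.comul (R := ℂ) (A := OU1)) ∘ₗ
        (coaction p q θ β).toAlgHom.toLinearMap) fun i => ?_)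
    simp only [LinearMap.comp_apply, e, LinearMap.rTensor_tmul, LinearMap.lTensor_tmul, comul_u]
    rfl
  · refine LinearMap.congr_fun (linearMap_ext hp hq θ β
      (f := (TensorProduct.rid ℂ _).toLinearMap ∘ₗ
        LinearMap.lTensor _ (Coalgebra.counit (R := ℂ) (A := OU1)) ∘ₗ
        (coaction p q θ β).toAlgHom.toLinearMap)
      (g := LinearMap.id) fun i => ?_)
    simp only [LinearMap.comp_apply, e, LinearMap.lTensor_tmul, counit_u,
      LinearEquiv.coe_coe, TensorProduct.rid_tmul, one_smul, LinearMap.id_apply]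

end Lens

theorem isColinear_of_gen {X : Type} {r : FreeStar X → FreeStar X → Prop} {B : Type} [Ring B]
    [Algebra ℂ B] [StarRing B] [StarModule ℂ B]
    {ρ : Presented r →⋆ₐ[ℂ] Presented r ⊗[ℂ] OU1} {σ : B →⋆ₐ[ℂ] B ⊗[ℂ] OU1}
    {F : Presented r →⋆ₐ[ℂ] B} (g : X → OU1)
    (hρ : ∀ x, ρ (Presented.gen r x) = Presented.gen r x ⊗ₜ g x)
    (hσ : ∀ x, σ (F (Presented.gen r x)) = F (Presented.gen r x) ⊗ₜ g x) :
    IsColinear ρ σ F := by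
  intro w
  refine DFunLike.congr_fun (Presented.algHom_ext (f := (σ.comp F).toAlgHom)
    (g := (Algebra.TensorProduct.map F.toAlgHom (AlgHom.id ℂ OU1)).comp ρ.toAlgHom)
    (fun x => ?_) (fun x => ?_)) w
  · change σ (F _) = Algebra.TensorProduct.map F.toAlgHom (AlgHom.id ℂ OU1) (ρ _)
    rw [hρ, hσ]
    rfl
  · change σ (F _) = Algebra.TensorProduct.map F.toAlgHom (AlgHom.id ℂ OU1) (ρ _)
    rw [map_star, map_star, map_star, hρ, hσ, TensorProduct.star_tmul, TensorProduct.star_tmul,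
      ← map_star]
    rfl

theorem Solid.coaction_x (p θ : ℝ) : Solid.coaction p θ (Solid.x p θ) = Solid.x p θ ⊗ₜ 1 :=
  Presented.lift_gen _ _ _

theorem Solid.coaction_h (p θ : ℝ) : Solid.coaction p θ (Solid.h p θ) = Solid.h p θ ⊗ₜ u 1 :=
  Presented.lift_gen _ _ _

namespace Lens

variable {p q : ℝ} (hp : 0 < p) (hq : 0 < q) (θ : ℝ) (β : ℕ)

theorem isColinear_fst :
    IsColinear (coaction p q θ β) (Solid.coaction p θ) (fst hp hq θ β) := by
  refine isColinear_of_gen (fun | .xi => 1 | .z => 1 | .a => u 1 | .b => u (-1)) ?_ ?_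
  · rintro ⟨⟩
    exacts [coaction_xi θ β, coaction_z θ β, coaction_a θ β, coaction_b θ β]
  · rintro ⟨⟩
    · change Solid.coaction p θ (fst hp hq θ β (xi p q θ β)) = fst hp hq θ β (xi p q θ β) ⊗ₜ 1
      rw [fst_xi, Solid.s, map_sub, map_mul, map_star, map_one, Solid.coaction_x,
        TensorProduct.star_tmul, star_one, Algebra.TensorProduct.tmul_mul_tmul, mul_one,
        Algebra.TensorProduct.one_def, TensorProduct.sub_tmul]
    · change Solid.coaction p θ (fst hp hq θ β (z p q θ β)) = fst hp hq θ β (z p q θ β) ⊗ₜ 1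
      rw [fst_z, Solid.coaction_x]
    · change Solid.coaction p θ (fst hp hq θ β (a p q θ β)) = fst hp hq θ β (a p q θ β) ⊗ₜ u 1
      rw [fst_a, map_smul, map_mul, map_pow, Solid.coaction_x, Solid.coaction_h,
        Algebra.TensorProduct.tmul_pow, one_pow, Algebra.TensorProduct.tmul_mul_tmul, one_mul,
        TensorProduct.smul_tmul']
    · change Solid.coaction p θ (fst hp hq θ β (b p q θ β)) = fst hp hq θ β (b p q θ β) ⊗ₜ u (-1)
      rw [fst_b, map_smul, map_star, Solid.coaction_h, TensorProduct.star_tmul, star_u,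
        TensorProduct.smul_tmul']

theorem isColinear_snd :
    IsColinear (coaction p q θ β) (Solid.coaction q θ) (snd hp hq θ β) := by
  refine isColinear_of_gen (fun | .xi => 1 | .z => 1 | .a => u 1 | .b => u (-1)) ?_ ?_
  · rintro ⟨⟩
    exacts [coaction_xi θ β, coaction_z θ β, coaction_a θ β, coaction_b θ β]
  · rintro ⟨⟩
    · change Solid.coaction q θ (snd hp hq θ β (xi p q θ β)) = snd hp hq θ β (xi p q θ β) ⊗ₜ 1
      rw [snd_xi, map_zero, TensorProduct.zero_tmul]
    · change Solid.coaction q θ (snd hp hq θ β (z p q θ β)) = snd hp hq θ β (z p q θ β) ⊗ₜ 1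
      rw [snd_z, Solid.coaction_x]
    · change Solid.coaction q θ (snd hp hq θ β (a p q θ β)) = snd hp hq θ β (a p q θ β) ⊗ₜ u 1
      rw [snd_a, Solid.coaction_h]
    · change Solid.coaction q θ (snd hp hq θ β (b p q θ β)) = snd hp hq θ β (b p q θ β) ⊗ₜ u (-1)
      rw [snd_b, map_mul, map_star, map_pow, Solid.coaction_x, Solid.coaction_h,
        Algebra.TensorProduct.tmul_pow, one_pow, TensorProduct.star_tmul, star_u,
        Algebra.TensorProduct.tmul_mul_tmul, one_mul]

/-! ## Coinvariants -/

/-- The constant coefficient of a Laurent polynomial. -/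
def constCoeff : OU1 →ₗ[ℂ] ℂ where
  toFun f := f.coeff 0
  map_add' _ _ := rfl
  map_smul' _ _ := rfl

theorem constCoeff_u (n : ℤ) : constCoeff (u n) = if n = 0 then 1 else 0 :=
  LaurentPolynomial.T_apply 0 n

include hp hq in
theorem mem_span_of_mem_coinvariants {w : Lens p q θ β} (hw : w ∈ coinvariants (coaction p q θ β)) :
    w ∈ Submodule.span ℂ (family p q θ β '' {i | degree i = 0}) := by
  set S := Submodule.span ℂ (family p q θ β '' {i | degree i = 0})
  let E : Lens p q θ β ⊗[ℂ] OU1 →ₗ[ℂ] Lens p q θ β :=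
    (TensorProduct.rid ℂ _).toLinearMap ∘ₗ LinearMap.lTensor _ constCoeff
  have hE : ∀ v n, E (v ⊗ₜ u n) = (if n = 0 then (1 : ℂ) else 0) • v := by
    intro v n
    simp only [E, LinearMap.comp_apply, LinearMap.lTensor_tmul, constCoeff_u, LinearEquiv.coe_coe,
      TensorProduct.rid_tmul]
  have hw' : coaction p q θ β w = w ⊗ₜ 1 := hw
  have h1 : E (coaction p q θ β w) = w := by
    rw [hw', ← u_zero, hE, if_pos rfl, one_smul]
  have h2 : ⊤ ≤ S.comap (E ∘ₗ (coaction p q θ β).toAlgHom.toLinearMap) := by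
    rw [← span_family hp hq]
    refine Submodule.span_le.2 ?_
    rintro _ ⟨i, rfl⟩
    change E (coaction p q θ β _) ∈ S
    rw [coaction_family, hE]
    split_ifs with h
    · rw [one_smul]
      exact Submodule.subset_span ⟨i, h, rfl⟩
    · rw [zero_smul]
      exact S.zero_mem
  rw [← h1]
  exact h2 (Submodule.mem_top (x := w))

end Lens

/-! ## The quantum sphere -/

section Sphere

variable (p q θ : ℝ) (β : ℕ)

namespace Sphere

theorem star_xi : star (xi p q) = xi p q := by
  simpa only [map_star, Presented.projStar_of, xi, z] using
    Presented.projStar_eq (SphereRel.xi_star (p := p) (q := q))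

theorem xi_mul_z : xi p q * z p q = (p : ℂ) • (z p q * xi p q) := by
  simpa only [map_mul, map_smul, Presented.projStar_of, xi, z] using
    Presented.projStar_eq (SphereRel.xi_z (p := p) (q := q))

theorem star_z_mul_z : star (z p q) * z p q - (q : ℂ) • (z p q * star (z p q)) =
    (1 - q : ℂ) • 1 - (p - q : ℂ) • xi p q := by
  simpa only [map_sub, map_one, map_star, map_mul, map_smul, Presented.projStar_of, xi, z] using
    Presented.projStar_eq (SphereRel.z_star_z (p := p) (q := q))

theorem eta_mul_xi : (1 - z p q * star (z p q) - xi p q) * xi p q = 0 := by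
  simpa only [map_sub, map_one, map_zero, map_star, map_mul, Presented.projStar_of, xi, z] using
    Presented.projStar_eq (SphereRel.ortho (p := p) (q := q))

/-- The inclusion of the quantum sphere into the quantum lens space. -/
def toLens : Sphere p q →⋆ₐ[ℂ] Lens p q θ β :=
  Presented.lift (fun | .xi => Lens.xi p q θ β | .z => Lens.z p q θ β) (by
    rintro _ _ ⟨⟩ <;>
    simp only [map_sub, map_one, map_zero, map_star, map_mul, map_smul, FreeStar.lift_of]
    · exact Lens.star_xi p q θ β
    · exact Lens.xi_mul_z p q θ β
    · exact Lens.star_z_mul_z p q θ β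
    · exact Lens.eta_mul_xi p q θ β)

theorem toLens_xi : toLens p q θ β (xi p q) = Lens.xi p q θ β := Presented.lift_gen _ _ _
theorem toLens_z : toLens p q θ β (z p q) = Lens.z p q θ β := Presented.lift_gen _ _ _

/-- The vectors `ξ^k z^m`, `k > 0`, and `(1 - zz* - ξ)^k z^m`, `k ≥ 0`. -/
def family : (ℕ+ × ℤ) ⊕ (ℕ × ℤ) → Sphere p q
  | .inl (k, m) => xi p q ^ (k : ℕ) * spow (z p q) m
  | .inr (k, m) => (1 - z p q * star (z p q) - xi p q) ^ k * spow (z p q) m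

theorem toLens_family_inl (k : ℕ+) (m : ℤ) :
    toLens p q θ β (family p q (.inl (k, m))) = Lens.family p q θ β (.inl (k, m, 0)) := by
  rw [family, Lens.family, map_mul, map_pow, map_spow, toLens_xi, toLens_z, spow_zero, mul_one]

theorem toLens_family_inr (k : ℕ) (m : ℤ) :
    toLens p q θ β (family p q (.inr (k, m))) = Lens.family p q θ β (.inr (k, m, 0)) := by
  rw [family, Lens.family, map_mul, map_pow, map_spow, map_sub, map_sub, map_mul, map_star,
    map_one, toLens_xi, toLens_z, spow_zero, mul_one, Lens.eta]

variable {p q} (hp : 0 < p) (hq : 0 < q)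

/-- The projection of the lens space of charge zero onto the quantum sphere. -/
def ofLens : Lens p q 0 0 →⋆ₐ[ℂ] Sphere p q :=
  Presented.lift (fun | .xi => xi p q | .z => z p q | .a => 1 | .b => 1) (by
    rintro _ _ ⟨⟩ <;>
    simp only [map_sub, map_one, map_zero, map_star, map_mul, map_smul,
      FreeStar.lift_of, lowerPoly_zero_left hp, lowerPoly_zero_left hq, raisePoly_zero_left hp, raisePoly_zero_left hq, star_one, mul_one,
      one_mul, pow_zero, one_smul, neg_zero, phase_zero, mul_zero, sub_self, zero_smul]
    · exact star_xi p q
    · exact xi_mul_z p q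
    · exact star_z_mul_z p q
    · exact eta_mul_xi p q)

include hp hq in
theorem span_family : Submodule.span ℂ (Set.range (family p q)) = ⊤ := by
  have exi : ofLens hp hq (Lens.xi p q 0 0) = xi p q := Presented.lift_gen _ _ _
  have ez : ofLens hp hq (Lens.z p q 0 0) = z p q := Presented.lift_gen _ _ _
  have ea : ofLens hp hq (Lens.a p q 0 0) = 1 := Presented.lift_gen _ _ _
  have eb : ofLens hp hq (Lens.b p q 0 0) = 1 := Presented.lift_gen _ _ _
  have e1 : ∀ n, spow (1 : Sphere p q) n = 1 := by
    rintro (n | n) <;> simp [spow]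
  have hs : Function.Surjective (ofLens hp hq) := by
    refine Presented.hom_surjective _ ?_
    rintro ⟨⟩
    exacts [⟨_, exi⟩, ⟨_, ez⟩]
  have htop := congrArg (Submodule.map (ofLens hp hq).toAlgHom.toLinearMap)
    (Lens.span_family hp hq 0 0)
  rw [Submodule.map_top, LinearMap.range_eq_top.2 hs, Submodule.map_span] at htop
  rw [← htop]
  refine le_antisymm (htop ▸ le_top) (Submodule.span_mono ?_)
  rintro _ ⟨_, ⟨i, rfl⟩, rfl⟩
  change ofLens hp hq _ ∈ _
  rcases i with ⟨k, m, n⟩ | ⟨k, m, n⟩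
  · refine ⟨.inl (k, m), ?_⟩
    rw [Lens.family, map_mul, map_mul, map_pow, map_spow, map_spow, exi, ez, eb, e1, mul_one]
    rfl
  · refine ⟨.inr (k, m), ?_⟩
    rw [Lens.family, Lens.eta, map_mul, map_mul, map_pow, map_spow, map_spow, map_sub, map_sub,
      map_mul, map_star, map_one, exi, ez, ea, e1, mul_one]
    rfl

include hp hq in
theorem toLens_injective : Function.Injective (toLens p q θ β) := by
  refine (injective_iff_map_eq_zero _).2 fun w hw => ?_
  have hw' : w ∈ Submodule.span ℂ (Set.range (family p q)) := by
    rw [span_family hp hq]; trivial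
  refine eq_zero_of_mem_span_of_map_eq_zero (toLens p q θ β).toAlgHom.toLinearMap ?_ hw' hw
  convert! (Lens.linearIndependent_family hp hq θ β).comp
    (Sum.map (fun i : ℕ+ × ℤ => (i.1, i.2, (0 : ℤ))) (fun i : ℕ × ℤ => (i.1, i.2, (0 : ℤ)))) ?_
    using 1
  · funext i
    rcases i with ⟨k, m⟩ | ⟨k, m⟩
    exacts [toLens_family_inl p q θ β k m, toLens_family_inr p q θ β k m]
  · refine Function.Injective.sumMap ?_ ?_ <;>
    · rintro ⟨k, m⟩ ⟨k', m'⟩ h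
      simp only [Prod.mk.injEq, and_true] at h
      rw [h.1, h.2]

/-- The quantum sphere maps to the coinvariants of the quantum lens space. -/
def toCoinvariants : Sphere p q →⋆ₐ[ℂ] coinvariants (Lens.coaction p q θ β) :=
  (toLens p q θ β).codRestrict _ (by
    have hxi : toLens p q θ β (xi p q) ∈ coinvariants (Lens.coaction p q θ β) := by
      rw [toLens_xi]; exact Lens.coaction_xi θ β
    have hz : toLens p q θ β (z p q) ∈ coinvariants (Lens.coaction p q θ β) := by
      rw [toLens_z]; exact Lens.coaction_z θ β
    refine Presented.mem_of_gen_mem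
      ((coinvariants (Lens.coaction p q θ β)).toSubalgebra.comap (toLens p q θ β).toAlgHom) ?_ ?_
    · rintro ⟨⟩
      exacts [hxi, hz]
    · rintro ⟨⟩
      · change toLens p q θ β (star (xi p q)) ∈ coinvariants (Lens.coaction p q θ β)
        rw [map_star]
        exact star_mem hxi
      · change toLens p q θ β (star (z p q)) ∈ coinvariants (Lens.coaction p q θ β)
        rw [map_star]
        exact star_mem hz)

include hp hq in
theorem toCoinvariants_bijective : Function.Bijective (toCoinvariants (p := p) (q := q) θ β) := by
  refine ⟨fun v w h => toLens_injective θ β hp hq (congrArg Subtype.val h), ?_⟩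
  rintro ⟨w, hw⟩
  have hle : Submodule.span ℂ (Lens.family p q θ β '' {i | Lens.degree i = 0}) ≤
      LinearMap.range (toLens p q θ β).toAlgHom.toLinearMap := by
    refine Submodule.span_le.2 ?_
    rintro _ ⟨⟨k, m, n⟩ | ⟨k, m, n⟩, hi, rfl⟩
    · obtain rfl : n = 0 := neg_eq_zero.1 hi
      exact ⟨_, toLens_family_inl p q θ β k m⟩
    · obtain rfl : n = 0 := hi
      exact ⟨_, toLens_family_inr p q θ β k m⟩
  obtain ⟨v, hv⟩ := hle (Lens.mem_span_of_mem_coinvariants hp hq θ β hw)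
  exact ⟨v, Subtype.ext hv⟩

end Sphere

end Sphere

/-! ## The quantum sphere as a gluing of quantum discs -/

namespace Disc

theorem star_x_mul (p : ℝ) : star (x p) * x p - (p : ℂ) • (x p * star (x p)) =
    (1 - p : ℂ) • 1 := by
  simpa only [x, map_sub, map_smul, map_mul, map_star, map_one, Presented.projStar_of] using
    Presented.projStar_eq (DiscRel.disc (p := p))

/-- The inclusion of the quantum disc into the quantum solid torus. -/
def toSolid (p θ : ℝ) : Disc p →⋆ₐ[ℂ] Solid p θ :=
  Presented.lift (fun _ => Solid.x p θ) (by
    rintro _ _ ⟨⟩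
    simpa only [map_sub, map_smul, map_mul, map_star, map_one, FreeStar.lift_of] using
      Solid.star_x_mul p θ)

/-- The projection of the untwisted solid torus onto the quantum disc. -/
def ofSolid (p : ℝ) : Solid p 0 →⋆ₐ[ℂ] Disc p :=
  Presented.lift (fun | .x => x p | .h => 1) (by
    rintro _ _ ⟨⟩ <;>
    simp only [map_sub, map_smul, map_mul, map_star, map_one, FreeStar.lift_of, star_one, mul_one,
      one_mul, neg_zero, phase_zero, one_smul]
    exact star_x_mul p)

theorem toSolid_x (p θ : ℝ) : toSolid p θ (x p) = Solid.x p θ := Presented.lift_gen _ _ _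
theorem ofSolid_x (p : ℝ) : ofSolid p (Solid.x p 0) = x p := Presented.lift_gen _ _ _
theorem ofSolid_h (p : ℝ) : ofSolid p (Solid.h p 0) = 1 := Presented.lift_gen _ _ _
theorem boundary_x (p : ℝ) : boundary p (x p) = u 1 := Presented.lift_gen _ _ _

theorem boundary_spow_x (p : ℝ) (m : ℤ) : boundary p (spow (x p) m) = u m := by
  rw [map_spow, boundary_x]
  cases m with
  | ofNat n => rw [spow, u_pow, mul_one]; rfl
  | negSucc n =>
    rw [spow, star_u, u_pow, Int.negSucc_eq]
    congr 1
    push_cast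
    ring

theorem linearIndependent_u : LinearIndependent ℂ u := by
  rw [linearIndependent_iff']
  intro F g hF n hn
  have h := congrArg (fun f => Lens.constCoeff (f * u (-n))) hF
  simp only [Finset.sum_mul, smul_mul_assoc, u_mul, map_sum, map_smul, Lens.constCoeff_u, zero_mul,
    map_zero, add_neg_eq_zero, smul_eq_mul, mul_ite, mul_one, mul_zero, Finset.sum_ite_eq',
    hn, if_true] at h
  exact h

theorem exists_eq_mul_of_boundary_eq_zero {q : ℝ} (hq : q ≠ 0) {w : Disc q}
    (hw : boundary q w = 0) : ∃ w', w = (1 - x q * star (x q)) * w' := by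
  have hs : Function.Surjective (ofSolid q) := by
    refine Presented.hom_surjective _ ?_
    rintro ⟨⟩
    exact ⟨_, ofSolid_x q⟩
  obtain ⟨w, rfl⟩ := hs w
  obtain ⟨v, hv, w', rfl⟩ := Solid.exists_add_s_mul hq 0 w
  have hsv : ofSolid q (Solid.s q 0) = 1 - x q * star (x q) := by
    rw [Solid.s, map_sub, map_mul, map_star, map_one, ofSolid_x]
  have hb : boundary q (1 - x q * star (x q)) = 0 := by
    rw [map_sub, map_mul, map_star, map_one, boundary_x, star_u, u_mul, add_neg_cancel, u_zero,
      sub_self]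
  rw [map_add, map_mul, hsv, map_add, map_mul, hb, zero_mul, add_zero] at hw
  have e1 : ∀ n, spow (1 : Disc q) n = 1 := by
    rintro (n | n) <;> simp [spow]
  have hv' : ofSolid q v ∈ Submodule.span ℂ (Set.range fun m : ℤ => spow (x q) m) := by
    have hle : Submodule.span ℂ (Set.range fun i : ℤ × ℤ => Solid.mono q 0 (0, i)) ≤
        (Submodule.span ℂ (Set.range fun m : ℤ => spow (x q) m)).comap
          (ofSolid q).toAlgHom.toLinearMap := by
      refine Submodule.span_le.2 ?_
      rintro _ ⟨⟨m, n⟩, rfl⟩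
      refine Submodule.subset_span ⟨m, ?_⟩
      change _ = ofSolid q (Solid.mono q 0 (0, m, n))
      rw [Solid.mono_eq, pow_zero, one_mul, map_mul, map_spow, map_spow, ofSolid_x, ofSolid_h, e1,
        mul_one]
    exact hle hv
  refine ⟨ofSolid q w', ?_⟩
  rw [map_add, map_mul, hsv, eq_zero_of_mem_span_of_map_eq_zero (boundary q).toAlgHom.toLinearMap
    ?_ hv' hw, zero_add]
  convert! linearIndependent_u using 1
  exact funext (boundary_spow_x q)

end Disc

namespace Sphere

variable (p q : ℝ)

/-- The restriction of the quantum sphere to the first quantum disc. -/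
def fst : Sphere p q →⋆ₐ[ℂ] Disc p :=
  Presented.lift (fun | .xi => 1 - Disc.x p * star (Disc.x p) | .z => Disc.x p) (by
    have h := sub_eq_iff_eq_add.1 (Disc.star_x_mul p)
    rintro _ _ ⟨⟩ <;>
    simp only [map_sub, map_one, map_zero, map_star, map_mul, map_smul, FreeStar.lift_of]
    · rw [star_sub, star_mul, star_star, star_one]
    · rw [sub_mul, mul_assoc, h, mul_sub, mul_add, one_mul, mul_one, mul_smul_comm, mul_smul_comm,
        mul_one, sub_smul, one_smul, smul_sub]
      abel
    · rw [h]
      simp only [sub_smul, smul_sub, one_smul]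
      abel
    · rw [sub_self, zero_mul])

/-- The restriction of the quantum sphere to the second quantum disc. -/
def snd : Sphere p q →⋆ₐ[ℂ] Disc q :=
  Presented.lift (fun | .xi => 0 | .z => Disc.x q) (by
    rintro _ _ ⟨⟩ <;>
    simp only [map_sub, map_one, map_zero, map_star, map_mul, map_smul, FreeStar.lift_of,
      star_zero, zero_mul, mul_zero, smul_zero, sub_zero]
    exact Disc.star_x_mul q)

theorem fst_xi : fst p q (xi p q) = 1 - Disc.x p * star (Disc.x p) := Presented.lift_gen _ _ _
theorem fst_z : fst p q (z p q) = Disc.x p := Presented.lift_gen _ _ _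
theorem snd_xi : snd p q (xi p q) = 0 := Presented.lift_gen _ _ _
theorem snd_z : snd p q (z p q) = Disc.x q := Presented.lift_gen _ _ _

theorem boundary_fst_eq (w : Sphere p q) :
    Disc.boundary p (fst p q w) = Disc.boundary q (snd p q w) := by
  refine Presented.hom_ext (f := (Disc.boundary p).comp (fst p q))
    (g := (Disc.boundary q).comp (snd p q)) ?_ w
  rintro ⟨⟩
  · change Disc.boundary p (fst p q (xi p q)) = Disc.boundary q (snd p q (xi p q))
    rw [fst_xi, snd_xi, map_zero, map_sub, map_mul, map_star, map_one, Disc.boundary_x, star_u,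
      u_mul, add_neg_cancel, u_zero, sub_self]
  · change Disc.boundary p (fst p q (z p q)) = Disc.boundary q (snd p q (z p q))
    rw [fst_z, snd_z, Disc.boundary_x, Disc.boundary_x]

/-- The `*`-homomorphism from the quantum sphere to the gluing of two quantum discs. -/
def toGlue : Sphere p q →⋆ₐ[ℂ] glue (Disc.boundary p) (Disc.boundary q) :=
  ((fst p q).prod (snd p q)).codRestrict _ (boundary_fst_eq p q)

theorem coe_toGlue (w : Sphere p q) : (toGlue p q w : Disc p × Disc q) = (fst p q w, snd p q w) :=
  rfl

variable {p q} (hp : 0 < p) (hq : 0 < q)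

theorem toSolid_fst (w : Sphere p q) :
    Disc.toSolid p 0 (fst p q w) = Lens.fst hp hq 0 0 (toLens p q 0 0 w) := by
  refine Presented.hom_ext (f := (Disc.toSolid p 0).comp (fst p q))
    (g := (Lens.fst hp hq 0 0).comp (toLens p q 0 0)) ?_ w
  rintro ⟨⟩
  · change Disc.toSolid p 0 (fst p q (xi p q)) = Lens.fst hp hq 0 0 (toLens p q 0 0 (xi p q))
    rw [fst_xi, toLens_xi, Lens.fst_xi, map_sub, map_mul, map_star, map_one, Disc.toSolid_x]
    rfl
  · change Disc.toSolid p 0 (fst p q (z p q)) = Lens.fst hp hq 0 0 (toLens p q 0 0 (z p q))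
    rw [fst_z, toLens_z, Lens.fst_z, Disc.toSolid_x]

theorem toSolid_snd (w : Sphere p q) :
    Disc.toSolid q 0 (snd p q w) = Lens.snd hp hq 0 0 (toLens p q 0 0 w) := by
  refine Presented.hom_ext (f := (Disc.toSolid q 0).comp (snd p q))
    (g := (Lens.snd hp hq 0 0).comp (toLens p q 0 0)) ?_ w
  rintro ⟨⟩
  · change Disc.toSolid q 0 (snd p q (xi p q)) = Lens.snd hp hq 0 0 (toLens p q 0 0 (xi p q))
    rw [snd_xi, toLens_xi, Lens.snd_xi, map_zero]
  · change Disc.toSolid q 0 (snd p q (z p q)) = Lens.snd hp hq 0 0 (toLens p q 0 0 (z p q))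
    rw [snd_z, toLens_z, Lens.snd_z, Disc.toSolid_x]

include hp hq in
theorem toGlue_bijective : Function.Bijective (toGlue p q) := by
  refine ⟨(injective_iff_map_eq_zero _).2 fun w hw => ?_, ?_⟩
  · have e := congrArg Subtype.val hw
    rw [coe_toGlue] at e
    have h1 : fst p q w = 0 := congrArg Prod.fst e
    have h2 : snd p q w = 0 := congrArg Prod.snd e
    refine (injective_iff_map_eq_zero _).1 (toLens_injective 0 0 hp hq) w
      (Lens.eq_zero_of_fst_of_snd hp hq 0 0 ?_ ?_)
    · rw [← toSolid_fst, h1, map_zero]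
    · rw [← toSolid_snd, h2, map_zero]
  · rintro ⟨⟨v, w⟩, h⟩
    rw [mem_glue] at h
    have hs1 : Function.Surjective (fst p q) := by
      refine Presented.hom_surjective _ ?_
      rintro ⟨⟩
      exact ⟨_, fst_z p q⟩
    have hs2 : Function.Surjective (snd p q) := by
      refine Presented.hom_surjective _ ?_
      rintro ⟨⟩
      exact ⟨_, snd_z p q⟩
    obtain ⟨l, rfl⟩ := hs1 v
    have hk : Disc.boundary q (w - snd p q l) = 0 := by
      rw [map_sub, ← h, boundary_fst_eq, sub_self]
    obtain ⟨w', hw'⟩ := Disc.exists_eq_mul_of_boundary_eq_zero hq.ne' hk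
    obtain ⟨l', rfl⟩ := hs2 w'
    refine ⟨l + (1 - z p q * star (z p q) - xi p q) * l', Subtype.ext ?_⟩
    rw [coe_toGlue]
    simp only [map_add, map_mul, map_sub, map_star, map_one, fst_z, fst_xi, snd_z, snd_xi, sub_self,
      zero_mul, add_zero, sub_zero]
    rw [← hw', add_sub_cancel]

end Sphere

end QLens

end

open QLens in
theorem mainTheorem6 (p q θ : ℝ) (hp0 : 0 < p) (hp1 : p < 1) (hq0 : 0 < q) (hq1 : q < 1)
    (β : ℕ) :
    -- the family is a linear basis of the algebra defined by generators and relations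
    (LinearIndependent ℂ (Lens.family p q θ β) ∧
      Submodule.span ℂ (Set.range (Lens.family p q θ β)) = ⊤) ∧
    -- the algebra is a comodule, isomorphic to the gluing of two quantum solid tori
    IsCoaction (Lens.coaction p q θ β) ∧
    (∃ χ : Lens p q θ β ≃⋆ₐ[ℂ] glue (chi12 p θ) (chi21 q θ β),
      (χ (Lens.xi p q θ β) : Solid p θ × Solid q θ) =
        (1 - Solid.x p θ * star (Solid.x p θ), 0) ∧
      (χ (Lens.z p q θ β) : Solid p θ × Solid q θ) = (Solid.x p θ, Solid.x q θ) ∧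
      (χ (Lens.a p q θ β) : Solid p θ × Solid q θ) =
        (phase (β * θ / 2) • (Solid.x p θ ^ β * Solid.h p θ), Solid.h q θ) ∧
      (χ (Lens.b p q θ β) : Solid p θ × Solid q θ) =
        (phase (β * θ / 2) • star (Solid.h p θ), Solid.x q θ ^ β * star (Solid.h q θ)) ∧
      IsColinear (Lens.coaction p q θ β) (Solid.coaction p θ)
        ((glueFst (chi12 p θ) (chi21 q θ β)).comp χ.toStarAlgHom) ∧
      IsColinear (Lens.coaction p q θ β) (Solid.coaction q θ)
        ((glueSnd (chi12 p θ) (chi21 q θ β)).comp χ.toStarAlgHom)) ∧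
    -- the coinvariants are the quantum sphere, which is the gluing of two quantum discs
    (∃ e : Sphere p q ≃⋆ₐ[ℂ] coinvariants (Lens.coaction p q θ β),
      (e (Sphere.xi p q) : Lens p q θ β) = Lens.xi p q θ β ∧
      (e (Sphere.z p q) : Lens p q θ β) = Lens.z p q θ β) ∧
    (∃ e : Sphere p q ≃⋆ₐ[ℂ] glue (Disc.boundary p) (Disc.boundary q),
      (e (Sphere.xi p q) : Disc p × Disc q) = (1 - Disc.x p * star (Disc.x p), 0) ∧
      (e (Sphere.z p q) : Disc p × Disc q) = (Disc.x p, Disc.x q)) := by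
  refine ⟨⟨Lens.linearIndependent_family hp0 hq0 θ β, Lens.span_family hp0 hq0 θ β⟩,
    Lens.isCoaction hp0 hq0 θ β, ?_, ?_, ?_⟩
  · refine ⟨StarAlgEquiv.ofBijective (Lens.toGlue hp0 hq0 θ β)
      (Lens.toGlue_bijective hp0 hq0 θ β), ?_, ?_, ?_, ?_,
      Lens.isColinear_fst hp0 hq0 θ β, Lens.isColinear_snd hp0 hq0 θ β⟩
    · exact Prod.ext (Lens.fst_xi hp0 hq0 θ β) (Lens.snd_xi hp0 hq0 θ β)
    · exact Prod.ext (Lens.fst_z hp0 hq0 θ β) (Lens.snd_z hp0 hq0 θ β)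
    · exact Prod.ext (Lens.fst_a hp0 hq0 θ β) (Lens.snd_a hp0 hq0 θ β)
    · exact Prod.ext (Lens.fst_b hp0 hq0 θ β) (Lens.snd_b hp0 hq0 θ β)
  · exact ⟨StarAlgEquiv.ofBijective (Sphere.toCoinvariants θ β)
      (Sphere.toCoinvariants_bijective θ β hp0 hq0), Sphere.toLens_xi p q θ β,
      Sphere.toLens_z p q θ β⟩
  · exact ⟨StarAlgEquiv.ofBijective (Sphere.toGlue p q) (Sphere.toGlue_bijective hp0 hq0),
      Prod.ext (Sphere.fst_xi p q) (Sphere.snd_xi p q),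
      Prod.ext (Sphere.fst_z p q) (Sphere.snd_z p q)⟩
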